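/- **Theorem (self-adjointness).** Let $m_Z>0$, $\omega(p)=p$ and $\omega_3(k)=\sqrt{|k|^2+m_Z^2}$. Let $\mathbb R_+=[0,\infty)$, let $\Gamma$ be the set of $\gamma=(j,m_j,\kappa_j)$ with $j\in\mathbb N+\frac12$ (so $j\geq\frac12$), $m_j\in\{-j,\dots,j\}$, $\kappa_j\in\{\pm(j+\frac12)\}$, and let $\Sigma=\mathbb R_+\times\Gamma$, $\Sigma_3=\mathbb R^3\times\{-1,0,1\}$, with Lebesgue times counting measure. Let $\mathcal H=\mathfrak F_a(L^2(\Sigma))\otimes\mathfrak F_a(L^2(\Sigma))\otimes\mathfrak F_s(L^2(\Sigma_3))$, where $\mathfrak F_a,\mathfrak F_s$ are the antisymmetric and symmetric Fock spaces, with annihilation operators $b_+(\xi_1)$, $b_-(\xi_2)$, $a(\xi_3)$ for the three factors, satisfying the usual canonical (anti)commutation relations, $b_+^\sharp$ anticommuting with $b_-^\sharp$. Let $$H_0=\mathrm d\Gamma(\omega)\otimes 1\otimes 1+1\otimes \mathrm d\Gamma(\omega)\otimes 1+1\otimes 1\otimes \mathrm d\Gamma(\omega_3).$$ *Dirac spherical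 waves.* For $\gamma_j=j+\frac12$ put $$g_{j+\frac12,+}(p,r)=-\frac{p}{\sqrt\pi}\frac{(2pr)^{\gamma_j-1}}{\Gamma(\gamma_j)}\,2\int_0^1\sin(pr(2u-1))\,u^{\gamma_j}(1-u)^{\gamma_j-1}du,$$ let $f_{j+\frac12,+}$ be the same expression with $\cos$ in place of $\sin$, and set $g_{j+\frac12,-}=f_{-(j+\frac12),+}=-f_{-(j+\frac12),-}=g_{j+\frac12,+}$ and $-g_{-(j+\frac12),\pm}=-f_{j+\frac12,-}=f_{j+\frac12,+}$. With the usual spherical harmonics $Y_{l,m}$ (Condon–Shortley phase) let $$\Phi^{(1)}_{m_j,j+\frac12}=\begin{pmatrix}-\sqrt{\tfrac{j-m_j+1}{2j+2}}\,Y_{j+\frac12,m_j-\frac12}\\ \sqrt{\tfrac{j+m_j+1}{2j+2}}\,Y_{j+\frac12,m_j+\frac12}\end{pmatrix},\qquad \Phi^{(1)}_{m_j,-(j+\frac12)}=\begin{pmatrix}\sqrt{\tfrac{j+m_j}{2j}}\,Y_{j-\frac12,m_j-\frac12}\\ \sqrt{\tfrac{j-m_j}{2j}}\,Y_{j-\frac12,m_j+\frac12}\end{pmatrix},$$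 $\Phi^{(2)}_{m_j,\kappa_j}=\Phi^{(1)}_{m_j,-\kappa_j}$, and, for $\xi=(p,\gamma)$, $\psi_\pm(\xi,x)=\big(i\,g_{\kappa_j,\pm}(p,|x|)\,\Phi^{(1)}_{m_j,\kappa_j}(x/|x|),\;-f_{\kappa_j,\pm}(p,|x|)\,\Phi^{(2)}_{m_j,\kappa_j}(x/|x|)\big)\in\mathbb C^4$ (these satisfy $-i\boldsymbol\alpha\cdot\nabla\psi_\pm=\pm p\,\psi_\pm$), and $\widetilde\psi_-((p,(j,m_j,\kappa_j)),x)=\psi_-((p,(j,-m_j,-\kappa_j)),x)$. *Interaction.* Let $\gamma^\mu$, $\gamma_5=i\gamma^0\gamma^1\gamma^2\gamma^3$ be the Dirac matrices in the standard representation and $\overline\psi=\psi^\dagger\gamma^0$. Let $\varepsilon_\mu(k,\lambda)$, $\lambda\in\{-1,0,1\}$, be polarization vectors of a spin-one particle of mass $m_Z$, depending measurably on $k$: with the metric $(+,-,-,-)$, $\omega_3(k)\,\varepsilon_0(k,\lambda)+\sum_{i=1}^3k_i\,\varepsilon_i(k,\lambda)=0$ and $\overline{\varepsilon_\mu(k,\lambda)}\,\varepsilon^\mu(k,\lambda')=-\delta_{\lambda\lambda'}$.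 Given $f:[0,\infty)\to\mathbb C$ and measurable $G^{(1)},G^{(2)}:\Sigma\times\Sigma\times\Sigma_3\to\mathbb C$, put $F^{(l)}=h^{(l)}G^{(l)}$, where, for $\xi_3=(k,\lambda)$ and with summation over $\mu$, $$h^{(1)}(\xi_1,\xi_2,\xi_3)=\int_{\mathbb R^3} f(|x|)\,\overline{\psi_+}(\xi_1,x)\gamma^\mu(1-\gamma_5)\widetilde\psi_-(\xi_2,x)\,\frac{\varepsilon_\mu(\xi_3)}{\sqrt{2\omega_3(k)}}\,e^{ik\cdot x}\,dx,$$ and $h^{(2)}$ is given by the same formula with $\overline{\varepsilon_\mu(\xi_3)}$ and $e^{-ik\cdot x}$ in place of $\varepsilon_\mu(\xi_3)$ and $e^{ik\cdot x}$. Let $$H_I=H_I^{(1)}+H_I^{(2)}+(H_I^{(1)})^*+(H_I^{(2)})^*,$$ $$H_I^{(1)}=\int F^{(1)}\,b_+^*(\xi_1)b_-^*(\xi_2)a(\xi_3)\,d\xi_1d\xi_2d\xi_3,\qquad H_I^{(2)}=\int F^{(2)}\,b_+^*(\xi_1)b_-^*(\xi_2)a^*(\xi_3)\,d\xi_1d\xi_2d\xi_3,$$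 each of $H_I^{(1)},H_I^{(2)}$ being taken on its maximal domain, and sums of operators on the intersection of the domains. Assume that (i) $f\in C^\infty([0,\infty))$ and there is $\Lambda>0$ with $f(r)=0$ for all $r>\Lambda$; (ii) $G^{(1)}$ and $G^{(2)}$ are bounded; (iii) there is a compact set $K\subset\mathbb R_+\times\mathbb R_+\times\mathbb R^3$ such that, for $l=1,2$ and all $\gamma_1,\gamma_2\in\Gamma$, $\lambda\in\{-1,0,1\}$, $G^{(l)}((p_1,\gamma_1),(p_2,\gamma_2),(k,\lambda))=0$ whenever $(p_1,p_2,k)\notin K$. Then there exists $g_0>0$ such that, for all $0\le g\le g_0$, the operator $H=H_0+gH_I$ is self-adjoint with domain $\mathfrak D(H)=\mathfrak D(H_0)$. -/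

import Mathlib

open MeasureTheory
open scoped NNReal ContDiff

noncomputable section

namespace ZDecay

/-! ## Quantum variables -/

/-- The set `Γ` of angular momentum quantum numbers `(j, m_j, κ_j)`: the label `(n, a, s)` stands for
`j = n + 1/2`, `m_j = -j + a` with `0 ≤ a ≤ 2j`, and `κ_j = j + 1/2` if `s = true`,
`κ_j = -(j + 1/2)` if `s = false`. -/
@[ext]
structure AngLabel where
  n : ℕ
  a : Fin (2 * n + 2)
  s : Bool

namespace AngLabel

/-- The quantum number `j = n + 1/2`. -/
def j (c : AngLabel) : ℝ := c.n + 1 / 2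

/-- The quantum number `m_j = -j + a`. -/
def mj (c : AngLabel) : ℝ := -c.j + (c.a : ℕ)

/-- The label `(j, -m_j, -κ_j)`. -/
def neg (c : AngLabel) : AngLabel := ⟨c.n, c.a.rev, !c.s⟩

/-- `(n, a, s)` as an element of a sigma type. -/
def equivSigma : AngLabel ≃ (Σ n : ℕ, Fin (2 * n + 2) × Bool) where
  toFun c := ⟨c.n, c.a, c.s⟩
  invFun c := ⟨c.1, c.2.1, c.2.2⟩
  left_inv _ := rfl
  right_inv _ := rfl

instance : Countable AngLabel := equivSigma.countable_iff.mpr inferInstance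

/-- `Γ` carries the counting measure. -/
instance : MeasureSpace AngLabel where
  toMeasurableSpace := ⊤
  volume := @Measure.count _ ⊤

instance : DiscreteMeasurableSpace AngLabel := ⟨fun _ => trivial⟩

instance : SigmaFinite (volume : Measure AngLabel) :=
  inferInstanceAs (SigmaFinite (Measure.count : Measure AngLabel))

end AngLabel

/-- The polarization index `λ ∈ {-1, 0, 1}`. -/
inductive Pol
  | minus
  | zero
  | plus
  deriving DecidableEq

namespace Pol

instance : Fintype Pol := ⟨{minus, zero, plus}, fun x => by cases x <;> simp⟩

/-- `{-1, 0, 1}` carries the counting measure. -/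
instance : MeasureSpace Pol where
  toMeasurableSpace := ⊤
  volume := @Measure.count _ ⊤

instance : DiscreteMeasurableSpace Pol := ⟨fun _ => trivial⟩

instance : SigmaFinite (volume : Measure Pol) :=
  inferInstanceAs (SigmaFinite (Measure.count : Measure Pol))

end Pol

/-- Euclidean three-space. -/
abbrev R3 := EuclideanSpace ℝ (Fin 3)

/-- The half-line `ℝ₊ = [0, ∞)` carries Lebesgue measure. -/
instance : MeasureSpace ℝ≥0 where
  volume := Measure.comap ((↑) : ℝ≥0 → ℝ) volume

instance : SigmaFinite (volume : Measure ℝ≥0) := by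
  refine SigmaFinite.of_map _ measurable_subtype_coe.aemeasurable
    (f := ((↑) : ℝ≥0 → ℝ)) ?_
  change SigmaFinite (Measure.map _ (Measure.comap _ volume))
  have h : MeasurableEmbedding ((↑) : ℝ≥0 → ℝ) :=
    MeasurableEmbedding.subtype_coe measurableSet_Ici
  rw [h.map_comap]
  infer_instance

/-- `Σ = ℝ₊ × Γ`, with Lebesgue measure times counting measure. -/
abbrev Lepton := ℝ≥0 × AngLabel

/-- `Σ₃ = ℝ³ × {-1, 0, 1}`, with Lebesgue measure times counting measure. -/
abbrev Boson := R3 × Pol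

instance : SigmaFinite (volume : Measure Lepton) := inferInstance

instance : SigmaFinite (volume : Measure Boson) := inferInstance

/-- The dispersion relation `ω₃(k) = √(|k|² + m²)` of the boson of mass `m`. -/
def omega3 (m : ℝ) (k : R3) : ℝ := √(‖k‖ ^ 2 + m ^ 2)

/-! ## Fock space -/

/-- Configurations of `n` neutrinos, `m` antineutrinos and `l` bosons. -/
abbrev Config (n m l : ℕ) := (Fin n → Lepton) × (Fin m → Lepton) × (Fin l → Boson)

instance (n m l : ℕ) : SigmaFinite (volume : Measure (Config n m l)) := inferInstance

/-- Relabelling of the particles in a configuration. -/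
def relabel {n m l : ℕ} (σ : Equiv.Perm (Fin n)) (τ : Equiv.Perm (Fin m))
    (π : Equiv.Perm (Fin l)) (c : Config n m l) : Config n m l :=
  (c.1 ∘ σ, c.2.1 ∘ τ, c.2.2 ∘ π)

theorem measurePreserving_relabel {n m l : ℕ} (σ : Equiv.Perm (Fin n)) (τ : Equiv.Perm (Fin m))
    (π : Equiv.Perm (Fin l)) : MeasurePreserving (relabel σ τ π) := by
  have key : ∀ {X : Type} [MeasureSpace X] [SigmaFinite (volume : Measure X)] {k : ℕ}
      (ρ : Equiv.Perm (Fin k)), MeasurePreserving (fun x : Fin k → X => x ∘ ρ) := by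
    intro X _ _ k ρ
    have h := volume_measurePreserving_piCongrLeft (fun _ : Fin k => X) ρ.symm
    have e : (fun x : Fin k → X => x ∘ ρ) =
        MeasurableEquiv.piCongrLeft (fun _ : Fin k => X) ρ.symm := by
      funext x i
      obtain ⟨i, rfl⟩ := ρ.symm.surjective i
      rw [MeasurableEquiv.coe_piCongrLeft, Equiv.piCongrLeft_apply_apply]
      simp
    rw [e]
    exact h
  exact (key σ).prod ((key τ).prod (key π))

/-- The `(n, m, l)`-particle space `(⊗ₐⁿ L²(Σ)) ⊗ (⊗ₐᵐ L²(Σ)) ⊗ (⊗ₛˡ L²(Σ₃))`: square integrable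
functions that are antisymmetric in the neutrino variables, antisymmetric in the antineutrino
variables and symmetric in the boson variables. -/
def sector (n m l : ℕ) : Submodule ℂ (Lp ℂ 2 (volume : Measure (Config n m l))) where
  carrier := {ψ | ∀ (σ : Equiv.Perm (Fin n)) (τ : Equiv.Perm (Fin m)) (π : Equiv.Perm (Fin l)),
    ∀ᵐ c : Config n m l,
      ψ (relabel σ τ π c) = ((σ.sign : ℤ) : ℂ) * ((τ.sign : ℤ) : ℂ) * ψ c}
  add_mem' {ψ φ} hψ hφ σ τ π := by
    have h := Lp.coeFn_add ψ φ
    filter_upwards [hψ σ τ π, hφ σ τ π, h,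
      (measurePreserving_relabel σ τ π).quasiMeasurePreserving.ae h] with c h1 h2 h3 h4
    rw [h3, h4, Pi.add_apply, Pi.add_apply, h1, h2, mul_add]
  zero_mem' σ τ π := by
    have h := Lp.coeFn_zero ℂ 2 (volume : Measure (Config n m l))
    filter_upwards [h, (measurePreserving_relabel σ τ π).quasiMeasurePreserving.ae h] with c h1 h2
    rw [h1, h2]
    simp
  smul_mem' z ψ hψ σ τ π := by
    have h := Lp.coeFn_smul z ψ
    filter_upwards [hψ σ τ π, h,
      (measurePreserving_relabel σ τ π).quasiMeasurePreserving.ae h] with c h1 h2 h3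
    rw [h2, h3, Pi.smul_apply, Pi.smul_apply, h1, smul_eq_mul, smul_eq_mul]
    ring

theorem isClosed_sector (n m l : ℕ) :
    IsClosed (sector n m l : Set (Lp ℂ 2 (volume : Measure (Config n m l)))) := by
  have h : (sector n m l : Set (Lp ℂ 2 (volume : Measure (Config n m l)))) =
      ⋂ (σ : Equiv.Perm (Fin n)) (τ : Equiv.Perm (Fin m)) (π : Equiv.Perm (Fin l)),
        {ψ | Lp.compMeasurePreserving _ (measurePreserving_relabel σ τ π) ψ =
          (((σ.sign : ℤ) : ℂ) * ((τ.sign : ℤ) : ℂ)) • ψ} := by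
    ext ψ
    simp only [Set.mem_iInter, Set.mem_ofPred_eq]
    refine forall_congr' fun σ => forall_congr' fun τ => forall_congr' fun π => ?_
    have h1 := Lp.coeFn_compMeasurePreserving ψ (measurePreserving_relabel σ τ π)
    have h2 := Lp.coeFn_smul (((σ.sign : ℤ) : ℂ) * ((τ.sign : ℤ) : ℂ)) ψ
    constructor
    · intro h
      apply Lp.ext
      filter_upwards [h, h1, h2] with c h h1 h2
      rw [h1, h2, Function.comp_apply, h]
      rfl
    · intro h
      rw [h] at h1
      filter_upwards [h1, h2] with c h1 h2
      rw [h2] at h1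
      exact h1.symm
  rw [h]
  refine isClosed_iInter fun σ => isClosed_iInter fun τ => isClosed_iInter fun π => ?_
  exact isClosed_eq
    (Lp.isometry_compMeasurePreserving (measurePreserving_relabel σ τ π)).continuous
    (continuous_const_smul _)

instance (n m l : ℕ) : CompleteSpace (sector n m l) := (isClosed_sector n m l).completeSpace_coe

/-- The total Fock space `𝔉ₐ(L²(Σ)) ⊗ 𝔉ₐ(L²(Σ)) ⊗ 𝔉ₛ(L²(Σ₃))`, as the Hilbert sum of the
`(n, m, l)`-particle spaces. -/
abbrev Fock := lp (fun ν : ℕ × ℕ × ℕ => sector ν.1 ν.2.1 ν.2.2) 2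

/-- The `(n, m, l)`-particle wave function of a vector of the Fock space. -/
def wave (ψ : Fock) (n m l : ℕ) : Config n m l → ℂ :=
  ((ψ (n, m, l) : sector n m l) : Lp ℂ 2 (volume : Measure (Config n m l)))

theorem wave_add (ψ φ : Fock) (n m l : ℕ) :
    ∀ᵐ c, wave (ψ + φ) n m l c = wave ψ n m l c + wave φ n m l c :=
  Lp.coeFn_add _ _

theorem wave_smul (z : ℂ) (ψ : Fock) (n m l : ℕ) :
    ∀ᵐ c, wave (z • ψ) n m l c = z * wave ψ n m l c :=
  Lp.coeFn_smul _ _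

theorem wave_zero (n m l : ℕ) : ∀ᵐ c, wave 0 n m l c = 0 :=
  Lp.coeFn_zero _ _ _

/-! ## The free Hamiltonian -/

/-- The total energy `∑ ω(p₁) + ∑ ω(p₂) + ∑ ω₃(k)` of a configuration, where `ω(p) = p`. -/
def energy (mZ : ℝ) {n m l : ℕ} (c : Config n m l) : ℝ :=
  ∑ i, ((c.1 i).1 : ℝ) + ∑ i, ((c.2.1 i).1 : ℝ) + ∑ i, omega3 mZ (c.2.2 i).1

/-- `φ` is `ψ` multiplied by the total energy in each `(n, m, l)`-particle space. -/
def FreeRel (mZ : ℝ) (ψ φ : Fock) : Prop :=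
  ∀ n m l, ∀ᵐ c : Config n m l, wave φ n m l c = (energy mZ c : ℂ) * wave ψ n m l c

/-- The graph of the free Hamiltonian. -/
def freeGraph (mZ : ℝ) : Submodule ℂ (Fock × Fock) where
  carrier := {q | FreeRel mZ q.1 q.2}
  add_mem' {p q} := by
    intro (hp : FreeRel mZ p.1 p.2) (hq : FreeRel mZ q.1 q.2)
    change FreeRel mZ (p.1 + q.1) (p.2 + q.2)
    intro n m l
    filter_upwards [hp n m l, hq n m l, wave_add p.1 q.1 n m l, wave_add p.2 q.2 n m l]
      with c h1 h2 h3 h4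
    linear_combination h4 + h1 + h2 - (energy mZ c : ℂ) * h3
  zero_mem' := by
    change FreeRel mZ 0 0
    intro n m l
    filter_upwards [wave_zero n m l] with c h
    linear_combination (1 - (energy mZ c : ℂ)) * h
  smul_mem' z q := by
    intro (hq : FreeRel mZ q.1 q.2)
    change FreeRel mZ (z • q.1) (z • q.2)
    intro n m l
    filter_upwards [hq n m l, wave_smul z q.1 n m l, wave_smul z q.2 n m l] with c h1 h2 h3
    linear_combination h3 + z * h1 - (energy mZ c : ℂ) * h2

/-- The free Hamiltonian
`H₀ = dΓ(ω) ⊗ 1 ⊗ 1 + 1 ⊗ dΓ(ω) ⊗ 1 + 1 ⊗ 1 ⊗ dΓ(ω₃)`: multiplication by the total energy in each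
`(n, m, l)`-particle space, on the domain of all `ψ` for which the result lies in the Fock space. -/
def H0 (mZ : ℝ) : Fock →ₗ.[ℂ] Fock := (freeGraph mZ).toLinearPMap

/-! ## Wick monomials -/

/-- Families of wave functions, one for each particle number `(n, m, l)`. -/
abbrev Waves := ∀ n m l : ℕ, Config n m l → ℂ

/-- The annihilation operator `a(ζ)` of the boson. -/
def annZ (ζ : Boson) (Ψ : Waves) : Waves := fun n m l c =>
  (√((l : ℝ) + 1) : ℂ) * Ψ n m (l + 1) (c.1, c.2.1, Fin.cons ζ c.2.2)

/-- `∫ a^*(ζ) Φ(ζ) dζ`, where `a^*(ζ)` is the creation operator of the boson. -/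
def creZ (Φ : Boson → Waves) : Waves
  | _, _, 0, _ => 0
  | n, m, l + 1, c => (√((l : ℝ) + 1) : ℂ)⁻¹ *
      ∑ i : Fin (l + 1), Φ (c.2.2 i) n m l (c.1, c.2.1, i.removeNth c.2.2)

/-- `∫ b₊^*(ξ) Φ(ξ) dξ`, where `b₊^*(ξ)` is the creation operator of the neutrino. -/
def creP (Φ : Lepton → Waves) : Waves
  | 0, _, _, _ => 0
  | n + 1, m, l, c => (√((n : ℝ) + 1) : ℂ)⁻¹ *
      ∑ i : Fin (n + 1), (-1) ^ (i : ℕ) * Φ (c.1 i) n m l (i.removeNth c.1, c.2.1, c.2.2)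

/-- `∫ b₋^*(ξ) Φ(ξ) dξ`, where `b₋^*(ξ)` is the creation operator of the antineutrino. The sign
`(-1)ⁿ`, with `n` the number of neutrinos, makes it anticommute with `b₊` and `b₊^*`. -/
def creM (Φ : Lepton → Waves) : Waves
  | _, 0, _, _ => 0
  | n, m + 1, l, c => (-1) ^ n * (√((m : ℝ) + 1) : ℂ)⁻¹ *
      ∑ i : Fin (m + 1), (-1) ^ (i : ℕ) * Φ (c.2.1 i) n m l (c.1, i.removeNth c.2.1, c.2.2)

/-- `∫ F(ξ₁, ξ₂, ξ₃) b₊^*(ξ₁) b₋^*(ξ₂) a(ξ₃) dξ₁ dξ₂ dξ₃` on wave functions. -/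
def wick1 (F : Lepton → Lepton → Boson → ℂ) (Ψ : Waves) : Waves :=
  creP fun ξ₁ => creM fun ξ₂ => fun n m l c => ∫ ξ₃, F ξ₁ ξ₂ ξ₃ * annZ ξ₃ Ψ n m l c

/-- `∫ F(ξ₁, ξ₂, ξ₃) b₊^*(ξ₁) b₋^*(ξ₂) a^*(ξ₃) dξ₁ dξ₂ dξ₃` on wave functions. -/
def wick2 (F : Lepton → Lepton → Boson → ℂ) (Ψ : Waves) : Waves :=
  creP fun ξ₁ => creM fun ξ₂ => creZ fun ξ₃ => fun n m l c => F ξ₁ ξ₂ ξ₃ * Ψ n m l c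

/-- The integrals over `ξ₃` in `wick1 F Ψ` converge almost everywhere. -/
def Wick1Converges (F : Lepton → Lepton → Boson → ℂ) (Ψ : Waves) : Prop :=
  ∀ n m l, ∀ᵐ c : Config (n + 1) (m + 1) l, ∀ i i',
    Integrable fun ξ₃ => F (c.1 i) (c.2.1 i') ξ₃ *
      annZ ξ₃ Ψ n m l (i.removeNth c.1, i'.removeNth c.2.1, c.2.2)

/-- `φ` is the image of `ψ` under the first Wick monomial; this does not depend on the
representatives `Ψ` chosen for the wave functions of `ψ`. -/
def Wick1Rel (F : Lepton → Lepton → Boson → ℂ) (ψ φ : Fock) : Prop :=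
  ∃ Ψ : Waves, (∀ n m l, ∀ᵐ c, wave ψ n m l c = Ψ n m l c) ∧ Wick1Converges F Ψ ∧
    ∀ n m l, ∀ᵐ c, wave φ n m l c = wick1 F Ψ n m l c

/-- `φ` is the image of `ψ` under the second Wick monomial; this does not depend on the
representatives `Ψ` chosen for the wave functions of `ψ`. -/
def Wick2Rel (F : Lepton → Lepton → Boson → ℂ) (ψ φ : Fock) : Prop :=
  ∃ Ψ : Waves, (∀ n m l, ∀ᵐ c, wave ψ n m l c = Ψ n m l c) ∧
    ∀ n m l, ∀ᵐ c, wave φ n m l c = wick2 F Ψ n m l c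

theorem annZ_add (ζ : Boson) (Ψ Φ : Waves) (n m l : ℕ) (c : Config n m l) :
    annZ ζ (Ψ + Φ) n m l c = annZ ζ Ψ n m l c + annZ ζ Φ n m l c := by
  simp [annZ, mul_add]

theorem annZ_smul (ζ : Boson) (z : ℂ) (Ψ : Waves) (n m l : ℕ) (c : Config n m l) :
    annZ ζ (z • Ψ) n m l c = z * annZ ζ Ψ n m l c := by
  simp only [annZ, Pi.smul_apply, smul_eq_mul]
  ring

theorem wick1_add {F : Lepton → Lepton → Boson → ℂ} {Ψ Φ : Waves} (hΨ : Wick1Converges F Ψ)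
    (hΦ : Wick1Converges F Φ) (n m l : ℕ) :
    ∀ᵐ c, wick1 F (Ψ + Φ) n m l c = wick1 F Ψ n m l c + wick1 F Φ n m l c := by
  match n, m with
  | 0, _ => simp [wick1, creP]
  | _ + 1, 0 => simp [wick1, creP, creM]
  | n + 1, m + 1 =>
    filter_upwards [hΨ n m l, hΦ n m l] with c h1 h2
    simp only [wick1, creP, creM, annZ_add, mul_add]
    rw [← mul_add, ← Finset.sum_add_distrib]
    congr 1
    refine Finset.sum_congr rfl fun i _ => ?_
    rw [← mul_add, ← mul_add, ← Finset.sum_add_distrib]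
    congr 2
    refine Finset.sum_congr rfl fun i' _ => ?_
    rw [← mul_add, integral_add (h1 i i') (h2 i i')]

theorem wick1_smul (F : Lepton → Lepton → Boson → ℂ) (z : ℂ) (Ψ : Waves) (n m l : ℕ)
    (c : Config n m l) : wick1 F (z • Ψ) n m l c = z * wick1 F Ψ n m l c := by
  match n, m with
  | 0, _ => simp [wick1, creP]
  | _ + 1, 0 => simp [wick1, creP, creM]
  | n + 1, m + 1 =>
    simp only [wick1, creP, creM, annZ_smul, mul_left_comm _ z, integral_const_mul,
      ← Finset.mul_sum]

theorem wick2_add (F : Lepton → Lepton → Boson → ℂ) (Ψ Φ : Waves) (n m l : ℕ) (c : Config n m l) :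
    wick2 F (Ψ + Φ) n m l c = wick2 F Ψ n m l c + wick2 F Φ n m l c := by
  match n, m, l with
  | 0, _, _ => simp [wick2, creP]
  | _ + 1, 0, _ => simp [wick2, creP, creM]
  | _ + 1, _ + 1, 0 => simp [wick2, creP, creM, creZ]
  | n + 1, m + 1, l + 1 =>
    simp only [wick2, creP, creM, creZ, Pi.add_apply, mul_add, Finset.sum_add_distrib]

theorem wick2_smul (F : Lepton → Lepton → Boson → ℂ) (z : ℂ) (Ψ : Waves) (n m l : ℕ)
    (c : Config n m l) : wick2 F (z • Ψ) n m l c = z * wick2 F Ψ n m l c := by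
  match n, m, l with
  | 0, _, _ => simp [wick2, creP]
  | _ + 1, 0, _ => simp [wick2, creP, creM]
  | _ + 1, _ + 1, 0 => simp [wick2, creP, creM, creZ]
  | n + 1, m + 1, l + 1 =>
    simp only [wick2, creP, creM, creZ, Pi.smul_apply, smul_eq_mul, mul_left_comm _ z,
      ← Finset.mul_sum]

/-- The graph of the first Wick monomial. -/
def wick1Graph (F : Lepton → Lepton → Boson → ℂ) : Submodule ℂ (Fock × Fock) where
  carrier := {q | Wick1Rel F q.1 q.2}
  add_mem' {p q} := by
    rintro ⟨Ψ, h1, h2, h3⟩ ⟨Φ, k1, k2, k3⟩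
    change Wick1Rel F (p.1 + q.1) (p.2 + q.2)
    refine ⟨Ψ + Φ, fun n m l => ?_, fun n m l => ?_, fun n m l => ?_⟩
    · filter_upwards [h1 n m l, k1 n m l, wave_add p.1 q.1 n m l] with c e1 e2 e3
      exact e3.trans (congrArg₂ _ e1 e2)
    · filter_upwards [h2 n m l, k2 n m l] with c e1 e2 i i'
      simp only [annZ_add, mul_add]
      exact (e1 i i').add (e2 i i')
    · filter_upwards [h3 n m l, k3 n m l, wave_add p.2 q.2 n m l, wick1_add h2 k2 n m l]
        with c e1 e2 e3 e4
      exact (e3.trans (congrArg₂ _ e1 e2)).trans e4.symm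
  zero_mem' := by
    change Wick1Rel F 0 0
    have h0 : ∀ n m l c, wick1 F 0 n m l c = 0 := fun n m l c => by
      simpa using wick1_smul F 0 0 n m l c
    refine ⟨0, fun n m l => wave_zero n m l, fun n m l => ?_, fun n m l => ?_⟩
    · refine Filter.Eventually.of_forall fun c i i' => ?_
      simp [annZ]
    · filter_upwards [wave_zero n m l] with c e
      exact e.trans (h0 n m l c).symm
  smul_mem' z q := by
    rintro ⟨Ψ, h1, h2, h3⟩
    change Wick1Rel F (z • q.1) (z • q.2)
    refine ⟨z • Ψ, fun n m l => ?_, fun n m l => ?_, fun n m l => ?_⟩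
    · filter_upwards [h1 n m l, wave_smul z q.1 n m l] with c e1 e2
      exact e2.trans (congrArg _ e1)
    · filter_upwards [h2 n m l] with c e1 i i'
      simp only [annZ_smul, mul_left_comm _ z]
      exact (e1 i i').const_mul z
    · filter_upwards [h3 n m l, wave_smul z q.2 n m l] with c e1 e2
      exact (e2.trans (congrArg _ e1)).trans (wick1_smul F z Ψ n m l c).symm

/-- The graph of the second Wick monomial. -/
def wick2Graph (F : Lepton → Lepton → Boson → ℂ) : Submodule ℂ (Fock × Fock) where
  carrier := {q | Wick2Rel F q.1 q.2}
  add_mem' {p q} := by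
    rintro ⟨Ψ, h1, h3⟩ ⟨Φ, k1, k3⟩
    change Wick2Rel F (p.1 + q.1) (p.2 + q.2)
    refine ⟨Ψ + Φ, fun n m l => ?_, fun n m l => ?_⟩
    · filter_upwards [h1 n m l, k1 n m l, wave_add p.1 q.1 n m l] with c e1 e2 e3
      exact e3.trans (congrArg₂ _ e1 e2)
    · filter_upwards [h3 n m l, k3 n m l, wave_add p.2 q.2 n m l] with c e1 e2 e3
      exact (e3.trans (congrArg₂ _ e1 e2)).trans (wick2_add F Ψ Φ n m l c).symm
  zero_mem' := by
    change Wick2Rel F 0 0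
    have h0 : ∀ n m l c, wick2 F 0 n m l c = 0 := fun n m l c => by
      simpa using wick2_smul F 0 0 n m l c
    refine ⟨0, fun n m l => wave_zero n m l, fun n m l => ?_⟩
    filter_upwards [wave_zero n m l] with c e
    exact e.trans (h0 n m l c).symm
  smul_mem' z q := by
    rintro ⟨Ψ, h1, h3⟩
    change Wick2Rel F (z • q.1) (z • q.2)
    refine ⟨z • Ψ, fun n m l => ?_, fun n m l => ?_⟩
    · filter_upwards [h1 n m l, wave_smul z q.1 n m l] with c e1 e2
      exact e2.trans (congrArg _ e1)
    · filter_upwards [h3 n m l, wave_smul z q.2 n m l] with c e1 e2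
      exact (e2.trans (congrArg _ e1)).trans (wick2_smul F z Ψ n m l c).symm

/-! The relations above are graphs of operators: the image of the zero vector is zero. -/

theorem eq_zero_of_wave {φ : Fock} (h : ∀ n m l, ∀ᵐ c, wave φ n m l c = 0) : φ = 0 := by
  refine lp.ext (funext fun ν => Subtype.ext (Lp.ext ?_))
  filter_upwards [h ν.1 ν.2.1 ν.2.2, Lp.coeFn_zero ℂ 2 (volume : Measure (Config ν.1 ν.2.1 ν.2.2))]
    with c h1 h2
  exact h1.trans h2.symm

theorem freeGraph_single_valued (mZ : ℝ) (q : Fock × Fock) (hq : q ∈ freeGraph mZ)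
    (h0 : q.1 = 0) : q.2 = 0 := by
  have hq : FreeRel mZ q.1 q.2 := hq
  refine eq_zero_of_wave fun n m l => ?_
  filter_upwards [hq n m l, h0 ▸ wave_zero n m l] with c h1 h2
  rw [h1, h2, mul_zero]

theorem quasi_removeNth {X : Type} [MeasureSpace X] [SigmaFinite (volume : Measure X)] {k : ℕ}
    (i : Fin (k + 1)) : Measure.QuasiMeasurePreserving (fun x : Fin (k + 1) → X => i.removeNth x)
      volume volume :=
  Measure.quasiMeasurePreserving_snd.comp
    (volume_preserving_piFinSuccAbove (fun _ => X) i).quasiMeasurePreserving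

theorem measurePreserving_cons {X : Type} [MeasureSpace X] [SigmaFinite (volume : Measure X)]
    {k : ℕ} : MeasurePreserving (fun q : (Fin k → X) × X => (Fin.cons q.2 q.1 : Fin (k + 1) → X))
      volume volume := by
  have h := (volume_preserving_piFinSuccAbove (fun _ : Fin (k + 1) => X) 0).symm
  have h' : MeasurePreserving (Prod.swap : (Fin k → X) × X → X × (Fin k → X)) volume volume :=
    Measure.measurePreserving_swap
  have e : (fun q : (Fin k → X) × X => (Fin.cons q.2 q.1 : Fin (k + 1) → X)) =
      (MeasurableEquiv.piFinSuccAbove (fun _ : Fin (k + 1) => X) 0).symm ∘ Prod.swap := by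
    funext q
    simp [MeasurableEquiv.piFinSuccAbove, Fin.insertNthEquiv]
  rw [e]
  exact h.comp h'

theorem wick1Graph_single_valued (F : Lepton → Lepton → Boson → ℂ) (q : Fock × Fock)
    (hq : q ∈ wick1Graph F) (h0 : q.1 = 0) : q.2 = 0 := by
  obtain ⟨Ψ, h1, -, h3⟩ : Wick1Rel F q.1 q.2 := hq
  have hΨ : ∀ n m l, ∀ᵐ c, Ψ n m l c = 0 := fun n m l => by
    filter_upwards [h1 n m l, h0 ▸ wave_zero n m l] with c e1 e2
    exact e1.symm.trans e2
  refine eq_zero_of_wave fun n m l => ?_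
  match n, m with
  | 0, m =>
    filter_upwards [h3 0 m l] with c e
    rw [e]
    simp [wick1, creP]
  | n + 1, 0 =>
    filter_upwards [h3 (n + 1) 0 l] with c e
    rw [e]
    simp [wick1, creP, creM]
  | n + 1, m + 1 =>
    have key : ∀ (i : Fin (n + 1)) (i' : Fin (m + 1)), ∀ᵐ c : Config (n + 1) (m + 1) l,
        ∀ᵐ ζ : Boson, annZ ζ Ψ n m l (i.removeNth c.1, i'.removeNth c.2.1, c.2.2) = 0 := by
      intro i i'
      have a1 : MeasurePreserving (fun t : Config n m l × Boson =>
          ((t.1.1, t.1.2.1, Fin.cons t.2 t.1.2.2) : Config n m (l + 1))) volume volume := by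
        have b1 : MeasurePreserving (MeasurableEquiv.prodAssoc :
            Config n m l × Boson ≃ᵐ _) volume volume := measurePreserving_prodAssoc _ _ _
        have b2 : MeasurePreserving (MeasurableEquiv.prodAssoc :
            ((Fin m → Lepton) × (Fin l → Boson)) × Boson ≃ᵐ _) volume volume :=
          measurePreserving_prodAssoc _ _ _
        have b3 : MeasurePreserving (fun t : (Fin m → Lepton) × ((Fin l → Boson) × Boson) =>
            (t.1, (Fin.cons t.2.2 t.2.1 : Fin (l + 1) → Boson))) volume volume :=
          (MeasurePreserving.id volume).prod measurePreserving_cons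
        have b4 : MeasurePreserving (fun t : (Fin n → Lepton) ×
            (((Fin m → Lepton) × (Fin l → Boson)) × Boson) =>
            ((t.1, t.2.1.1, Fin.cons t.2.2 t.2.1.2) : Config n m (l + 1))) volume volume :=
          (MeasurePreserving.id volume).prod (b3.comp b2)
        exact b4.comp b1
      have a2 := Measure.ae_ae_of_ae_prod (a1.quasiMeasurePreserving.ae (hΨ n m (l + 1)))
      have a3 : Measure.QuasiMeasurePreserving (fun c : Config (n + 1) (m + 1) l =>
          ((i.removeNth c.1, i'.removeNth c.2.1, c.2.2) : Config n m l)) volume volume :=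
        QuasiMeasurePreserving.prodMap (quasi_removeNth i)
          (QuasiMeasurePreserving.prodMap (quasi_removeNth i') (.id _))
      filter_upwards [a3.ae a2] with c hc
      filter_upwards [hc] with ζ hζ
      simp only [annZ, hζ, mul_zero]
    filter_upwards [h3 (n + 1) (m + 1) l, ae_all_iff.2 fun i => ae_all_iff.2 (key i)] with c e1 e2
    rw [e1]
    simp only [wick1, creP, creM]
    have : ∀ i i', ∫ ζ, F (c.1 i) (c.2.1 i') ζ *
        annZ ζ Ψ n m l (i.removeNth c.1, i'.removeNth c.2.1, c.2.2) = 0 := fun i i' =>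
      integral_eq_zero_of_ae ((e2 i i').mono fun ζ h => by simp [h])
    simp [this]

theorem wick2Graph_single_valued (F : Lepton → Lepton → Boson → ℂ) (q : Fock × Fock)
    (hq : q ∈ wick2Graph F) (h0 : q.1 = 0) : q.2 = 0 := by
  obtain ⟨Ψ, h1, h3⟩ : Wick2Rel F q.1 q.2 := hq
  have hΨ : ∀ n m l, ∀ᵐ c, Ψ n m l c = 0 := fun n m l => by
    filter_upwards [h1 n m l, h0 ▸ wave_zero n m l] with c e1 e2
    exact e1.symm.trans e2
  refine eq_zero_of_wave fun n m l => ?_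
  match n, m, l with
  | 0, m, l =>
    filter_upwards [h3 0 m l] with c e
    rw [e]
    simp [wick2, creP]
  | n + 1, 0, l =>
    filter_upwards [h3 (n + 1) 0 l] with c e
    rw [e]
    simp [wick2, creP, creM]
  | n + 1, m + 1, 0 =>
    filter_upwards [h3 (n + 1) (m + 1) 0] with c e
    rw [e]
    simp [wick2, creP, creM, creZ]
  | n + 1, m + 1, l + 1 =>
    have key : ∀ (i : Fin (n + 1)) (i' : Fin (m + 1)) (i'' : Fin (l + 1)),
        ∀ᵐ c : Config (n + 1) (m + 1) (l + 1),
        Ψ n m l (i.removeNth c.1, i'.removeNth c.2.1, i''.removeNth c.2.2) = 0 := by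
      intro i i' i''
      have a3 : Measure.QuasiMeasurePreserving (fun c : Config (n + 1) (m + 1) (l + 1) =>
          ((i.removeNth c.1, i'.removeNth c.2.1, i''.removeNth c.2.2) : Config n m l))
          volume volume :=
        QuasiMeasurePreserving.prodMap (quasi_removeNth i)
          (QuasiMeasurePreserving.prodMap (quasi_removeNth i') (quasi_removeNth i''))
      exact a3.ae (hΨ n m l)
    filter_upwards [h3 (n + 1) (m + 1) (l + 1),
      ae_all_iff.2 fun i => ae_all_iff.2 fun i' => ae_all_iff.2 (key i i')] with c e1 e2
    rw [e1]
    simp only [wick2, creP, creM, creZ]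
    simp [e2]

/-- The operator `∫ F(ξ₁, ξ₂, ξ₃) b₊^*(ξ₁) b₋^*(ξ₂) a(ξ₃) dξ₁ dξ₂ dξ₃` on its maximal domain, the
set of all `ψ` for which the result is well defined and lies in the Fock space. -/
def HI1 (F : Lepton → Lepton → Boson → ℂ) : Fock →ₗ.[ℂ] Fock := (wick1Graph F).toLinearPMap

/-- The operator `∫ F(ξ₁, ξ₂, ξ₃) b₊^*(ξ₁) b₋^*(ξ₂) a^*(ξ₃) dξ₁ dξ₂ dξ₃` on its maximal domain, the
set of all `ψ` for which the result lies in the Fock space. -/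
def HI2 (F : Lepton → Lepton → Boson → ℂ) : Fock →ₗ.[ℂ] Fock := (wick2Graph F).toLinearPMap

/-! ## Massless Dirac spherical waves -/

/-- The Legendre polynomial `P_l`, by Rodrigues' formula. -/
def legendreP (l : ℕ) : Polynomial ℝ :=
  Polynomial.C ((2 ^ l * (l.factorial : ℝ))⁻¹) *
    Polynomial.derivative^[l] ((Polynomial.X ^ 2 - 1) ^ l)

/-- The spherical harmonic `Y_{l,m}`, `m ≥ 0`, with the Condon–Shortley phase, at the direction
`x / |x|`; in spherical coordinates `(x₀ + i x₁) / |x| = sin θ e^{iφ}` and `x₂ / |x| = cos θ`, so that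
`(-1)^m (sin θ)^m P_l^{(m)}(cos θ)` is the associated Legendre function. -/
def sphHarmNat (l m : ℕ) (x : R3) : ℂ :=
  (-1) ^ m *
    (√((2 * l + 1) / (4 * Real.pi) * (((l - m).factorial : ℝ) / ((l + m).factorial : ℝ))) : ℂ) *
    (((x 0 / ‖x‖ : ℝ) : ℂ) + Complex.I * ((x 1 / ‖x‖ : ℝ) : ℂ)) ^ m *
    (((Polynomial.derivative^[m] (legendreP l)).eval (x 2 / ‖x‖) : ℝ) : ℂ)

/-- The spherical harmonic `Y_{l,m}` for `m ∈ ℤ`, with `Y_{l,-m} = (-1)^m conj Y_{l,m}`. -/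
def sphHarm (l : ℕ) (m : ℤ) (x : R3) : ℂ :=
  if 0 ≤ m then sphHarmNat l m.natAbs x
  else (-1) ^ m.natAbs * (starRingEnd ℂ) (sphHarmNat l m.natAbs x)

/-- The spherical spinor `Φ^{(1)}_{m_j, κ_j}`, with orbital angular momentum `j + 1/2` if `κ_j > 0`
and `j - 1/2` if `κ_j < 0`; here `m_j - 1/2 = a - n - 1` and `m_j + 1/2 = a - n`. -/
def spinor1 (c : AngLabel) (x : R3) : Fin 2 → ℂ :=
  if c.s then
    ![-(√((c.j - c.mj + 1) / (2 * c.j + 2)) : ℂ) * sphHarm (c.n + 1) ((c.a : ℕ) - c.n - 1) x,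
      (√((c.j + c.mj + 1) / (2 * c.j + 2)) : ℂ) * sphHarm (c.n + 1) ((c.a : ℕ) - c.n) x]
  else
    ![(√((c.j + c.mj) / (2 * c.j)) : ℂ) * sphHarm c.n ((c.a : ℕ) - c.n - 1) x,
      (√((c.j - c.mj) / (2 * c.j)) : ℂ) * sphHarm c.n ((c.a : ℕ) - c.n) x]

/-- The spherical spinor `Φ^{(2)}_{m_j, κ_j} = Φ^{(1)}_{m_j, -κ_j}`. -/
def spinor2 (c : AngLabel) (x : R3) : Fin 2 → ℂ := spinor1 ⟨c.n, c.a, !c.s⟩ x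

/-- The radial function `g_{j+1/2,+}(p, r)`, with `γ_j = j + 1/2 = n + 1` and `Γ(γ_j) = n!`. -/
def radialG (n : ℕ) (p r : ℝ) : ℝ :=
  -(p / √Real.pi) * ((2 * p * r) ^ n / (n.factorial : ℝ)) *
    (2 * ∫ u in (0 : ℝ)..1, Real.sin (p * r * (2 * u - 1)) * u ^ (n + 1) * (1 - u) ^ n)

/-- The radial function `f_{j+1/2,+}(p, r)`, with `γ_j = j + 1/2 = n + 1` and `Γ(γ_j) = n!`. -/
def radialF (n : ℕ) (p r : ℝ) : ℝ :=
  -(p / √Real.pi) * ((2 * p * r) ^ n / (n.factorial : ℝ)) *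
    (2 * ∫ u in (0 : ℝ)..1, Real.cos (p * r * (2 * u - 1)) * u ^ (n + 1) * (1 - u) ^ n)

/-- The radial function `g_{κ_j,±}(p, r)`, which is the same for both signs of the energy. -/
def gRad (c : AngLabel) (p r : ℝ) : ℝ := if c.s then radialG c.n p r else -radialF c.n p r

/-- The radial function `f_{κ_j,+}(p, r)`; one has `f_{κ_j,-} = -f_{κ_j,+}`. -/
def fRad (c : AngLabel) (p r : ℝ) : ℝ := if c.s then radialF c.n p r else radialG c.n p r

/-- The four-component spinor `(i g Φ^{(1)}, -f Φ^{(2)})`. -/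
def assemble (c : AngLabel) (g f : ℝ) (x : R3) : Fin 4 → ℂ :=
  ![Complex.I * g * spinor1 c x 0, Complex.I * g * spinor1 c x 1,
    -f * spinor2 c x 0, -f * spinor2 c x 1]

/-- The generalized eigenfunction `ψ₊(ξ, x)` of the massless Dirac operator. -/
def psiPlus (ξ : Lepton) (x : R3) : Fin 4 → ℂ :=
  assemble ξ.2 (gRad ξ.2 ξ.1 ‖x‖) (fRad ξ.2 ξ.1 ‖x‖) x

/-- The generalized eigenfunction `ψ₋(ξ, x)` of the massless Dirac operator. -/
def psiMinus (ξ : Lepton) (x : R3) : Fin 4 → ℂ :=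
  assemble ξ.2 (gRad ξ.2 ξ.1 ‖x‖) (-fRad ξ.2 ξ.1 ‖x‖) x

/-- `ψ̃₋(ξ, x) = ψ₋((p, (j, -m_j, -κ_j)), x)`. -/
def psiMinusTilde (ξ : Lepton) (x : R3) : Fin 4 → ℂ := psiMinus (ξ.1, ξ.2.neg) x

/-! ## The interaction -/

/-- The Dirac matrices `γ^μ` in the standard representation. -/
def gammaM : Fin 4 → Matrix (Fin 4) (Fin 4) ℂ :=
  ![!![1, 0, 0, 0; 0, 1, 0, 0; 0, 0, -1, 0; 0, 0, 0, -1],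
    !![0, 0, 0, 1; 0, 0, 1, 0; 0, -1, 0, 0; -1, 0, 0, 0],
    !![0, 0, 0, -Complex.I; 0, 0, Complex.I, 0; 0, Complex.I, 0, 0; -Complex.I, 0, 0, 0],
    !![0, 0, 1, 0; 0, 0, 0, -1; -1, 0, 0, 0; 0, 1, 0, 0]]

/-- `γ₅ = i γ⁰ γ¹ γ² γ³`. -/
def gamma5 : Matrix (Fin 4) (Fin 4) ℂ :=
  Complex.I • (gammaM 0 * gammaM 1 * gammaM 2 * gammaM 3)

/-- Polarization vectors `ε_μ(k, λ)` (covariant components, Minkowski metric `(+,-,-,-)`) of a spin one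
particle of mass `m`: for each `k` the three vectors `ε(k, λ)` are orthogonal to the four-momentum
`(ω₃(k), k)` and orthonormal for minus the Minkowski metric, and they depend measurably on `k`. -/
structure IsPolarization (m : ℝ) (ε : Fin 4 → Boson → ℂ) : Prop where
  measurable : ∀ μ, Measurable (ε μ)
  transversal : ∀ k l, (omega3 m k : ℂ) * ε 0 (k, l) + ∑ i : Fin 3, (k i : ℂ) * ε i.succ (k, l) = 0
  orthonormal : ∀ k l l', (∑ i : Fin 3, (starRingEnd ℂ) (ε i.succ (k, l)) * ε i.succ (k, l')) -
    (starRingEnd ℂ) (ε 0 (k, l)) * ε 0 (k, l') = if l = l' then 1 else 0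

/-- Spatial polarization vectors at rest: `e(0) = (0, 0, 1)`, `e(±1) = ∓(1, ±i, 0) / √2`. -/
def restPol : Pol → Fin 3 → ℂ
  | .minus => ![(√2 : ℂ)⁻¹, -Complex.I * (√2 : ℂ)⁻¹, 0]
  | .zero => ![0, 0, 1]
  | .plus => ![-(√2 : ℂ)⁻¹, -Complex.I * (√2 : ℂ)⁻¹, 0]

/-- The standard choice of polarization vectors: the vectors at rest, boosted to momentum `k`. -/
def boostPol (m : ℝ) (μ : Fin 4) (ξ : Boson) : ℂ :=
  let d := ∑ i, (ξ.1 i : ℂ) * restPol ξ.2 i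
  Fin.cons (α := fun _ => ℂ) (d / m) (fun i => -(restPol ξ.2 i + ξ.1 i * d / (m * (omega3 m ξ.1 + m)))) μ

theorem isPolarization_boostPol {m : ℝ} (hm : 0 < m) : IsPolarization m (boostPol m) := by
  have hw : ∀ k : R3, (omega3 m k : ℂ) ^ 2 = (k 0 : ℂ) ^ 2 + (k 1 : ℂ) ^ 2 + (k 2 : ℂ) ^ 2 + m ^ 2 := by
    intro k
    have : omega3 m k ^ 2 = k 0 ^ 2 + k 1 ^ 2 + k 2 ^ 2 + m ^ 2 := by
      rw [omega3, Real.sq_sqrt (by positivity), EuclideanSpace.norm_sq_eq, Fin.sum_univ_three]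
      simp
    exact_mod_cast this
  have hm' : (m : ℂ) ≠ 0 := by exact_mod_cast hm.ne'
  have hwm : ∀ k : R3, (omega3 m k : ℂ) + m ≠ 0 := by
    intro k
    have : 0 < omega3 m k + m := add_pos_of_nonneg_of_pos (Real.sqrt_nonneg _) hm
    exact_mod_cast this.ne'
  have h2 : ((√2 : ℝ) : ℂ)⁻¹ ^ 2 = 1 / 2 := by
    rw [inv_pow, ← Complex.ofReal_pow, Real.sq_sqrt (by norm_num)]
    norm_num
  have hrest : ∀ l l', (starRingEnd ℂ) (restPol l 0) * restPol l' 0 +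
      (starRingEnd ℂ) (restPol l 1) * restPol l' 1 + (starRingEnd ℂ) (restPol l 2) * restPol l' 2 =
      if l = l' then 1 else 0 := by
    intro l l'
    cases l <;> cases l' <;> simp [restPol] <;>
      first
      | linear_combination 2 * h2 + ((√2 : ℝ) : ℂ)⁻¹ ^ 2 * (-Complex.I_sq)
      | linear_combination (((√2 : ℝ) : ℂ)⁻¹ ^ 2) * (-Complex.I_sq)
  refine ⟨fun μ => ?_, fun k l => ?_, fun k l l' => ?_⟩
  · refine measurable_from_prod_countable_left fun l => ?_
    have hc : Continuous fun k : R3 => omega3 m k := by unfold omega3; fun_prop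
    refine Fin.cases ?_ (fun i => ?_) μ
    · simp only [boostPol, Fin.cons_zero]
      fun_prop
    · simp only [boostPol, Fin.cons_succ]
      have := hc.measurable
      fun_prop
  · simp only [boostPol, Fin.cons_zero, Fin.cons_succ, Fin.sum_univ_three]
    have := hwm k
    field_simp
    linear_combination ((k 0 : ℂ) * restPol l 0 + (k 1 : ℂ) * restPol l 1 +
      (k 2 : ℂ) * restPol l 2) * hw k
  · rw [← hrest l l']
    simp only [boostPol, Fin.cons_zero, Fin.cons_succ, Fin.sum_univ_three, map_neg, map_add,
      map_mul, map_div₀, Complex.conj_ofReal]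
    have := hwm k
    generalize (starRingEnd ℂ) (restPol l 0) = a0
    generalize (starRingEnd ℂ) (restPol l 1) = a1
    generalize (starRingEnd ℂ) (restPol l 2) = a2
    field_simp
    linear_combination (-(a0 * k 0 + a1 * k 1 + a2 * k 2) * (k 0 * restPol l' 0 +
      k 1 * restPol l' 1 + k 2 * restPol l' 2)) * hw k

/-- The spinor current contracted with a covector,
`∑_μ ψ̄₊(ξ₁, x) γ^μ (1 - γ₅) ψ̃₋(ξ₂, x) e_μ`, where `ψ̄ = ψ† γ⁰`. -/
def current (ξ₁ ξ₂ : Lepton) (x : R3) (e : Fin 4 → ℂ) : ℂ :=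
  ∑ μ, dotProduct (star (psiPlus ξ₁ x))
    ((gammaM 0 * gammaM μ * (1 - gamma5)).mulVec (psiMinusTilde ξ₂ x)) * e μ

/-- The kernel `h^{(1)}`. -/
def h1 (mZ : ℝ) (f : ℝ → ℂ) (ε : Fin 4 → Boson → ℂ) (ξ₁ ξ₂ : Lepton) (ξ₃ : Boson) : ℂ :=
  ∫ x : R3, f ‖x‖ * current ξ₁ ξ₂ x (fun μ => ε μ ξ₃ / (√(2 * omega3 mZ ξ₃.1) : ℂ)) *
    Complex.exp (Complex.I * (inner ℝ ξ₃.1 x : ℝ))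

/-- The kernel `h^{(2)}`. -/
def h2 (mZ : ℝ) (f : ℝ → ℂ) (ε : Fin 4 → Boson → ℂ) (ξ₁ ξ₂ : Lepton) (ξ₃ : Boson) : ℂ :=
  ∫ x : R3, f ‖x‖ *
    current ξ₁ ξ₂ x (fun μ => (starRingEnd ℂ) (ε μ ξ₃) / (√(2 * omega3 mZ ξ₃.1) : ℂ)) *
    Complex.exp (-Complex.I * (inner ℝ ξ₃.1 x : ℝ))

/-- The interaction Hamiltonian `H_I = H_I^{(1)}(F^{(1)}) + H_I^{(2)}(F^{(2)}) + h.c.` with kernels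
`F^{(j)} = h^{(j)} G^{(j)}`. -/
def HI (mZ : ℝ) (f : ℝ → ℂ) (ε : Fin 4 → Boson → ℂ) (G1 G2 : Lepton → Lepton → Boson → ℂ) :
    Fock →ₗ.[ℂ] Fock :=
  let H1 := HI1 fun ξ₁ ξ₂ ξ₃ => h1 mZ f ε ξ₁ ξ₂ ξ₃ * G1 ξ₁ ξ₂ ξ₃
  let H2 := HI2 fun ξ₁ ξ₂ ξ₃ => h2 mZ f ε ξ₁ ξ₂ ξ₃ * G2 ξ₁ ξ₂ ξ₃
  H1 + H2 + H1.adjoint + H2.adjoint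

/-- The total Hamiltonian `H = H₀ + g H_I`. -/
def H (mZ : ℝ) (f : ℝ → ℂ) (ε : Fin 4 → Boson → ℂ) (G1 G2 : Lepton → Lepton → Boson → ℂ) (g : ℝ) :
    Fock →ₗ.[ℂ] Fock :=
  H0 mZ + (g : ℂ) • HI mZ f ε G1 G2

/-- The assumptions on the cutoffs: `f` is smooth on `[0, ∞)` with bounded support; `G^{(1)}`,
`G^{(2)}` are measurable, bounded, and vanish for momenta `(p₁, p₂, k)` outside a compact set. -/
structure CutoffHypothesis (f : ℝ → ℂ) (G1 G2 : Lepton → Lepton → Boson → ℂ) : Prop where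
  smooth : ContDiffOn ℝ ∞ f (Set.Ici 0)
  support : ∃ Λ : ℝ, 0 < Λ ∧ ∀ r, Λ < r → f r = 0
  measurable : ∀ G ∈ ({G1, G2} : Set (Lepton → Lepton → Boson → ℂ)),
    AEStronglyMeasurable (fun q : Lepton × Lepton × Boson => G q.1 q.2.1 q.2.2) volume
  bounded : ∀ G ∈ ({G1, G2} : Set (Lepton → Lepton → Boson → ℂ)),
    ∃ M : ℝ, ∀ ξ₁ ξ₂ ξ₃, ‖G ξ₁ ξ₂ ξ₃‖ ≤ M
  compact : ∃ K : Set (ℝ≥0 × ℝ≥0 × R3), IsCompact K ∧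
    ∀ G ∈ ({G1, G2} : Set (Lepton → Lepton → Boson → ℂ)), ∀ p₁ γ₁ p₂ γ₂ k l,
      (p₁, p₂, k) ∉ K → G (p₁, γ₁) (p₂, γ₂) (k, l) = 0

end ZDecay

end

noncomputable section

namespace ZDecay

open MeasureTheory
open scoped NNReal ContDiff

/-! ## Self-adjointness criteria -/

section Criterion

variable {E : Type*} [NormedAddCommGroup E] [InnerProductSpace ℂ E]

/-! The free Hamiltonian is multiplication by a nonnegative function on every particle sector, so it
is symmetric and `H0 ± i` is onto, with inverse multiplication by `(E ± i)⁻¹`. If each of the four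
terms of the interaction is defined on the domain of `H0` and bounded there by `C (‖H0 ψ‖ + ‖ψ‖)`,
then `H0 + g H_I ± i = (1 + g H_I (H0 ± i)⁻¹)(H0 ± i)` is onto for small `g` by a Neumann series. A
symmetric operator with this property is self-adjoint (`isSelfAdjoint_add_small`,
`exists_coupling`). The theorem thus reduces to relative bounds for the two Wick monomials and their
adjoints.

A Wick monomial sends each sector into a single other sector, injectively on labels, so its norm is
read off from the matrix elements (`IsBlock`). A matrix element is a pairing of wave functions with
the kernel, multiplied by a constant of modulus `√((n+1)(m+1)(l+1))`. The three factors are absorbed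
differently. Antisymmetry in the antineutrinos removes `m+1`: creating a fermion with wave function
`f` is bounded by `‖f‖`, because the exchange terms are nonpositive (`integral_exchange`,
`sqInt_alt_le`). The factor `n+1` is turned into the total neutrino momentum by symmetry
(`lintegral_front`). Neutrinos are massless, so this costs a factor `p₁/(1+p₁)` that the squared
kernel must supply (`contract_pairing_le`, `sq_enorm_inner_le`). The factor `l+1` is controlled by
the energy since every boson has energy at least `mZ`. Together the weights are at most a multiple
of `1 + E²` (`weight_le_energy`), which is the required bound.

The kernel has to be square integrable with this decay at `p₁ = 0`. Each spherical wave carries a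
factor `p` and, for bounded `p` and `r`, a factor `(const)^n / n!` from the radial function, which
beats the exponential bound `12^l` on spherical harmonics and the number of angular momentum labels
(`norm_psiPlus_le`, `summable_waveBound`). The cutoff in `x` makes the integral over `x` finite,
those in the momenta make the integrals over momenta finite, and `exists_regularKernel` assembles
the result. -/

theorem norm_sq_add_smul_of_symmetric {A : E →ₗ.[ℂ] E} (hs : A.IsFormalAdjoint A) (z : ℂ)
    (hz : z.re = 0) (x : A.domain) :
    ‖A x + z • (x : E)‖ ^ 2 = ‖A x‖ ^ 2 + ‖z‖ ^ 2 * ‖(x : E)‖ ^ 2 := by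
  -- Symmetry makes `⟨A x, x⟩` real, so the cross term with an imaginary `z` has no real part and
  -- Pythagoras holds.
  have him : (inner ℂ (A x) (x : E)).im = 0 := by
    rw [← Complex.conj_eq_iff_im, inner_conj_symm]
    exact (hs x x).symm
  rw [@norm_add_sq ℂ, inner_smul_right, norm_smul, mul_pow]
  simp [hz, him]

theorem inner_self_add_smul_im {A : E →ₗ.[ℂ] E} (hs : A.IsFormalAdjoint A) (x : A.domain) (z : ℂ) :
    (inner ℂ (x : E) (A x + z • (x : E))).im = z.im * ‖(x : E)‖ ^ 2 := by
  have him : (inner ℂ (x : E) (A x)).im = 0 := by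
    rw [← Complex.conj_eq_iff_im, inner_conj_symm]
    exact hs x x
  rw [inner_add_right, inner_smul_right, inner_self_eq_norm_sq_to_K, Complex.add_im, him,
    Complex.mul_im]
  simp [← Complex.ofReal_pow]

variable [CompleteSpace E]

/-- A vector orthogonal to the domain equals `(A + i) η` for some `η` in the domain. Its pairing
with `η` vanishes but has imaginary part `‖η‖²`, which forces `η = 0`. -/
theorem dense_domain_of_surjective {A : E →ₗ.[ℂ] E} (hs : A.IsFormalAdjoint A)
    (hp : ∀ y, ∃ x : A.domain, A x + Complex.I • (x : E) = y) : Dense (A.domain : Set E) := by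
  rw [Submodule.dense_iff_topologicalClosure_eq_top, Submodule.topologicalClosure_eq_top_iff,
    Submodule.eq_bot_iff]
  intro χ hχ
  obtain ⟨η, rfl⟩ := hp χ
  have h1 := inner_self_add_smul_im hs η Complex.I
  rw [Submodule.mem_orthogonal] at hχ
  rw [hχ _ η.2] at h1
  have h2 : (η : E) = 0 := by simpa using h1.symm
  have h3 : η = 0 := Subtype.ext h2
  simp [h3]

/-- A symmetric operator `A` with `A ± i` surjective is self-adjoint. -/
theorem isSelfAdjoint_of_surjective {A : E →ₗ.[ℂ] E} (hs : A.IsFormalAdjoint A)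
    (hp : ∀ y, ∃ x : A.domain, A x + Complex.I • (x : E) = y)
    (hm : ∀ y, ∃ x : A.domain, A x + (-Complex.I) • (x : E) = y) : IsSelfAdjoint A := by
  have hd := dense_domain_of_surjective hs hp
  have hle : A ≤ A.adjoint := hs.le_adjoint hd
  rw [LinearPMap.isSelfAdjoint_def]
  refine (LinearPMap.eq_of_le_of_domain_eq hle (le_antisymm hle.1 fun y hy => ?_)).symm
  -- With `(A - i) x = (A* - i) y`, the difference `y - x` lies in the kernel of `A* - i`, hence is
  -- orthogonal to the range of `A + i`. That range is everything, in particular it contains `y - x`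
  -- itself.
  obtain ⟨x, hx⟩ := hm (A.adjoint ⟨y, hy⟩ + (-Complex.I) • y)
  obtain ⟨v, hv⟩ := hp (y - x)
  have hx' : A.adjoint ⟨y, hy⟩ - A x = Complex.I • (y - x) := by
    have : A.adjoint ⟨y, hy⟩ = A x + (-Complex.I) • (x : E) + Complex.I • y := by
      rw [hx]; module
    rw [this]; module
  have h1 : inner ℂ (y - x) (y - (x : E)) = 0 := by
    nth_rewrite 2 [← hv]
    rw [inner_add_right, inner_sub_left, ← hs x v,
      ← LinearPMap.adjoint_isFormalAdjoint hd ⟨y, hy⟩ v, ← inner_sub_left, hx', inner_smul_left,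
      inner_smul_right]
    simp
  rw [inner_self_eq_zero, sub_eq_zero] at h1
  rw [h1]
  exact x.2

/-- By Pythagoras `‖A x‖` and `‖x‖` are both at most `‖(A + z) x‖`, so `K = V (A + z)⁻¹` has norm at
most `2C`. The claim follows from the factorization `A + gV + z = (1 + gK)(A + z)` and the
invertibility of `1 + gK`. -/
theorem surjective_add_perturbation {A V : E →ₗ.[ℂ] E} (hs : A.IsFormalAdjoint A)
    {z : ℂ} (hz : z.re = 0) (hz1 : ‖z‖ = 1)
    (hp : ∀ y, ∃ x : A.domain, A x + z • (x : E) = y)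
    (hV : A.domain ≤ V.domain) {C : ℝ}
    (hb : ∀ x : A.domain, ‖V ⟨x, hV x.2⟩‖ ≤ C * (‖A x‖ + ‖(x : E)‖))
    {g : ℝ} (hg : 0 ≤ g) (hgC : g * (2 * C) < 1) (y : E) :
    ∃ x : A.domain, A x + (g : ℂ) • V ⟨x, hV x.2⟩ + z • (x : E) = y := by
  have hn : ∀ x : A.domain, ‖A x‖ ^ 2 + ‖(x : E)‖ ^ 2 = ‖A x + z • (x : E)‖ ^ 2 := fun x => by
    rw [norm_sq_add_smul_of_symmetric hs z hz, hz1]; ring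
  have hn1 : ∀ x : A.domain, ‖A x‖ ≤ ‖A x + z • (x : E)‖ := fun x =>
    abs_le_of_sq_le_sq' (by nlinarith [hn x, sq_nonneg ‖(x : E)‖]) (norm_nonneg _) |>.2
  have hn2 : ∀ x : A.domain, ‖(x : E)‖ ≤ ‖A x + z • (x : E)‖ := fun x =>
    abs_le_of_sq_le_sq' (by nlinarith [hn x, sq_nonneg ‖A x‖]) (norm_nonneg _) |>.2
  let L : A.domain →ₗ[ℂ] E := A.toFun + z • A.domain.subtype
  have hL : ∀ x, L x = A x + z • (x : E) := fun x => rfl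
  have hbij : Function.Bijective L := by
    refine ⟨?_, fun y => (hp y).imp fun x hx => hx⟩
    rw [← LinearMap.ker_eq_bot, LinearMap.ker_eq_bot']
    intro x hx
    have := hn2 x
    rw [← hL, hx, norm_zero] at this
    exact Subtype.ext (norm_le_zero_iff.1 this)
  let e := LinearEquiv.ofBijective L hbij
  let K0 : E →ₗ[ℂ] E := (V.toFun ∘ₗ Submodule.inclusion hV) ∘ₗ e.symm.toLinearMap
  have hK0 : ∀ x : A.domain, K0 (L x) = V ⟨x, hV x.2⟩ := fun x => by
    change V.toFun (Submodule.inclusion hV (e.symm (e x))) = _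
    rw [e.symm_apply_apply]; rfl
  -- The operator norm estimate for `K` needs a nonnegative constant. For negative `C` the
  -- hypothesis forces `V = 0` on the domain of `A`.
  by_cases hC : 0 ≤ C
  swap
  · obtain ⟨x, hx⟩ := hp y
    refine ⟨x, ?_⟩
    have h0 : V ⟨x, hV x.2⟩ = 0 := by
      have := hb x
      have h1 : 0 ≤ ‖A x‖ + ‖(x : E)‖ := by positivity
      exact norm_le_zero_iff.1 (this.trans (mul_nonpos_of_nonpos_of_nonneg (not_le.1 hC).le h1))
    rw [h0, smul_zero, add_zero, hx]
  have hKb : ∀ w, ‖K0 w‖ ≤ 2 * C * ‖w‖ := by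
    intro w
    obtain ⟨x, rfl⟩ := hbij.2 w
    rw [hK0]
    have h1 := hn1 x
    have h2 := hn2 x
    rw [← hL] at h1 h2
    calc _ ≤ C * (‖A x‖ + ‖(x : E)‖) := hb x
      _ ≤ C * (‖L x‖ + ‖L x‖) := by gcongr
      _ = _ := by ring
  let K : E →L[ℂ] E := K0.mkContinuous (2 * C) hKb
  have hKn : ‖-((g : ℂ) • K)‖ < 1 := by
    rw [norm_neg, norm_smul, Complex.norm_real, Real.norm_of_nonneg hg]
    refine lt_of_le_of_lt ?_ hgC
    gcongr
    exact LinearMap.mkContinuous_norm_le _ (by positivity) _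
  have hu := isUnit_one_sub_of_norm_lt_one hKn
  obtain ⟨u, hu⟩ := hu
  obtain ⟨x, hx⟩ := hbij.2 ((↑u⁻¹ : E →L[ℂ] E) y)
  refine ⟨x, ?_⟩
  have h3 : (u : E →L[ℂ] E) ((↑u⁻¹ : E →L[ℂ] E) y) = y := by
    rw [← mul_apply_eq_comp, u.mul_inv]; rfl
  rw [hu, ← hx] at h3
  have h4 : K (L x) = V ⟨x, hV x.2⟩ := hK0 x
  rw [← h3]
  change _ = L x - (-((g : ℂ) • K (L x)))
  rw [h4, hL]
  module

/-- Kato–Rellich for small coupling. -/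
theorem isSelfAdjoint_add_small {A V : E →ₗ.[ℂ] E} (hs : A.IsFormalAdjoint A)
    (hp : ∀ y, ∃ x : A.domain, A x + Complex.I • (x : E) = y)
    (hm : ∀ y, ∃ x : A.domain, A x + (-Complex.I) • (x : E) = y)
    (hV : A.domain ≤ V.domain)
    (hVs : ∀ x y : A.domain,
      inner ℂ (V ⟨x, hV x.2⟩) (y : E) = inner ℂ (x : E) (V ⟨y, hV y.2⟩)) {C : ℝ}
    (hb : ∀ x : A.domain, ‖V ⟨x, hV x.2⟩‖ ≤ C * (‖A x‖ + ‖(x : E)‖))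
    {g : ℝ} (hg : 0 ≤ g) (hgC : g * (2 * C) < 1) :
    (A + (g : ℂ) • V).domain = A.domain ∧ IsSelfAdjoint (A + (g : ℂ) • V) := by
  have hdom : (A + (g : ℂ) • V).domain = A.domain := by
    rw [LinearPMap.add_domain, LinearPMap.smul_domain]
    exact inf_eq_left.2 hV
  have happ : ∀ x : (A + (g : ℂ) • V).domain, (A + (g : ℂ) • V) x =
      A ⟨x, x.2.1⟩ + (g : ℂ) • V ⟨x, x.2.2⟩ := fun x => LinearPMap.add_apply _ _ _
  refine ⟨hdom, isSelfAdjoint_of_surjective (fun x y => ?_) (fun y => ?_) fun y => ?_⟩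
  · rw [happ, happ, inner_add_left, inner_add_right, inner_smul_left, inner_smul_right,
      hs ⟨x, x.2.1⟩ ⟨y, y.2.1⟩, hVs ⟨x, x.2.1⟩ ⟨y, y.2.1⟩]
    simp
  · obtain ⟨x, hx⟩ := surjective_add_perturbation hs Complex.I_re Complex.norm_I hp hV hb hg hgC y
    exact ⟨⟨x, hdom.symm ▸ x.2⟩, by rw [happ]; exact hx⟩
  · obtain ⟨x, hx⟩ := surjective_add_perturbation hs (z := -Complex.I) (by simp) (by simp) hm hV hb
      hg hgC y
    exact ⟨⟨x, hdom.symm ▸ x.2⟩, by rw [happ]; exact hx⟩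

end Criterion

/-! ## Block operators on Hilbert sums -/

section Block

variable {ι κ : Type*} {E : ι → Type*} [∀ i, NormedAddCommGroup (E i)]

theorem exists_extension_by_zero {t : κ → ι} (ht : Function.Injective t) (v : ∀ k, E (t k)) :
    ∃ w : ∀ i, E i, (∀ k, w (t k) = v k) ∧ ∀ i ∉ Set.range t, w i = 0 := by
  classical
  refine ⟨fun i => if h : ∃ k, t k = i then h.choose_spec ▸ v h.choose else 0, fun k => ?_,
    fun i hi => dif_neg hi⟩
  have h : ∃ k', t k' = t k := ⟨k, rfl⟩
  have h2 : h.choose = k := ht h.choose_spec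
  have key : ∀ k' (e : t k' = t k), k' = k → (e ▸ v k' : E (t k)) = v k := by
    rintro k' e rfl
    rfl
  exact (dif_pos h).trans (key _ h.choose_spec h2)

variable [∀ i, InnerProductSpace ℂ (E i)]

theorem lp_hasSum_norm_sq (ψ : lp E 2) : HasSum (fun i => ‖ψ i‖ ^ 2) (‖ψ‖ ^ 2) := by
  have h := lp.hasSum_inner (𝕜 := ℂ) ψ ψ
  simp only [inner_self_eq_norm_sq_to_K] at h
  exact_mod_cast h

/-- No target index is hit twice, so the squared norms of the pieces `v k` add up to that of the
assembled vector. No source index is used twice, so the sum of the bounds is dominated by the full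
norms. In the application `φ` is a vector in the domain of `H0` and `φ'` its image. -/
theorem exists_lp_of_norm_sq_le {s t : κ → ι} (hs : Function.Injective s)
    (ht : Function.Injective t) (v : ∀ k, E (t k)) (φ φ' : lp E 2) {C : ℝ}
    (hv : ∀ k, ‖v k‖ ^ 2 ≤ C ^ 2 * (‖φ' (s k)‖ ^ 2 + ‖φ (s k)‖ ^ 2)) :
    ∃ w : lp E 2, (∀ k, w (t k) = v k) ∧ (∀ i ∉ Set.range t, w i = 0) ∧
      ‖w‖ ^ 2 ≤ C ^ 2 * (‖φ'‖ ^ 2 + ‖φ‖ ^ 2) := by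
  obtain ⟨w, hw1, hw2⟩ := exists_extension_by_zero ht v
  have h0 : HasSum (fun i => C ^ 2 * (‖φ' i‖ ^ 2 + ‖φ i‖ ^ 2)) (C ^ 2 * (‖φ'‖ ^ 2 + ‖φ‖ ^ 2)) :=
    ((lp_hasSum_norm_sq φ').add (lp_hasSum_norm_sq φ)).mul_left _
  have h1 : Summable fun k => C ^ 2 * (‖φ' (s k)‖ ^ 2 + ‖φ (s k)‖ ^ 2) :=
    h0.summable.comp_injective hs
  have h2 : Summable fun k => ‖w (t k)‖ ^ 2 :=
    h1.of_nonneg_of_le (fun k => by positivity) fun k => by rw [hw1]; exact hv k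
  have h3 : Summable fun i => ‖w i‖ ^ 2 :=
    (ht.summable_iff fun i hi => by rw [hw2 i hi]; simp).1 h2
  have hmem : Memℓp w 2 := memℓp_gen (by simpa using h3)
  refine ⟨⟨w, hmem⟩, hw1, hw2, ?_⟩
  have h4 := lp_hasSum_norm_sq (⟨w, hmem⟩ : lp E 2)
  have h5 : HasSum (fun k => ‖w (t k)‖ ^ 2) (‖(⟨w, hmem⟩ : lp E 2)‖ ^ 2) :=
    (ht.hasSum_iff fun i hi => by
      change ‖w i‖ ^ 2 = 0
      rw [hw2 i hi]; simp).2 h4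
  calc _ ≤ ∑' k, C ^ 2 * (‖φ' (s k)‖ ^ 2 + ‖φ (s k)‖ ^ 2) :=
        hasSum_le (fun k => by rw [hw1]; exact hv k) h5 h1.hasSum
    _ ≤ ∑' i, C ^ 2 * (‖φ' i‖ ^ 2 + ‖φ i‖ ^ 2) :=
        h1.tsum_le_tsum_of_inj s hs (fun i _ => by positivity) (fun k => le_rfl) h0.summable
    _ = _ := h0.tsum_eq

/-- `A` is the operator on the Hilbert sum of the `E i`, on its maximal domain, with the bounded
matrix elements `T k` from `E (s k)` to `E (t k)`. -/
structure IsBlock (A : lp E 2 →ₗ.[ℂ] lp E 2) (s t : κ → ι) (T : ∀ k, E (s k) →L[ℂ] E (t k)) :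
    Prop where
  inj_source : Function.Injective s
  inj_target : Function.Injective t
  graph_iff : ∀ ψ φ : lp E 2, (ψ, φ) ∈ A.graph ↔
    (∀ k, φ (t k) = T k (ψ (s k))) ∧ ∀ i ∉ Set.range t, φ i = 0

variable {A : lp E 2 →ₗ.[ℂ] lp E 2} {s t : κ → ι} {T : ∀ k, E (s k) →L[ℂ] E (t k)}

theorem le_mul_add_of_sq_le {a b c C : ℝ} (hb : 0 ≤ b) (hc : 0 ≤ c) (hC : 0 ≤ C)
    (h : a ^ 2 ≤ C ^ 2 * (b ^ 2 + c ^ 2)) : a ≤ C * (b + c) :=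
  abs_le_of_sq_le_sq' (h.trans (by rw [mul_pow]; gcongr; nlinarith)) (by positivity) |>.2

theorem IsBlock.exists_graph (hA : IsBlock A s t T) {C : ℝ} (hC : 0 ≤ C) {φ φ' : lp E 2}
    (h : ∀ k, ‖T k (φ (s k))‖ ^ 2 ≤ C ^ 2 * (‖φ' (s k)‖ ^ 2 + ‖φ (s k)‖ ^ 2)) :
    ∃ w, (φ, w) ∈ A.graph ∧ ‖w‖ ≤ C * (‖φ'‖ + ‖φ‖) := by
  obtain ⟨w, h1, h2, h3⟩ := exists_lp_of_norm_sq_le hA.inj_source hA.inj_target _ φ φ' h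
  exact ⟨w, (hA.graph_iff _ _).2 ⟨h1, h2⟩,
    le_mul_add_of_sq_le (norm_nonneg _) (norm_nonneg _) hC h3⟩

/-- The vector with components `(T k)* φ (t k)` in the places `s k` is the value of the adjoint at
`φ`: paired with the graph of `A`, both inner products reduce to sums over `k` that agree term by
term. Only these vectors are needed, not a description of the full domain of the adjoint. -/
theorem IsBlock.exists_adjoint_graph [∀ i, CompleteSpace (E i)] (hA : IsBlock A s t T)
    (hd : Dense (A.domain : Set (lp E 2)))
    {C : ℝ} (hC : 0 ≤ C) {φ φ' : lp E 2}
    (h : ∀ k, ‖(T k).adjoint (φ (t k))‖ ^ 2 ≤ C ^ 2 * (‖φ' (t k)‖ ^ 2 + ‖φ (t k)‖ ^ 2)) :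
    ∃ w, (φ, w) ∈ A.adjoint.graph ∧ ‖w‖ ≤ C * (‖φ'‖ + ‖φ‖) := by
  obtain ⟨w, h1, h2, h3⟩ := exists_lp_of_norm_sq_le hA.inj_target hA.inj_source
    (fun k => (T k).adjoint (φ (t k))) φ φ' h
  have key : ∀ x : A.domain, inner ℂ w (x : lp E 2) = inner ℂ φ (A x) := by
    intro x
    obtain ⟨g1, g2⟩ := (hA.graph_iff _ _).1 (A.mem_graph x)
    have e1 : HasSum (fun k => inner ℂ (w (s k)) ((x : lp E 2) (s k))) (inner ℂ w (x : lp E 2)) :=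
      (hA.inj_source.hasSum_iff fun i hi => by rw [h2 i hi, inner_zero_left]).2
        (lp.hasSum_inner w (x : lp E 2))
    have e2 : HasSum (fun k => inner ℂ (φ (t k)) (A x (t k))) (inner ℂ φ (A x)) :=
      (hA.inj_target.hasSum_iff fun i hi => by rw [g2 i hi, inner_zero_right]).2
        (lp.hasSum_inner φ (A x))
    refine e1.unique (e2.congr_fun ?_)
    intro k
    rw [h1, g1, ContinuousLinearMap.adjoint_inner_left]
  have hmem : φ ∈ A.adjoint.domain := A.mem_adjoint_domain_of_exists φ ⟨w, key⟩
  refine ⟨w, ?_, le_mul_add_of_sq_le (norm_nonneg _) (norm_nonneg _) hC h3⟩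
  rw [LinearPMap.mem_graph_iff]
  exact ⟨⟨φ, hmem⟩, rfl, LinearPMap.adjoint_apply_eq hd _ key⟩

end Block

/-! ## Square integrals -/

section SqInt

open ENNReal

variable {Ω : Type*} [MeasurableSpace Ω] {μ : Measure Ω}

theorem sq_lintegral_mul_le {f g : Ω → ℝ≥0∞} (hf : AEMeasurable f μ) (hg : AEMeasurable g μ) :
    (∫⁻ x, f x * g x ∂μ) ^ 2 ≤ (∫⁻ x, f x ^ 2 ∂μ) * ∫⁻ x, g x ^ 2 ∂μ := by
  have h := ENNReal.lintegral_mul_le_Lp_mul_Lq μ Real.HolderConjugate.two_two hf hg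
  have h2 := pow_le_pow_left₀ (zero_le) h 2
  refine h2.trans (le_of_eq ?_)
  rw [mul_pow, ← ENNReal.rpow_natCast, ← ENNReal.rpow_natCast, ← ENNReal.rpow_mul,
    ← ENNReal.rpow_mul]
  norm_num

theorem memLp_two_iff {f : Ω → ℂ} (hf : AEStronglyMeasurable f μ) :
    MemLp f 2 μ ↔ ∫⁻ x, ‖f x‖ₑ ^ 2 ∂μ < ⊤ := by
  have h := eLpNorm_lt_top_iff_lintegral_rpow_enorm_lt_top (f := f) (μ := μ) (p := 2)
    two_ne_zero ENNReal.ofNat_ne_top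
  simp only [ENNReal.toReal_ofNat] at h
  simp only [MemLp, hf, true_and, h]
  norm_cast

theorem integral_conj_mul_self {f : Ω → ℂ} (hf : MemLp f 2 μ) :
    ∫ x, (starRingEnd ℂ) (f x) * f x ∂μ = ((∫⁻ x, ‖f x‖ₑ ^ 2 ∂μ).toReal : ℂ) := by
  rw [← integral_toReal]
  · rw [← integral_complex_ofReal]
    refine integral_congr_ae (Filter.Eventually.of_forall fun x => ?_)
    simp [Complex.conj_mul']
  · exact hf.1.enorm.pow_const 2
  · exact Filter.Eventually.of_forall fun x => by simp [ENNReal.pow_lt_top_iff]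

theorem integrable_conj_mul {f g : Ω → ℂ} (hf : MemLp f 2 μ) (hg : MemLp g 2 μ) :
    Integrable (fun x => (starRingEnd ℂ) (f x) * g x) μ :=
  MemLp.integrable_mul (p := 2) (q := 2) hf.star hg

theorem sq_enorm_integral_conj_mul_le {f g : Ω → ℂ} (hf : AEStronglyMeasurable f μ)
    (hg : AEStronglyMeasurable g μ) :
    ‖∫ x, (starRingEnd ℂ) (f x) * g x ∂μ‖ₑ ^ 2 ≤
      (∫⁻ x, ‖f x‖ₑ ^ 2 ∂μ) * ∫⁻ x, ‖g x‖ₑ ^ 2 ∂μ := by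
  refine le_trans (pow_le_pow_left₀ zero_le (enorm_integral_le_lintegral_enorm _) 2) ?_
  refine le_trans (le_of_eq ?_) (sq_lintegral_mul_le hf.enorm hg.enorm)
  simp [enorm_mul]

theorem integral_comp_of_measurePreserving {Ω' : Type*} [MeasurableSpace Ω'] {ν : Measure Ω'}
    {g : Ω → Ω'} (hg : MeasurePreserving g μ ν) {f : Ω' → ℂ} (hf : AEStronglyMeasurable f ν) :
    ∫ x, f (g x) ∂μ = ∫ y, f y ∂ν := by
  rw [← hg.map_eq, integral_map hg.aemeasurable (hg.map_eq ▸ hf)]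

/-- Pairing a function of definite symmetry type with a signed sum over symmetries. -/
theorem integral_conj_mul_sum {J : Type*} [Fintype J] {g : J → Ω → Ω}
    (hg : ∀ j, MeasurePreserving (g j) μ μ) {ε : J → ℤˣ} {χ u : Ω → ℂ}
    (hχ : ∀ j, ∀ᵐ c ∂μ, χ (g j c) = ((ε j : ℤ) : ℂ) * χ c) (hχ2 : MemLp χ 2 μ)
    (hu : MemLp u 2 μ) :
    ∫ c, (starRingEnd ℂ) (χ c) * ∑ j, ((ε j : ℤ) : ℂ) * u (g j c) ∂μ =
      Fintype.card J * ∫ c, (starRingEnd ℂ) (χ c) * u c ∂μ := by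
  have hi := integrable_conj_mul hχ2 hu
  -- The sign moves from `u` onto `χ` because it squares to one. Each term is then an integrand
  -- composed with `g j`, whose integral does not depend on `j`.
  have hae : ∀ j, (fun c => (starRingEnd ℂ) (χ c) * (((ε j : ℤ) : ℂ) * u (g j c))) =ᵐ[μ]
      fun c => (starRingEnd ℂ) (χ (g j c)) * u (g j c) := fun j => by
    filter_upwards [hχ j] with c hc
    rw [hc]
    rcases Int.units_eq_one_or (ε j) with h | h <;> simp [h]
  simp only [Finset.mul_sum]
  rw [integral_finsetSum]
  · rw [Finset.sum_congr rfl fun j _ => (integral_congr_ae (hae j)).trans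
      (integral_comp_of_measurePreserving (hg j) hi.1)]
    simp
  · intro j _
    rw [integrable_congr (hae j)]
    exact (hg j).integrable_comp_of_integrable hi

end SqInt

/-! ## Alternation -/

section Alternation

variable {X : Type*} {n : ℕ}

/-- The cyclic permutation bringing the `i`-th particle to the front. -/
def front (i : Fin (n + 1)) : Equiv.Perm (Fin (n + 1)) := i.cycleRange.symm

@[simp] theorem front_apply_zero (i : Fin (n + 1)) : front i 0 = i := Fin.cycleRange_symm_zero i

@[simp] theorem front_apply_succ (i : Fin (n + 1)) (j : Fin n) : front i j.succ = i.succAbove j :=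
  Fin.cycleRange_symm_succ i j

theorem sign_front (i : Fin (n + 1)) : Equiv.Perm.sign (front i) = (-1) ^ (i : ℕ) := by
  rw [front, Equiv.Perm.sign_symm, Fin.sign_cycleRange]

theorem tail_comp_front (c : Fin (n + 1) → X) (i : Fin (n + 1)) :
    Fin.tail (c ∘ front i) = i.removeNth c := by
  funext j
  simp [Fin.tail, Fin.removeNth]

/-- The sum over all ways to bring one particle to the front, with signs given by `ε`. -/
def alt (ε : Equiv.Perm (Fin (n + 1)) →* ℤˣ) (u : (Fin (n + 1) → X) → ℂ) (c : Fin (n + 1) → X) :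
    ℂ :=
  ∑ i, ((ε (front i) : ℤ) : ℂ) * u (c ∘ front i)

/-- The permutations `front i` represent the cosets of the stabilizer of `0`. Acting with `σ` sends
the coset of `i` to that of `σ i`, up to an element of the stabilizer, under which `u` is assumed to
transform by its sign. -/
theorem alt_comp_perm (ε : Equiv.Perm (Fin (n + 1)) →* ℤˣ) {u : (Fin (n + 1) → X) → ℂ}
    (hu : ∀ ρ : Equiv.Perm (Fin (n + 1)), ρ 0 = 0 → ∀ c, u (c ∘ ρ) = ((ε ρ : ℤ) : ℂ) * u c)
    (σ : Equiv.Perm (Fin (n + 1))) (c : Fin (n + 1) → X) :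
    alt ε u (c ∘ σ) = ((ε σ : ℤ) : ℂ) * alt ε u c := by
  unfold alt
  rw [← Equiv.sum_comp σ (fun i => ((ε (front i) : ℤ) : ℂ) * u (c ∘ front i)), Finset.mul_sum]
  refine Finset.sum_congr rfl fun i _ => ?_
  have h1 : (c ∘ σ) ∘ front i = (c ∘ front (σ i)) ∘ ((front (σ i))⁻¹ * σ * front i) := by
    funext j
    simp
  have h2 : ((front (σ i))⁻¹ * σ * front i) 0 = 0 := by
    rw [Equiv.Perm.mul_apply, Equiv.Perm.mul_apply, Equiv.Perm.inv_eq_iff_eq]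
    simp
  rw [h1, hu _ h2]
  simp only [map_mul, map_inv]
  rcases Int.units_eq_one_or (ε (front i)) with h | h <;>
  rcases Int.units_eq_one_or (ε (front (σ i))) with h' | h' <;>
  rcases Int.units_eq_one_or (ε σ) with h'' | h'' <;> simp [h, h', h'']

theorem exists_perm_of_fix_zero (ρ : Equiv.Perm (Fin (n + 1))) (h : ρ 0 = 0) :
    ∃ e : Equiv.Perm (Fin n), (∀ j, ρ j.succ = (e j).succ) ∧
      Equiv.Perm.sign ρ = Equiv.Perm.sign e := by
  obtain ⟨⟨p, e⟩, rfl⟩ := Equiv.Perm.decomposeFin.symm.surjective ρ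
  have hp : p = 0 := by simpa using h
  subst hp
  refine ⟨e, fun j => by simp, by simp [Equiv.Perm.decomposeFin.symm_sign]⟩

theorem tail_comp_of_fix_zero {ρ : Equiv.Perm (Fin (n + 1))} {e : Equiv.Perm (Fin n)}
    (he : ∀ j, ρ j.succ = (e j).succ) (c : Fin (n + 1) → X) :
    Fin.tail (c ∘ ρ) = Fin.tail c ∘ e := by
  funext j
  simp [Fin.tail, he]

/-- Antisymmetric functions. -/
def Antisymm (g : (Fin n → X) → ℂ) : Prop :=
  ∀ (e : Equiv.Perm (Fin n)) c, g (c ∘ e) = ((Equiv.Perm.sign e : ℤ) : ℂ) * g c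

theorem antisymm_alt {u : X → (Fin n → X) → ℂ} (hu : ∀ x, Antisymm (u x)) :
    Antisymm (alt Equiv.Perm.sign fun c => u (c 0) (Fin.tail c)) := by
  intro σ c
  refine alt_comp_perm _ (fun ρ hρ c => ?_) σ c
  obtain ⟨e, he, hs⟩ := exists_perm_of_fix_zero ρ hρ
  rw [tail_comp_of_fix_zero he, hs, Function.comp_apply, hρ, hu]

theorem Antisymm.insertNth {g : (Fin (n + 1) → X) → ℂ} (hg : Antisymm g) (j : Fin (n + 1)) (y : X)
    (c : Fin n → X) : g (j.insertNth y c) = (-1) ^ (j : ℕ) * g (Fin.cons y c) := by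
  have h : (Fin.cons y c : Fin (n + 1) → X) = (j.insertNth y c : Fin (n + 1) → X) ∘ front j := by
    funext i
    refine Fin.cases ?_ (fun k => ?_) i <;> simp
  rw [h, hg, sign_front]
  push_cast
  rw [← mul_assoc, ← pow_add, Even.neg_one_pow ⟨_, rfl⟩, one_mul]

end Alternation

/-! ## Configurations of one species -/

section Insert

open ENNReal

variable {X : Type} [MeasureSpace X] [SigmaFinite (volume : Measure X)] {n : ℕ}

theorem measurePreserving_insertNth (i : Fin (n + 1)) :
    MeasurePreserving (fun q : X × (Fin n → X) => (i.insertNth q.1 q.2 : Fin (n + 1) → X))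
      volume volume :=
  (volume_preserving_piFinSuccAbove (fun _ : Fin (n + 1) => X) i).symm

theorem measurePreserving_cons' :
    MeasurePreserving (fun q : X × (Fin n → X) => (Fin.cons q.1 q.2 : Fin (n + 1) → X))
      volume volume := by
  have h := measurePreserving_insertNth (X := X) (n := n) 0
  simpa only [Fin.insertNth_zero'] using h

theorem measurePreserving_comp_perm (ρ : Equiv.Perm (Fin n)) :
    MeasurePreserving (fun x : Fin n → X => x ∘ ρ) volume volume := by
  have h := volume_measurePreserving_piCongrLeft (fun _ : Fin n => X) ρ.symm
  have e : (fun x : Fin n → X => x ∘ ρ) =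
      MeasurableEquiv.piCongrLeft (fun _ : Fin n => X) ρ.symm := by
    funext x i
    obtain ⟨i, rfl⟩ := ρ.symm.surjective i
    rw [MeasurableEquiv.coe_piCongrLeft, Equiv.piCongrLeft_apply_apply]
    simp
  rw [e]
  exact h

theorem lintegral_fin_succ {h : (Fin (n + 1) → X) → ℝ≥0∞} (hh : Measurable h) :
    ∫⁻ c, h c = ∫⁻ x, ∫⁻ c, h (Fin.cons x c) := by
  rw [← measurePreserving_cons'.lintegral_comp hh]
  exact lintegral_prod _ (hh.comp measurePreserving_cons'.measurable).aemeasurable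

theorem measurable_tail {X : Type*} [MeasurableSpace X] {n : ℕ} :
    Measurable (Fin.tail : (Fin (n + 1) → X) → Fin n → X) :=
  measurable_pi_lambda _ fun j => measurable_pi_apply j.succ

theorem sqInt_tensor {f : X → ℂ} {g : (Fin n → X) → ℂ} (hf : Measurable f) (hg : Measurable g) :
    ∫⁻ c : Fin (n + 1) → X, ‖f (c 0) * g (Fin.tail c)‖ₑ ^ 2 =
      (∫⁻ x, ‖f x‖ₑ ^ 2) * ∫⁻ c, ‖g c‖ₑ ^ 2 := by
  have ht := measurable_tail (X := X) (n := n)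
  rw [lintegral_fin_succ (by fun_prop)]
  simp only [Fin.cons_zero, Fin.tail_cons, enorm_mul, mul_pow]
  rw [← lintegral_mul_const _ (by fun_prop)]
  refine lintegral_congr fun x => ?_
  rw [lintegral_const_mul _ (by fun_prop)]

/-- The overlap of `f ⊗ g` with its image under exchanging the first particle with another one. -/
theorem integral_exchange {f : X → ℂ} {g : (Fin (n + 1) → X) → ℂ} (hf : Measurable f)
    (hg : Measurable g) (hf2 : MemLp f 2) (hg2 : MemLp g 2) (ha : Antisymm g)
    (j : Fin (n + 1)) :
    ∃ r : ℝ, 0 ≤ r ∧ (-1) ^ ((j.succ : Fin (n + 2)) : ℕ) * ∫ c : Fin (n + 2) → X,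
      (starRingEnd ℂ) (f ((c ∘ front j.succ) 0) * g (Fin.tail (c ∘ front j.succ))) *
        (f (c 0) * g (Fin.tail c)) = -(r : ℂ) := by
  have ht := measurable_tail (X := X) (n := n + 1)
  let u : (Fin (n + 2) → X) → ℂ := fun c => f (c 0) * g (Fin.tail c)
  have hum : Measurable u := by fun_prop
  have hu2 : MemLp u 2 := by
    rw [memLp_two_iff hum.aestronglyMeasurable, sqInt_tensor hf hg]
    exact ENNReal.mul_lt_top ((memLp_two_iff hf.aestronglyMeasurable).1 hf2)
      ((memLp_two_iff hg.aestronglyMeasurable).1 hg2)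
  have hint : Integrable fun c => (starRingEnd ℂ) (u (c ∘ front j.succ)) * u c :=
    integrable_conj_mul (hu2.comp_measurePreserving (measurePreserving_comp_perm (front j.succ))) hu2
  -- Coordinates that isolate the two exchanged particles, at positions `0` and `j + 1`, from the
  -- `n` spectators.
  have hΦ : MeasurePreserving (fun q : (Fin n → X) × (X × X) =>
      (Fin.cons q.2.1 (j.insertNth q.2.2 q.1 : Fin (n + 1) → X) : Fin (n + 2) → X))
      volume volume := by
    have b1 : MeasurePreserving (Prod.swap : (Fin n → X) × (X × X) → _) volume volume :=
      Measure.measurePreserving_swap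
    have b2 : MeasurePreserving (MeasurableEquiv.prodAssoc :
      (X × X) × (Fin n → X) ≃ᵐ _) volume volume := measurePreserving_prodAssoc _ _ _
    have b3 := (MeasurePreserving.id (volume : Measure X)).prod
      (measurePreserving_insertNth (X := X) (n := n) j)
    exact measurePreserving_cons'.comp (b3.comp (b2.comp b1))
  have hΦi := hΦ.integrable_comp_of_integrable hint
  have hval : ∀ q : (Fin n → X) × (X × X),
      (starRingEnd ℂ) (u ((Fin.cons q.2.1 (j.insertNth q.2.2 q.1 : Fin (n + 1) → X) :
        Fin (n + 2) → X) ∘ front j.succ)) *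
        u (Fin.cons q.2.1 (j.insertNth q.2.2 q.1 : Fin (n + 1) → X) : Fin (n + 2) → X) =
      (-1) ^ (j : ℕ) * ((f q.2.1 * (starRingEnd ℂ) (g (Fin.cons q.2.1 q.1))) *
        ((starRingEnd ℂ) (f q.2.2) * g (Fin.cons q.2.2 q.1))) := by
    intro q
    have e1 : Fin.tail ((Fin.cons q.2.1 (j.insertNth q.2.2 q.1 : Fin (n + 1) → X) :
        Fin (n + 2) → X) ∘ front j.succ) = Fin.cons q.2.1 q.1 := by
      rw [tail_comp_front]
      funext i
      refine Fin.cases ?_ (fun k => ?_) i <;> simp [Fin.removeNth]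
    simp only [u, e1]
    simp only [Function.comp_apply, front_apply_zero, Fin.cons_succ, Fin.insertNth_apply_same,
      Fin.cons_zero, Fin.tail_cons, ha.insertNth, map_mul]
    ring
  -- For fixed spectators the overlap factorizes over the two exchanged particles into a number
  -- times its conjugate, so `r` is the squared norm of `g` with one particle contracted against
  -- `f`. Up to normalization this is the anticommutation relation `‖b*(f) g‖² = ‖f‖² ‖g‖² - ‖b(f)
  -- g‖²`.
  refine ⟨∫ c : Fin n → X, ‖∫ y, (starRingEnd ℂ) (f y) * g (Fin.cons y c)‖ ^ 2,
    integral_nonneg fun c => by positivity, ?_⟩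
  change _ * ∫ c, (starRingEnd ℂ) (u (c ∘ front j.succ)) * u c = _
  rw [← integral_comp_of_measurePreserving hΦ hint.1]
  simp only [Function.comp_def] at hΦi
  have hval' := funext hval
  simp only [Function.comp_def] at hval' ⊢
  rw [hval'] at hΦi ⊢
  change _ * ∫ q, _ ∂(volume.prod volume) = _
  rw [integral_prod _ hΦi]
  have : ∀ c : Fin n → X, (∫ y : X × X, (-1 : ℂ) ^ (j : ℕ) *
      ((f y.1 * (starRingEnd ℂ) (g (Fin.cons y.1 c))) *
        ((starRingEnd ℂ) (f y.2) * g (Fin.cons y.2 c)))) =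
      (-1 : ℂ) ^ (j : ℕ) * ((‖∫ y, (starRingEnd ℂ) (f y) * g (Fin.cons y c)‖ ^ 2 : ℝ) : ℂ) := by
    intro c
    rw [integral_const_mul]
    congr 1
    change ∫ y, _ ∂(volume.prod volume) = _
    rw [integral_prod_mul (fun y => f y * (starRingEnd ℂ) (g (Fin.cons y c)))
      (fun y => (starRingEnd ℂ) (f y) * g (Fin.cons y c))]
    have e : ∫ y, f y * (starRingEnd ℂ) (g (Fin.cons y c)) =
        (starRingEnd ℂ) (∫ y, (starRingEnd ℂ) (f y) * g (Fin.cons y c)) := by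
      rw [← integral_conj]
      simp
    rw [e, Complex.conj_mul']
    norm_cast
  simp only [this]
  rw [integral_const_mul, integral_complex_ofReal, ← mul_assoc, ← pow_add]
  -- The cyclic permutation contributes `(-1)^(j+1)` and moving the second particle inside `g`
  -- contributes `(-1)^j`; their product is the minus sign of Fermi statistics.
  have hodd : Odd (((j.succ : Fin (n + 2)) : ℕ) + (j : ℕ)) := ⟨j, by simp; ring⟩
  rw [hodd.neg_one_pow]
  simp

/-- Creating a fermion with wave function `f` does not enlarge the norm by more than that of `f`. -/
theorem sqInt_alt_le {f : X → ℂ} {g : (Fin n → X) → ℂ} (hf : Measurable f) (hg : Measurable g)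
    (hf2 : MemLp f 2) (hg2 : MemLp g 2) (ha : Antisymm g) :
    ∫⁻ c, ‖alt Equiv.Perm.sign (fun c => f (c 0) * g (Fin.tail c)) c‖ₑ ^ 2 ≤
      (n + 1) * ((∫⁻ x, ‖f x‖ₑ ^ 2) * ∫⁻ c, ‖g c‖ₑ ^ 2) := by
  have ht := measurable_tail (X := X) (n := n)
  set u : (Fin (n + 1) → X) → ℂ := fun c => f (c 0) * g (Fin.tail c) with hu
  have hum : Measurable u := by fun_prop
  have hsq : ∫⁻ c, ‖u c‖ₑ ^ 2 = (∫⁻ x, ‖f x‖ₑ ^ 2) * ∫⁻ c, ‖g c‖ₑ ^ 2 := sqInt_tensor hf hg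
  have hfin : ∫⁻ c, ‖u c‖ₑ ^ 2 < ⊤ := by
    rw [hsq]
    exact ENNReal.mul_lt_top ((memLp_two_iff hf.aestronglyMeasurable).1 hf2)
      ((memLp_two_iff hg.aestronglyMeasurable).1 hg2)
  have hu2 : MemLp u 2 := (memLp_two_iff hum.aestronglyMeasurable).2 hfin
  have huk : ∀ k, MemLp (fun c => u (c ∘ front k)) 2 := fun k =>
    hu2.comp_measurePreserving (measurePreserving_comp_perm (front k))
  have hW2 : MemLp (alt Equiv.Perm.sign u) 2 :=
    memLp_finsetSum _ fun k _ => (huk k).const_mul _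
  have hWa : Antisymm (alt Equiv.Perm.sign u) :=
    antisymm_alt (u := fun x c => f x * g c) fun x e c => by
      change f x * g (c ∘ e) = _
      rw [ha e c]; ring
  -- Since `alt u` is itself antisymmetric, `‖alt u‖² = (n + 1) ⟨alt u, u⟩`. It remains to bound
  -- `⟨alt u, u⟩` by `‖u‖²`, with no factor from the number of terms.
  have h1 := integral_conj_mul_sum (fun k => measurePreserving_comp_perm (X := X) (front k))
    (ε := fun k => Equiv.Perm.sign (front k)) (χ := alt Equiv.Perm.sign u) (u := u)
    (fun k => Filter.Eventually.of_forall fun c => hWa _ c) hW2 hu2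
  change ∫ c, (starRingEnd ℂ) (alt Equiv.Perm.sign u c) * alt Equiv.Perm.sign u c = _ at h1
  rw [integral_conj_mul_self hW2] at h1
  have h2 : ∃ r : ℝ, 0 ≤ r ∧ ∫ c, (starRingEnd ℂ) (alt Equiv.Perm.sign u c) * u c =
      ((∫⁻ c, ‖u c‖ₑ ^ 2).toReal : ℂ) - r := by
    have h3 : ∫ c, (starRingEnd ℂ) (alt Equiv.Perm.sign u c) * u c =
        ∑ k : Fin (n + 1), (-1) ^ (k : ℕ) * ∫ c, (starRingEnd ℂ) (u (c ∘ front k)) * u c := by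
      simp only [alt, map_sum, Finset.sum_mul, map_mul]
      rw [integral_finsetSum]
      · refine Finset.sum_congr rfl fun k _ => ?_
        rw [← integral_const_mul, sign_front]
        refine integral_congr_ae (Filter.Eventually.of_forall fun c => ?_)
        simp [mul_assoc]
      · intro k _
        simp only [mul_assoc]
        exact (integrable_conj_mul (huk k) hu2).const_mul _
    -- The term `k = 0` is `‖u‖²`; all others are exchange terms and nonpositive.
    rw [h3, Fin.sum_univ_succ]
    have h4 : ∀ c : Fin (n + 1) → X, c ∘ front 0 = c := fun c => by
      funext i
      refine Fin.cases ?_ (fun k => ?_) i <;> simp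
    simp only [h4, Fin.val_zero, pow_zero, one_mul]
    rw [integral_conj_mul_self hu2]
    have h5 : ∀ j : Fin n, ∃ r : ℝ, 0 ≤ r ∧ (-1) ^ ((j.succ : Fin (n + 1)) : ℕ) *
        ∫ c, (starRingEnd ℂ) (u (c ∘ front j.succ)) * u c = -(r : ℂ) := by
      intro j
      rcases n with _ | n
      · exact j.elim0
      · exact integral_exchange hf hg hf2 hg2 ha j
    choose r hr0 hr using h5
    refine ⟨∑ j, r j, Finset.sum_nonneg fun j _ => hr0 j, ?_⟩
    simp only [hr, Finset.sum_neg_distrib]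
    push_cast
    ring
  obtain ⟨r, hr0, hr⟩ := h2
  rw [hr] at h1
  have h6 : (∫⁻ c, ‖alt Equiv.Perm.sign u c‖ₑ ^ 2).toReal =
      (n + 1) * ((∫⁻ c, ‖u c‖ₑ ^ 2).toReal - r) := by
    have := h1
    simp only [Fintype.card_fin] at this
    exact_mod_cast this
  have h7 : ∫⁻ c, ‖alt Equiv.Perm.sign u c‖ₑ ^ 2 ≠ ⊤ := ((memLp_two_iff hW2.1).1 hW2).ne
  rw [← hsq, ← ENNReal.ofReal_toReal h7, h6]
  refine (ENNReal.ofReal_le_ofReal (q := (n + 1) * (∫⁻ c, ‖u c‖ₑ ^ 2).toReal) ?_).trans ?_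
  · gcongr; linarith
  · rw [ENNReal.ofReal_mul (by positivity), ENNReal.ofReal_toReal hfin.ne]
    gcongr
    rw [ENNReal.ofReal_add (by positivity) (by norm_num)]
    simp

/-- Annihilating a fermion: `|⟨χ, f ⊗ g⟩|² ≤ ‖χ‖² ‖f‖² ‖g‖² / (n + 1)` for antisymmetric `χ`, `g`. -/
theorem fermion_pairing_le {f : X → ℂ} {g : (Fin n → X) → ℂ} {χ : (Fin (n + 1) → X) → ℂ}
    (hf : Measurable f) (hg : Measurable g) (hf2 : MemLp f 2) (hg2 : MemLp g 2)
    (ha : Antisymm g) (hχa : Antisymm χ) (hχ2 : MemLp χ 2) :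
    (n + 1) * ‖∫ c, (starRingEnd ℂ) (χ c) * (f (c 0) * g (Fin.tail c))‖ₑ ^ 2 ≤
      (∫⁻ c, ‖χ c‖ₑ ^ 2) * ((∫⁻ x, ‖f x‖ₑ ^ 2) * ∫⁻ c, ‖g c‖ₑ ^ 2) := by
  have ht := measurable_tail (X := X) (n := n)
  set u : (Fin (n + 1) → X) → ℂ := fun c => f (c 0) * g (Fin.tail c) with hu
  have hum : Measurable u := by fun_prop
  have hu2 : MemLp u 2 := by
    rw [memLp_two_iff hum.aestronglyMeasurable, sqInt_tensor hf hg]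
    exact ENNReal.mul_lt_top ((memLp_two_iff hf.aestronglyMeasurable).1 hf2)
      ((memLp_two_iff hg.aestronglyMeasurable).1 hg2)
  have hW2 : MemLp (alt Equiv.Perm.sign u) 2 := memLp_finsetSum _ fun k _ =>
    (hu2.comp_measurePreserving (measurePreserving_comp_perm (front k))).const_mul _
  -- `⟨χ, alt u⟩ = (n + 1) ⟨χ, u⟩`. Cauchy–Schwarz with `sqInt_alt_le` then bounds `(n + 1)² |⟨χ,
  -- u⟩|²` by `n + 1` times the product of norms, and one factor `n + 1` cancels.
  have h1 := integral_conj_mul_sum (fun k => measurePreserving_comp_perm (X := X) (front k))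
    (ε := fun k => Equiv.Perm.sign (front k)) (χ := χ) (u := u)
    (fun k => Filter.Eventually.of_forall fun c => hχa _ c) hχ2 hu2
  change ∫ c, (starRingEnd ℂ) (χ c) * alt Equiv.Perm.sign u c = _ at h1
  have h2 := sq_enorm_integral_conj_mul_le hχ2.1 hW2.1
  rw [h1, enorm_mul, mul_pow] at h2
  have h3 : ‖((Fintype.card (Fin (n + 1)) : ℕ) : ℂ)‖ₑ = (n + 1 : ℝ≥0∞) := by
    rw [← ofReal_norm, Complex.norm_natCast, ENNReal.ofReal_natCast]
    simp
  rw [h3] at h2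
  have h4 := h2.trans (mul_le_mul_right (sqInt_alt_le hf hg hf2 hg2 ha) _)
  rw [mul_left_comm, sq, mul_assoc] at h4
  exact (ENNReal.mul_le_mul_iff_right (by simp) (by finiteness)).1 h4

end Insert

-- Cauchy–Schwarz for a function known only through the pointwise bound `f ≤ √(k⁻¹ g) √h`, so
-- measurability is asked of the majorants alone. The constant `k` passes through unchanged, which
-- allows integrating out one group of variables after another.
open ENNReal in
theorem mul_sq_lintegral_le {Ω : Type*} [MeasurableSpace Ω] {μ : Measure Ω} {k : ℝ≥0∞}
    (hk0 : k ≠ 0) (hk : k ≠ ⊤) {f g h : Ω → ℝ≥0∞} (hg : Measurable g) (hh : Measurable h)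
    (hf : ∀ x, k * f x ^ 2 ≤ g x * h x) :
    k * (∫⁻ x, f x ∂μ) ^ 2 ≤ (∫⁻ x, g x ∂μ) * ∫⁻ x, h x ∂μ := by
  have h1 : ∀ x, f x ≤ (k⁻¹ * g x) ^ (1 / 2 : ℝ) * h x ^ (1 / 2 : ℝ) := by
    intro x
    rw [← ENNReal.mul_rpow_of_nonneg _ _ (by norm_num)]
    have h2 : f x ^ 2 ≤ k⁻¹ * g x * h x := by
      rw [mul_assoc, ← ENNReal.inv_mul_cancel_left (a := k) (b := f x ^ 2) hk0 hk]
      exact mul_le_mul_right (hf x) _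
    have h3 := ENNReal.rpow_le_rpow h2 (z := 1 / 2) (by norm_num)
    rwa [← ENNReal.rpow_natCast, ← ENNReal.rpow_mul, Nat.cast_ofNat, mul_one_div_cancel two_ne_zero,
      ENNReal.rpow_one] at h3
  have h4 := sq_lintegral_mul_le (μ := μ) ((hg.const_mul k⁻¹).pow_const (1 / 2 : ℝ)).aemeasurable
    (hh.pow_const (1 / 2 : ℝ)).aemeasurable
  have h5 : ∀ a : ℝ≥0∞, (a ^ (1 / 2 : ℝ)) ^ 2 = a := fun a => by
    rw [← ENNReal.rpow_natCast, ← ENNReal.rpow_mul]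
    norm_num
  simp only [h5] at h4
  rw [lintegral_const_mul _ hg] at h4
  calc _ ≤ k * (k⁻¹ * (∫⁻ x, g x ∂μ) * ∫⁻ x, h x ∂μ) := by
        exact mul_le_mul_right
          ((pow_le_pow_left₀ zero_le (lintegral_mono h1) 2).trans h4) _
    _ = _ := by rw [mul_assoc, ENNReal.mul_inv_cancel_left hk0 hk]

set_option linter.unusedSectionVars false

/-! ### Measure-preserving rearrangements of products -/

section Shuffle

variable {A A' Q Q' : Type*} [MeasureSpace A] [MeasureSpace A'] [MeasureSpace Q] [MeasureSpace Q']
  [SigmaFinite (volume : Measure A)] [SigmaFinite (volume : Measure A')]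
  [SigmaFinite (volume : Measure Q)] [SigmaFinite (volume : Measure Q')]

theorem measurePreserving_prodAssoc' : MeasurePreserving
    (fun q : (A × A') × Q => (q.1.1, (q.1.2, q.2))) volume volume :=
  measurePreserving_prodAssoc (volume : Measure A) (volume : Measure A') (volume : Measure Q)

theorem measurePreserving_prodAssoc_symm : MeasurePreserving
    (fun q : A × (A' × Q) => ((q.1, q.2.1), q.2.2)) volume volume :=
  (measurePreserving_prodAssoc (volume : Measure A) (volume : Measure A')
    (volume : Measure Q)).symm

theorem measurePreserving_swap' : MeasurePreserving (fun q : A × A' => (q.2, q.1))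
    volume volume :=
  Measure.measurePreserving_swap

theorem measurePreserving_leftComm : MeasurePreserving
    (fun q : A × (A' × Q) => (q.2.1, (q.1, q.2.2))) volume volume :=
  measurePreserving_prodAssoc'.comp ((measurePreserving_swap'.prod (.id _)).comp
    measurePreserving_prodAssoc_symm)

theorem measurePreserving_shuffle : MeasurePreserving
    (fun q : (A × A') × (Q × Q') => ((q.1.1, q.2.1), (q.1.2, q.2.2))) volume volume :=
  measurePreserving_prodAssoc_symm.comp
    (((MeasurePreserving.id (volume : Measure A)).prod measurePreserving_leftComm).comp
      measurePreserving_prodAssoc')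

end Shuffle

theorem measurePreserving_split {X : Type} [MeasureSpace X] [SigmaFinite (volume : Measure X)]
    {n : ℕ} : MeasurePreserving (fun c : Fin (n + 1) → X => (c 0, Fin.tail c)) volume volume := by
  have h := volume_preserving_piFinSuccAbove (fun _ : Fin (n + 1) => X) 0
  have e : (fun c : Fin (n + 1) → X => (c 0, Fin.tail c)) =
      MeasurableEquiv.piFinSuccAbove (fun _ : Fin (n + 1) => X) 0 := by
    funext c
    simp [MeasurableEquiv.piFinSuccAbove, Fin.insertNthEquiv]
  rw [e]
  exact h

/-! ## Contraction of a wave function with a kernel -/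

section Contraction

variable {Ω Ω' O R Z : Type*} [MeasureSpace Ω] [MeasureSpace Ω'] [MeasureSpace O] [MeasureSpace R]
  [MeasureSpace Z] [SigmaFinite (volume : Measure Ω)] [SigmaFinite (volume : Measure Ω')]
  [SigmaFinite (volume : Measure O)] [SigmaFinite (volume : Measure R)]
  [SigmaFinite (volume : Measure Z)]
  {π : Ω → O × R} {ι : Z × R → Ω'} {F : O → Z → ℂ} {ψ φ : Ω' → ℂ}

/-- The function `(o, r) ↦ ∫ F(o, z) ψ(z, r) dz`, in coordinates given by `π` and `ι`. -/
def contract (π : Ω → O × R) (ι : Z × R → Ω') (F : O → Z → ℂ) (ψ : Ω' → ℂ) (c : Ω) : ℂ :=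
  ∫ z, F (π c).1 z * ψ (ι (z, (π c).2))

/-- Fubini: a null set in the input variables meets almost every slice along which the contraction
integrates in a null set. Hence contractions do not depend on representatives. -/
theorem ae_contract (hπ : MeasurePreserving π volume volume)
    (hι : MeasurePreserving ι volume volume) {P : Ω' → Prop} (hP : ∀ᵐ w, P w) :
    ∀ᵐ c : Ω, ∀ᵐ z : Z, P (ι (z, (π c).2)) := by
  have h1 : MeasurePreserving (fun q : R × Z => ι (q.2, q.1)) volume volume :=
    hι.comp measurePreserving_swap'
  have h2 := Measure.ae_ae_of_ae_prod (h1.quasiMeasurePreserving.ae hP)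
  exact (Measure.quasiMeasurePreserving_snd.comp hπ.quasiMeasurePreserving).ae h2

theorem ae_contract_kernel (hπ : MeasurePreserving π volume volume) {P : O → Z → Prop}
    (hP : ∀ᵐ q : O × Z, P q.1 q.2) : ∀ᵐ c : Ω, ∀ᵐ z : Z, P (π c).1 z :=
  (Measure.quasiMeasurePreserving_fst.comp hπ.quasiMeasurePreserving).ae
    (Measure.ae_ae_of_ae_prod hP)

theorem contract_congr (hπ : MeasurePreserving π volume volume)
    (hι : MeasurePreserving ι volume volume) (h : ∀ᵐ w, ψ w = φ w) :
    ∀ᵐ c : Ω, contract π ι F ψ c = contract π ι F φ c := by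
  filter_upwards [ae_contract hπ hι h] with c hc
  exact integral_congr_ae (hc.mono fun z hz => by simp only [hz])

variable (hπ : MeasurePreserving π volume volume) (hι : MeasurePreserving ι volume volume)
  (hF : Measurable fun q : O × Z => F q.1 q.2) (hψ : Measurable ψ)

include hπ hι hF hψ

/-- The Hilbert–Schmidt estimate. Cauchy–Schwarz in `z` splits the integrand into a function of `o`
times a function of `r`, and the measure-preserving coordinates let the integral factorize. It gives
integrability and boundedness on each sector; the dependence on particle numbers is obtained
separately in `contract_pairing_le`. -/
theorem lintegral_sq_contract_le :
    ∫⁻ c : Ω, (∫⁻ z, ‖F (π c).1 z‖ₑ * ‖ψ (ι (z, (π c).2))‖ₑ) ^ 2 ≤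
      (∫⁻ q : O × Z, ‖F q.1 q.2‖ₑ ^ 2) * ∫⁻ w, ‖ψ w‖ₑ ^ 2 := by
  have hιm := hι.measurable
  have hm1 : Measurable fun o : O => ∫⁻ z, ‖F o z‖ₑ ^ 2 :=
    (hF.enorm.pow_const 2).lintegral_prod_right'
  have hm2 : Measurable fun q : R × Z => ‖ψ (ι (q.2, q.1))‖ₑ ^ 2 := by fun_prop
  have hm2' : Measurable fun r : R => ∫⁻ z, ‖ψ (ι (z, r))‖ₑ ^ 2 := hm2.lintegral_prod_right'
  have h1 : ∀ c, (∫⁻ z, ‖F (π c).1 z‖ₑ * ‖ψ (ι (z, (π c).2))‖ₑ) ^ 2 ≤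
      (∫⁻ z, ‖F (π c).1 z‖ₑ ^ 2) * ∫⁻ z, ‖ψ (ι (z, (π c).2))‖ₑ ^ 2 := fun c =>
    sq_lintegral_mul_le (hF.comp measurable_prodMk_left).enorm.aemeasurable
      (hψ.comp (hιm.comp (measurable_id.prodMk measurable_const))).enorm.aemeasurable
  refine (lintegral_mono h1).trans (le_of_eq ?_)
  rw [hπ.lintegral_comp (f := fun q : O × R => (∫⁻ z, ‖F q.1 z‖ₑ ^ 2) *
    ∫⁻ z, ‖ψ (ι (z, q.2))‖ₑ ^ 2) ((hm1.comp measurable_fst).mul (hm2'.comp measurable_snd))]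
  refine (lintegral_prod_mul hm1.aemeasurable hm2'.aemeasurable).trans ?_
  congr 1
  · exact (lintegral_prod _ (hF.enorm.pow_const 2).aemeasurable).symm
  · have h3 : MeasurePreserving (fun q : R × Z => ι (q.2, q.1)) volume volume :=
      hι.comp measurePreserving_swap'
    rw [← h3.lintegral_comp (hψ.enorm.pow_const 2)]
    exact (lintegral_prod _ hm2.aemeasurable).symm

theorem measurable_contract_integrand :
    Measurable fun q : Ω × Z => F (π q.1).1 q.2 * ψ (ι (q.2, (π q.1).2)) := by
  have hιm := hι.measurable
  have hπm := hπ.measurable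
  have h1 : Measurable fun q : Ω × Z => F (π q.1).1 q.2 :=
    hF.comp ((hπm.comp measurable_fst).fst.prodMk measurable_snd)
  exact h1.mul (by fun_prop)

theorem measurable_contract : Measurable (contract π ι F ψ) :=
  (measurable_contract_integrand hπ hι hF hψ).stronglyMeasurable.integral_prod_right'.measurable

theorem sq_enorm_contract_le :
    ∫⁻ c, ‖contract π ι F ψ c‖ₑ ^ 2 ≤
      (∫⁻ q : O × Z, ‖F q.1 q.2‖ₑ ^ 2) * ∫⁻ w, ‖ψ w‖ₑ ^ 2 := by
  refine le_trans (lintegral_mono fun c => ?_) (lintegral_sq_contract_le hπ hι hF hψ)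
  gcongr
  refine (enorm_integral_le_lintegral_enorm _).trans (le_of_eq ?_)
  simp [enorm_mul]

variable (hF2 : ∫⁻ q : O × Z, ‖F q.1 q.2‖ₑ ^ 2 < ⊤) (hψ2 : ∫⁻ w, ‖ψ w‖ₑ ^ 2 < ⊤)

include hF2 hψ2

theorem memLp_contract : MemLp (contract π ι F ψ) 2 :=
  (memLp_two_iff (measurable_contract hπ hι hF hψ).aestronglyMeasurable).2
    ((sq_enorm_contract_le hπ hι hF hψ).trans_lt (ENNReal.mul_lt_top hF2 hψ2))

theorem ae_integrable_contract :
    ∀ᵐ c : Ω, Integrable fun z => F (π c).1 z * ψ (ι (z, (π c).2)) := by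
  have hm := measurable_contract_integrand hπ hι hF hψ
  have h1 : Measurable fun c => ∫⁻ z, ‖F (π c).1 z‖ₑ * ‖ψ (ι (z, (π c).2))‖ₑ := by
    simp only [← enorm_mul]
    exact hm.enorm.lintegral_prod_right'
  have h2 := ae_lt_top (h1.pow_const 2) ((lintegral_sq_contract_le hπ hι hF hψ).trans_lt
    (ENNReal.mul_lt_top hF2 hψ2)).ne
  filter_upwards [h2] with c hc
  refine ⟨(hm.comp measurable_prodMk_left).aestronglyMeasurable, ?_⟩
  rw [hasFiniteIntegral_iff_enorm]
  simp only [enorm_mul]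
  exact (ENNReal.pow_lt_top_iff.1 hc).resolve_right two_ne_zero

theorem integrable_conj_mul_contract {χ : Ω → ℂ} (hχ : Measurable χ)
    (hχ2 : ∫⁻ w, ‖χ w‖ₑ ^ 2 < ⊤) : Integrable (fun q : Ω × Z =>
      (starRingEnd ℂ) (χ q.1) * (F (π q.1).1 q.2 * ψ (ι (q.2, (π q.1).2)))) := by
  have hm := measurable_contract_integrand hπ hι hF hψ
  have hm' : Measurable fun q : Ω × Z =>
      (starRingEnd ℂ) (χ q.1) * (F (π q.1).1 q.2 * ψ (ι (q.2, (π q.1).2))) :=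
    (Complex.continuous_conj.measurable.comp (hχ.comp measurable_fst)).mul hm
  refine ⟨hm'.aestronglyMeasurable, ?_⟩
  rw [hasFiniteIntegral_iff_enorm]
  have h1 : Measurable fun c => ∫⁻ z, ‖F (π c).1 z‖ₑ * ‖ψ (ι (z, (π c).2))‖ₑ := by
    simp only [← enorm_mul]
    exact hm.enorm.lintegral_prod_right'
  have h2 : ∫⁻ q : Ω × Z,
      ‖(starRingEnd ℂ) (χ q.1) * (F (π q.1).1 q.2 * ψ (ι (q.2, (π q.1).2)))‖ₑ =
      ∫⁻ c, ‖χ c‖ₑ * ∫⁻ z, ‖F (π c).1 z‖ₑ * ‖ψ (ι (z, (π c).2))‖ₑ := by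
    refine (lintegral_prod _ hm'.enorm.aemeasurable).trans (lintegral_congr fun c => ?_)
    simp only [enorm_mul, RCLike.enorm_conj]
    refine lintegral_const_mul _ ?_
    simp only [← enorm_mul]
    exact hm.enorm.comp measurable_prodMk_left
  rw [h2]
  have h3 := (sq_lintegral_mul_le hχ.enorm.aemeasurable h1.aemeasurable).trans_lt
    (ENNReal.mul_lt_top hχ2 ((lintegral_sq_contract_le hπ hι hF hψ).trans_lt
      (ENNReal.mul_lt_top hF2 hψ2)))
  exact (ENNReal.pow_lt_top_iff.1 h3).resolve_right two_ne_zero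

theorem integral_conj_mul_contract {χ : Ω → ℂ} (hχ : Measurable χ)
    (hχ2 : ∫⁻ w, ‖χ w‖ₑ ^ 2 < ⊤) : ∫ c, (starRingEnd ℂ) (χ c) * contract π ι F ψ c =
      ∫ q : Ω × Z, (starRingEnd ℂ) (χ q.1) * (F (π q.1).1 q.2 * ψ (ι (q.2, (π q.1).2))) := by
  refine Eq.symm ((integral_prod _
    (integrable_conj_mul_contract hπ hι hF hψ hF2 hψ2 hχ hχ2)).trans ?_)
  simp only [contract, ← integral_const_mul]

end Contraction

section Fermion

variable {X : Type} [MeasureSpace X] [SigmaFinite (volume : Measure X)] {n : ℕ}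

/-- Removes square integrability, since slices of a square integrable function need not all be
square integrable. If the right side is zero, plain Cauchy–Schwarz makes the pairing vanish. If it
is neither zero nor infinite, all three norms are finite. -/
theorem fermion_pairing_le' {f : X → ℂ} {g : (Fin n → X) → ℂ} {χ : (Fin (n + 1) → X) → ℂ}
    (hf : Measurable f) (hg : Measurable g) (hχ : Measurable χ)
    (ha : Antisymm g) (hχa : Antisymm χ) :
    (n + 1) * ‖∫ c, (starRingEnd ℂ) (χ c) * (f (c 0) * g (Fin.tail c))‖ₑ ^ 2 ≤
      (∫⁻ c, ‖χ c‖ₑ ^ 2) * ((∫⁻ x, ‖f x‖ₑ ^ 2) * ∫⁻ c, ‖g c‖ₑ ^ 2) := by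
  have ht := measurable_tail (X := X) (n := n)
  have hu : Measurable fun c : Fin (n + 1) → X => f (c 0) * g (Fin.tail c) := by fun_prop
  have h0 := sq_enorm_integral_conj_mul_le (μ := volume) hχ.aestronglyMeasurable
    hu.aestronglyMeasurable
  rw [sqInt_tensor hf hg] at h0
  rcases eq_or_ne ((∫⁻ c, ‖χ c‖ₑ ^ 2) * ((∫⁻ x, ‖f x‖ₑ ^ 2) * ∫⁻ c, ‖g c‖ₑ ^ 2)) 0 with hz | hz
  · rw [hz] at h0 ⊢
    rw [le_zero_iff.1 h0, mul_zero]
  rcases eq_or_ne ((∫⁻ c, ‖χ c‖ₑ ^ 2) * ((∫⁻ x, ‖f x‖ₑ ^ 2) * ∫⁻ c, ‖g c‖ₑ ^ 2)) ⊤ with ht | ht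
  · rw [ht]; exact le_top
  have hz1 := left_ne_zero_of_mul hz
  have hz2 := left_ne_zero_of_mul (right_ne_zero_of_mul hz)
  have hz3 := right_ne_zero_of_mul (right_ne_zero_of_mul hz)
  refine fermion_pairing_le hf hg ?_ ?_ ha hχa ?_
  · rw [memLp_two_iff hf.aestronglyMeasurable, lt_top_iff_ne_top]
    intro h
    simp [h, hz1, hz3, ENNReal.mul_top, ENNReal.top_mul] at ht
  · rw [memLp_two_iff hg.aestronglyMeasurable, lt_top_iff_ne_top]
    intro h
    simp [h, hz1, hz2, ENNReal.mul_top] at ht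
  · rw [memLp_two_iff hχ.aestronglyMeasurable, lt_top_iff_ne_top]
    intro h
    simp [h, hz2, hz3, ENNReal.top_mul] at ht

end Fermion

/-! ## The basic estimate -/

section Core

open ENNReal

variable {X S Z B Y W : Type} [MeasureSpace X] [MeasureSpace S] [MeasureSpace Z] [MeasureSpace B]
  [MeasureSpace Y] [MeasureSpace W]
  [SigmaFinite (volume : Measure X)] [SigmaFinite (volume : Measure S)]
  [SigmaFinite (volume : Measure Z)] [SigmaFinite (volume : Measure B)]
  [SigmaFinite (volume : Measure Y)] [SigmaFinite (volume : Measure W)]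
  {n m : ℕ} {eo : Y → S × B} {ei : Z × B → W}

/-- Separation of the first particle of the two fermion species and of the part of the third factor
singled out by `eo`. -/
def outMap (eo : Y → S × B) (c : (Fin (n + 1) → X) × (Fin (m + 1) → X) × Y) :
    (X × X × S) × ((Fin n → X) × (Fin m → X) × B) :=
  ((c.1 0, c.2.1 0, (eo c.2.2).1), (Fin.tail c.1, Fin.tail c.2.1, (eo c.2.2).2))

/-- Insertion of a variable into the third factor by `ei`. -/
def inMap (ei : Z × B → W) (q : Z × ((Fin n → X) × (Fin m → X) × B)) :
    (Fin n → X) × (Fin m → X) × W :=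
  (q.2.1, q.2.2.1, ei (q.1, q.2.2.2))

theorem measurePreserving_outMap (heo : MeasurePreserving eo volume volume) :
    MeasurePreserving (outMap (X := X) (n := n) (m := m) eo) volume volume := by
  have h1 : MeasurePreserving (fun q : (Fin (m + 1) → X) × Y =>
      ((q.1 0, (eo q.2).1), (Fin.tail q.1, (eo q.2).2))) volume volume :=
    measurePreserving_shuffle.comp (measurePreserving_split.prod heo)
  exact measurePreserving_shuffle.comp (measurePreserving_split.prod h1)

theorem measurePreserving_inMap (hei : MeasurePreserving ei volume volume) :
    MeasurePreserving (inMap (X := X) (n := n) (m := m) ei) volume volume := by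
  have h1 : MeasurePreserving (fun q : Z × ((Fin m → X) × B) => (q.2.1, ei (q.1, q.2.2)))
      volume volume :=
    ((MeasurePreserving.id _).prod hei).comp measurePreserving_leftComm
  exact ((MeasurePreserving.id (volume : Measure (Fin n → X))).prod h1).comp
    measurePreserving_leftComm

/-- The sesquilinear form of a Wick monomial: one fermion is controlled by antisymmetry, the other one
by the weights `α`, `β`. -/
theorem contract_pairing_le (heo : MeasurePreserving eo volume volume)
    (hei : MeasurePreserving ei volume volume)
    {χ : (Fin (n + 1) → X) × (Fin (m + 1) → X) × Y → ℂ}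
    {ψ : (Fin n → X) × (Fin m → X) × W → ℂ} {F Ft : X × X × S → Z → ℂ}
    (hχ : Measurable χ) (hψ : Measurable ψ)
    (hF : Measurable fun q : (X × X × S) × Z => F q.1 q.2)
    (hFt : Measurable fun q : (X × X × S) × Z => Ft q.1 q.2)
    (hχa : ∀ c y, Antisymm fun d => χ (c, d, y)) (hψa : ∀ c y, Antisymm fun d => ψ (c, d, y))
    (hF2 : ∫⁻ q : (X × X × S) × Z, ‖F q.1 q.2‖ₑ ^ 2 < ⊤) (hψ2 : ∫⁻ w, ‖ψ w‖ₑ ^ 2 < ⊤)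
    (hχ2 : ∫⁻ w, ‖χ w‖ₑ ^ 2 < ⊤)
    {κ : X → ℝ≥0∞} {α : (Fin (n + 1) → X) → ℝ≥0∞} {β : (Fin n → X) → ℝ≥0∞}
    (hα : Measurable α) (hβ : Measurable β)
    (hκ : ∀ o z, ‖F o z‖ₑ ^ 2 ≤ κ o.1 * ‖Ft o z‖ₑ ^ 2)
    (hαβ : ∀ c, κ (c 0) ≤ α c * β (Fin.tail c)) :
    (m + 1) * ‖∫ c, (starRingEnd ℂ) (χ c) * contract (outMap eo) (inMap ei) F ψ c‖ₑ ^ 2 ≤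
      (∫⁻ c, ‖χ c‖ₑ ^ 2 * α c.1) *
        ((∫⁻ q : (X × X × S) × Z, ‖Ft q.1 q.2‖ₑ ^ 2) * ∫⁻ w, ‖ψ w‖ₑ ^ 2 * β w.1) := by
  have hπ := measurePreserving_outMap (X := X) (n := n) (m := m) heo
  have hι := measurePreserving_inMap (X := X) (n := n) (m := m) hei
  have heom := heo.measurable
  have heim := hei.measurable
  have ht := measurable_tail (X := X) (n := n)
  have ht' := measurable_tail (X := X) (n := m)
  rw [integral_conj_mul_contract hπ hι hF hψ hF2 hψ2 hχ hχ2]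
  have hint := integrable_conj_mul_contract hπ hι hF hψ hF2 hψ2 hχ hχ2
  -- Makes the configuration of the second species the innermost variable, so that the fermionic
  -- estimate can be applied with everything else frozen.
  have he : MeasurePreserving (fun q : ((Fin (n + 1) → X) × (Y × Z)) × (Fin (m + 1) → X) =>
      ((q.1.1, (q.2, q.1.2.1)), q.1.2.2)) volume volume := by
    have b1 := (MeasurePreserving.id (volume : Measure (Fin (n + 1) → X))).prod
      (measurePreserving_prodAssoc_symm.comp
        (measurePreserving_swap' (A := Y × Z) (A' := Fin (m + 1) → X)))
    exact measurePreserving_prodAssoc_symm.comp (b1.comp measurePreserving_prodAssoc')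
  rw [← integral_comp_of_measurePreserving he hint.1]
  have hint' := he.integrable_comp_of_integrable hint
  simp only [Function.comp_def, outMap, inMap] at hint' ⊢
  rw [Measure.volume_eq_prod, integral_prod _ hint']
  -- squared norms in the variables of the second species
  let A : (Fin (n + 1) → X) × Y → ℝ≥0∞ := fun q => ∫⁻ d, ‖χ (q.1, d, q.2)‖ₑ ^ 2
  let Bf : (X × S) × Z → ℝ≥0∞ := fun q => ∫⁻ x, ‖F (q.1.1, x, q.1.2) q.2‖ₑ ^ 2
  let Bt : (X × S) × Z → ℝ≥0∞ := fun q => ∫⁻ x, ‖Ft (q.1.1, x, q.1.2) q.2‖ₑ ^ 2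
  let D : (Fin n → X) × W → ℝ≥0∞ := fun q => ∫⁻ d, ‖ψ (q.1, d, q.2)‖ₑ ^ 2
  have hA : Measurable A := by
    have : Measurable fun q : ((Fin (n + 1) → X) × Y) × (Fin (m + 1) → X) =>
      ‖χ (q.1.1, q.2, q.1.2)‖ₑ ^ 2 := by fun_prop
    exact this.lintegral_prod_right'
  have hBt : Measurable Bt := by
    have : Measurable fun q : ((X × S) × Z) × X => ‖Ft (q.1.1.1, q.2, q.1.1.2) q.1.2‖ₑ ^ 2 :=
      (hFt.comp (f := fun q : ((X × S) × Z) × X => ((q.1.1.1, q.2, q.1.1.2), q.1.2))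
        (by fun_prop)).enorm.pow_const 2
    exact this.lintegral_prod_right'
  have hBf : Measurable Bf := by
    have : Measurable fun q : ((X × S) × Z) × X => ‖F (q.1.1.1, q.2, q.1.1.2) q.1.2‖ₑ ^ 2 :=
      (hF.comp (f := fun q : ((X × S) × Z) × X => ((q.1.1.1, q.2, q.1.1.2), q.1.2))
        (by fun_prop)).enorm.pow_const 2
    exact this.lintegral_prod_right'
  have hD : Measurable D := by
    have : Measurable fun q : ((Fin n → X) × W) × (Fin m → X) =>
      ‖ψ (q.1.1, q.2, q.1.2)‖ₑ ^ 2 := by fun_prop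
    exact this.lintegral_prod_right'
  let Dz : (Fin n → X) × B → ℝ≥0∞ := fun q => ∫⁻ z, D (q.1, ei (z, q.2))
  have hDz : Measurable Dz := by
    have : Measurable fun q : ((Fin n → X) × B) × Z => D (q.1.1, ei (q.2, q.1.2)) := by fun_prop
    exact this.lintegral_prod_right'
  let Btz : X × S → ℝ≥0∞ := fun q => ∫⁻ z, Bt (q, z)
  have hBtz : Measurable Btz := hBt.lintegral_prod_right'
  have hm1 : (m + 1 : ℝ≥0∞) ≠ 0 := by simp
  have hm2 : (m + 1 : ℝ≥0∞) ≠ ⊤ := by finiteness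
  -- `K` is the modulus of the pairing over the second species alone. The next bounds integrate
  -- first over `z`, then over the first species and `Y`, by Cauchy–Schwarz each time and keeping
  -- the factor `m + 1`.
  let K : (Fin (n + 1) → X) × (Y × Z) → ℝ≥0∞ := fun w =>
    ‖∫ d : Fin (m + 1) → X, (starRingEnd ℂ) (χ (w.1, d, w.2.1)) *
      (F (w.1 0, d 0, (eo w.2.1).1) w.2.2 *
        ψ (Fin.tail w.1, Fin.tail d, ei (w.2.2, (eo w.2.1).2)))‖ₑ
  have hKm : Measurable K := by
    have h1 : Measurable fun q : ((Fin (n + 1) → X) × (Y × Z)) × (Fin (m + 1) → X) =>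
        F (q.1.1 0, q.2 0, (eo q.1.2.1).1) q.1.2.2 :=
      hF.comp (f := fun q : ((Fin (n + 1) → X) × (Y × Z)) × (Fin (m + 1) → X) =>
        ((q.1.1 0, q.2 0, (eo q.1.2.1).1), q.1.2.2)) (by fun_prop)
    have h2 : Measurable fun q : ((Fin (n + 1) → X) × (Y × Z)) × (Fin (m + 1) → X) =>
        (starRingEnd ℂ) (χ (q.1.1, q.2, q.1.2.1)) *
        (F (q.1.1 0, q.2 0, (eo q.1.2.1).1) q.1.2.2 *
        ψ (Fin.tail q.1.1, Fin.tail q.2, ei (q.1.2.2, (eo q.1.2.1).2))) := by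
      refine Measurable.mul (Complex.continuous_conj.measurable.comp (by fun_prop))
        (h1.mul (by fun_prop))
    exact h2.stronglyMeasurable.integral_prod_right'.measurable.enorm
  have hK : ∀ w, (m + 1) * K w ^ 2 ≤ (A (w.1, w.2.1) * Bf ((w.1 0, (eo w.2.1).1), w.2.2)) *
      D (Fin.tail w.1, ei (w.2.2, (eo w.2.1).2)) := fun w => by
    rw [mul_assoc]
    exact fermion_pairing_le' (f := fun x => F (w.1 0, x, (eo w.2.1).1) w.2.2)
      (g := fun d => ψ (Fin.tail w.1, d, ei (w.2.2, (eo w.2.1).2)))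
      (χ := fun d => χ (w.1, d, w.2.1))
      (hF.comp (f := fun x : X => ((w.1 0, x, (eo w.2.1).1), w.2.2)) (by fun_prop))
      (by fun_prop) (by fun_prop) (hψa _ _) (hχa _ _)
  have hBfBt : ∀ q z, Bf (q, z) ≤ κ q.1 * Bt (q, z) := fun q z => by
    have : Measurable fun x => ‖Ft (q.1, x, q.2) z‖ₑ ^ 2 :=
      (hFt.comp (f := fun x : X => ((q.1, x, q.2), z)) (by fun_prop)).enorm.pow_const 2
    simp only [Bf, Bt]
    rw [← lintegral_const_mul _ this]
    exact lintegral_mono fun x => hκ (q.1, x, q.2) z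
  -- Here the factor `κ` of the kernel is traded for `α β`: `α` is attached to the norm of `χ`, `β`
  -- to that of `ψ`, leaving the reduced kernel `Ft`.
  have hKz : ∀ q : (Fin (n + 1) → X) × Y, (m + 1) * (∫⁻ z, K (q.1, (q.2, z))) ^ 2 ≤
      (A q * α q.1) *
        (Btz (q.1 0, (eo q.2).1) * (β (Fin.tail q.1) * Dz (Fin.tail q.1, (eo q.2).2))) := by
    intro q
    have h1 := mul_sq_lintegral_le (μ := (volume : Measure Z)) hm1 hm2
      (f := fun z => K (q.1, (q.2, z))) (g := fun z => A q * Bf ((q.1 0, (eo q.2).1), z))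
      (h := fun z => D (Fin.tail q.1, ei (z, (eo q.2).2)))
      ((hBf.comp measurable_prodMk_left).const_mul _) (by fun_prop) fun z => hK (q.1, (q.2, z))
    refine h1.trans ?_
    have hBq : Measurable fun z => Bf ((q.1 0, (eo q.2).1), z) := by fun_prop
    have hBtq : Measurable fun z => Bt ((q.1 0, (eo q.2).1), z) := by fun_prop
    rw [lintegral_const_mul _ hBq]
    have h2 : ∫⁻ z, Bf ((q.1 0, (eo q.2).1), z) ≤
        (α q.1 * β (Fin.tail q.1)) * Btz (q.1 0, (eo q.2).1) := by
      simp only [Btz]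
      rw [← lintegral_const_mul _ hBtq]
      exact lintegral_mono fun z => (hBfBt _ z).trans (mul_le_mul_left (hαβ q.1) _)
    calc _ ≤ A q * ((α q.1 * β (Fin.tail q.1)) * Btz (q.1 0, (eo q.2).1)) *
          ∫⁻ z, D (Fin.tail q.1, ei (z, (eo q.2).2)) := by gcongr
      _ = _ := by simp only [Dz]; ring
  -- The second factor depends on the first particle through `Btz` and on the remaining ones through
  -- `β` and `Dz`, so its integral is a product: the norm of `Ft` times the weighted norm of `ψ`.
  have hfin := mul_sq_lintegral_le (μ := (volume : Measure ((Fin (n + 1) → X) × Y))) hm1 hm2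
    (f := fun q => ∫⁻ z, K (q.1, (q.2, z))) (g := fun q => A q * α q.1)
    (h := fun q => Btz (q.1 0, (eo q.2).1) *
      (β (Fin.tail q.1) * Dz (Fin.tail q.1, (eo q.2).2)))
    (by fun_prop) (by fun_prop) hKz
  have hleft : ‖∫ w : (Fin (n + 1) → X) × (Y × Z), ∫ d : Fin (m + 1) → X,
      (starRingEnd ℂ) (χ (w.1, d, w.2.1)) * (F (w.1 0, d 0, (eo w.2.1).1) w.2.2 *
        ψ (Fin.tail w.1, Fin.tail d, ei (w.2.2, (eo w.2.1).2)))‖ₑ ≤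
      ∫⁻ q : (Fin (n + 1) → X) × Y, ∫⁻ z, K (q.1, (q.2, z)) := by
    refine (enorm_integral_le_lintegral_enorm _).trans (le_of_eq ?_)
    change ∫⁻ w, K w = _
    rw [← (measurePreserving_prodAssoc' (A := Fin (n + 1) → X) (A' := Y) (Q := Z)).lintegral_comp
      hKm]
    exact lintegral_prod _ (hKm.comp (measurePreserving_prodAssoc' (A := Fin (n + 1) → X)
      (A' := Y) (Q := Z)).measurable).aemeasurable
  have hr1 : ∫⁻ q : (Fin (n + 1) → X) × Y, A q * α q.1 = ∫⁻ c, ‖χ c‖ₑ ^ 2 * α c.1 := by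
    have b : MeasurePreserving (fun q : ((Fin (n + 1) → X) × Y) × (Fin (m + 1) → X) =>
        (q.1.1, (q.2, q.1.2))) volume volume :=
      ((MeasurePreserving.id (volume : Measure (Fin (n + 1) → X))).prod
        (measurePreserving_swap' (A := Y) (A' := Fin (m + 1) → X))).comp
          measurePreserving_prodAssoc'
    rw [← b.lintegral_comp (f := fun c => ‖χ c‖ₑ ^ 2 * α c.1) (by fun_prop)]
    have hmq : Measurable fun q : ((Fin (n + 1) → X) × Y) × (Fin (m + 1) → X) =>
        ‖χ (q.1.1, (q.2, q.1.2))‖ₑ ^ 2 * α q.1.1 := by fun_prop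
    refine Eq.symm ((lintegral_prod _ hmq.aemeasurable).trans (lintegral_congr fun q => ?_))
    have hmd : Measurable fun d => ‖χ (q.1, (d, q.2))‖ₑ ^ 2 := by fun_prop
    exact lintegral_mul_const (α q.1) hmd
  have hr2 : ∫⁻ q : (Fin (n + 1) → X) × Y, Btz (q.1 0, (eo q.2).1) *
      (β (Fin.tail q.1) * Dz (Fin.tail q.1, (eo q.2).2)) =
      (∫⁻ q : (X × X × S) × Z, ‖Ft q.1 q.2‖ₑ ^ 2) * ∫⁻ w, ‖ψ w‖ₑ ^ 2 * β w.1 := by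
    have b : MeasurePreserving (fun q : (Fin (n + 1) → X) × Y =>
        ((q.1 0, (eo q.2).1), (Fin.tail q.1, (eo q.2).2))) volume volume :=
      measurePreserving_shuffle.comp (measurePreserving_split.prod heo)
    rw [b.lintegral_comp (f := fun q : (X × S) × ((Fin n → X) × B) =>
      Btz q.1 * (β q.2.1 * Dz q.2)) (by fun_prop)]
    refine (lintegral_prod_mul (f := Btz) (g := fun q => β q.1 * Dz q) hBtz.aemeasurable
      (by fun_prop)).trans ?_
    congr 1
    · have b1 : MeasurePreserving (fun q : ((X × S) × Z) × X =>
          ((q.1.1.1, (q.2, q.1.1.2)), q.1.2)) volume volume := by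
        have b2 : MeasurePreserving (fun q : ((X × S) × X) => (q.1.1, (q.2, q.1.2)))
            volume volume := ((MeasurePreserving.id (volume : Measure X)).prod
          (measurePreserving_swap' (A := S) (A' := X))).comp measurePreserving_prodAssoc'
        have b3 : MeasurePreserving (fun q : ((X × S) × Z) × X => ((q.1.1, q.2), q.1.2))
            volume volume := measurePreserving_prodAssoc_symm.comp
          (((MeasurePreserving.id (volume : Measure (X × S))).prod
            (measurePreserving_swap' (A := Z) (A' := X))).comp measurePreserving_prodAssoc')
        exact (b2.prod (.id (volume : Measure Z))).comp b3
      have hm3 : Measurable fun q : (X × X × S) × Z => ‖Ft q.1 q.2‖ₑ ^ 2 := hFt.enorm.pow_const 2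
      rw [← b1.lintegral_comp hm3]
      refine Eq.symm ((lintegral_prod _ (hm3.comp b1.measurable).aemeasurable).trans ?_)
      exact lintegral_prod _ hBt.aemeasurable
    · have b1 : MeasurePreserving (fun q : ((Fin n → X) × B) × (Z × (Fin m → X)) =>
          (q.1.1, (q.2.2, ei (q.2.1, q.1.2)))) volume volume := by
        have c1 : MeasurePreserving (fun q : B × (Z × (Fin m → X)) => (q.2.2, ei (q.2.1, q.1)))
            volume volume := by
          have c2 : MeasurePreserving (fun q : B × (Z × (Fin m → X)) => ((q.2.1, q.1), q.2.2))
              volume volume :=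
            measurePreserving_prodAssoc_symm.comp measurePreserving_leftComm
          exact measurePreserving_swap'.comp
            ((hei.prod (.id (volume : Measure (Fin m → X)))).comp c2)
        exact ((MeasurePreserving.id (volume : Measure (Fin n → X))).prod c1).comp
          measurePreserving_prodAssoc'
      rw [← b1.lintegral_comp (f := fun w => ‖ψ w‖ₑ ^ 2 * β w.1) (by fun_prop)]
      have hmq : Measurable fun q : ((Fin n → X) × B) × (Z × (Fin m → X)) =>
          ‖ψ (q.1.1, (q.2.2, ei (q.2.1, q.1.2)))‖ₑ ^ 2 * β q.1.1 := by fun_prop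
      refine Eq.symm ((lintegral_prod _ hmq.aemeasurable).trans (lintegral_congr fun q => ?_))
      refine (lintegral_prod _ (hmq.comp measurable_prodMk_left).aemeasurable).trans ?_
      simp only [Dz, D]
      rw [← lintegral_const_mul _ (by fun_prop)]
      refine lintegral_congr fun z => ?_
      rw [mul_comm]
      have hmd : Measurable fun d => ‖ψ (q.1, (d, ei (z, q.2)))‖ₑ ^ 2 := by fun_prop
      exact lintegral_mul_const (β q.1) hmd
  rw [hr1, hr2] at hfin
  exact le_trans (by gcongr) hfin

end Core

/-! ## Wave functions of definite symmetry -/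

section Sector

variable {n m l : ℕ}

/-- The wave function of a vector of the `(n, m, l)`-particle space. -/
def fn (ψ : sector n m l) : Config n m l → ℂ :=
  (ψ : Lp ℂ 2 (volume : Measure (Config n m l)))

theorem sq_enorm_sector (ψ : sector n m l) :
    ‖ψ‖ₑ ^ 2 = ∫⁻ c, ‖fn ψ c‖ₑ ^ 2 := by
  change ‖(ψ : Lp ℂ 2 (volume : Measure (Config n m l)))‖ₑ ^ 2 = _
  rw [Lp.enorm_def, eLpNorm_eq_lintegral_rpow_enorm_toReal two_ne_zero ENNReal.ofNat_ne_top,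
    ← ENNReal.rpow_natCast, ← ENNReal.rpow_mul]
  norm_num
  rfl

theorem inner_sector (χ ψ : sector n m l) : inner ℂ χ ψ =
    ∫ c, (starRingEnd ℂ) (fn χ c) * fn ψ c := by
  change inner ℂ (χ : Lp ℂ 2 (volume : Measure (Config n m l)))
    (ψ : Lp ℂ 2 (volume : Measure (Config n m l))) = _
  rw [L2.inner_def]
  refine integral_congr_ae (Filter.Eventually.of_forall fun c => ?_)
  simp [RCLike.inner_apply, mul_comm, fn]

theorem measurable_sector (ψ : sector n m l) :
    Measurable (fn ψ) :=
  (Lp.stronglyMeasurable _).measurable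

theorem fn_add (ψ φ : sector n m l) : ∀ᵐ c, fn (ψ + φ) c = fn ψ c + fn φ c := Lp.coeFn_add _ _

theorem fn_smul (z : ℂ) (ψ : sector n m l) : ∀ᵐ c, fn (z • ψ) c = z * fn ψ c := Lp.coeFn_smul _ _

theorem memLp_fn (ψ : sector n m l) : MemLp (fn ψ) 2 := Lp.memLp _

theorem sqInt_sector_lt_top (ψ : sector n m l) :
    ∫⁻ c, ‖fn ψ c‖ₑ ^ 2 < ⊤ := by
  rw [← sq_enorm_sector]
  exact ENNReal.pow_lt_top enorm_lt_top

/-- Triples of permutations of the three species. -/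
abbrev Perms (n m l : ℕ) := Equiv.Perm (Fin n) × Equiv.Perm (Fin m) × Equiv.Perm (Fin l)

/-- The sign with which a triple of permutations acts on wave functions. -/
def Perms.sign (g : Perms n m l) : ℤˣ := Equiv.Perm.sign g.1 * Equiv.Perm.sign g.2.1

/-- The action of a triple of permutations on configurations. -/
def Perms.act (g : Perms n m l) (c : Config n m l) : Config n m l := relabel g.1 g.2.1 g.2.2 c

theorem Perms.measurePreserving_act (g : Perms n m l) : MeasurePreserving g.act volume volume :=
  measurePreserving_relabel _ _ _

theorem Perms.act_act (g h : Perms n m l) (c : Config n m l) : g.act (h.act c) = (h * g).act c := by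
  rfl

theorem Perms.sign_mul (g h : Perms n m l) : (g * h).sign = g.sign * h.sign := by
  simp only [Perms.sign, Prod.fst_mul, Prod.snd_mul, Equiv.Perm.sign_mul]
  exact mul_mul_mul_comm _ _ _ _

/-- Antisymmetry in the two lepton species and symmetry in the bosons. -/
def FermiBose (Ψ : Config n m l → ℂ) : Prop :=
  ∀ (g : Perms n m l) c, Ψ (g.act c) = ((g.sign : ℤ) : ℂ) * Ψ c

theorem mem_sector_iff (ψ : Lp ℂ 2 (volume : Measure (Config n m l))) : ψ ∈ sector n m l ↔
    ∀ g : Perms n m l, ∀ᵐ c, ψ (g.act c) = ((g.sign : ℤ) : ℂ) * ψ c := by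
  refine ⟨fun h g => ?_, fun h σ τ π => ?_⟩
  · filter_upwards [h g.1 g.2.1 g.2.2] with c hc
    simp only [Perms.act, hc, Perms.sign]
    push_cast
    rfl
  · filter_upwards [h (σ, τ, π)] with c hc
    simp only [Perms.act, Perms.sign] at hc
    push_cast at hc
    exact hc

theorem fn_act (χ : sector n m l) (g : Perms n m l) :
    ∀ᵐ c, fn χ (g.act c) = ((g.sign : ℤ) : ℂ) * fn χ c :=
  (mem_sector_iff _).1 χ.2 g

/-- Signed averaging over the finite group of permutations yields a representative with the symmetry
at every point, not just almost everywhere. Slices with some variables frozen then inherit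
antisymmetry, as the fermionic estimate requires. -/
theorem exists_fermiBose (ψ : sector n m l) : ∃ Ψ : Config n m l → ℂ, Measurable Ψ ∧ FermiBose Ψ ∧
    ∀ᵐ c, fn ψ c = Ψ c := by
  set f : Config n m l → ℂ := fn ψ with hf
  refine ⟨fun c => (Fintype.card (Perms n m l) : ℂ)⁻¹ *
    ∑ g : Perms n m l, ((g.sign : ℤ) : ℂ) * f (g.act c), ?_, fun g c => ?_, ?_⟩
  · refine Measurable.const_mul (Finset.measurable_sum _ fun g _ => Measurable.const_mul ?_ _) _
    exact (measurable_sector ψ).comp g.measurePreserving_act.measurable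
  · simp only [Perms.act_act]
    rw [mul_left_comm]
    congr 1
    rw [← Equiv.sum_comp (Equiv.mulLeft g)
      (fun h : Perms n m l => ((h.sign : ℤ) : ℂ) * f (h.act c)), Finset.mul_sum]
    refine Finset.sum_congr rfl fun h _ => ?_
    simp only [Equiv.coe_mulLeft, Perms.sign_mul]
    rcases Int.units_eq_one_or g.sign with e | e <;> simp [e]
  · have h1 : ∀ᵐ c, ∀ g : Perms n m l, f (g.act c) = ((g.sign : ℤ) : ℂ) * f c :=
      ae_all_iff.2 fun g => (mem_sector_iff _).1 ψ.2 g
    filter_upwards [h1] with c hc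
    have h2 : ∀ g : Perms n m l, ((g.sign : ℤ) : ℂ) * f (g.act c) = f c := fun g => by
      rw [hc]
      rcases Int.units_eq_one_or g.sign with e | e <;> simp [e]
    simp only [h2, Finset.sum_const, Finset.card_univ, nsmul_eq_mul]
    rw [inv_mul_cancel_left₀ (Nat.cast_ne_zero.2 Fintype.card_ne_zero)]

theorem FermiBose.antisymm {Ψ : Config n m l → ℂ} (h : FermiBose Ψ) (c : Fin n → Lepton)
    (y : Fin l → Boson) : Antisymm fun d => Ψ (c, d, y) := by
  intro e d
  simpa [Perms.act, Perms.sign, relabel] using h (1, e, 1) (c, d, y)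

end Sector

/-! ## Sector operators -/

section Operator

open ENNReal

theorem norm_inner_self {E : Type*} [NormedAddCommGroup E] [InnerProductSpace ℂ E] (x : E) :
    ‖inner ℂ x x‖ = ‖x‖ ^ 2 := by
  rw [inner_self_eq_norm_sq_to_K]
  simp

/-- Meant for `x = T y`, where `I` is the pairing of `x` with the kernel applied to `y`: after
Cauchy–Schwarz, one factor `‖x‖` is divided out. -/
theorem norm_le_of_sq_eq_mul {E E' : Type*} [SeminormedAddCommGroup E] [SeminormedAddCommGroup E']
    {x : E} {y : E'} {I : ℂ} {k : ℝ} (hk : 0 ≤ k) {N : ℝ≥0∞} (hN : N ≠ ⊤)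
    (h1 : ‖x‖ ^ 2 = k * ‖I‖) (h2 : ‖I‖ₑ ^ 2 ≤ ‖x‖ₑ ^ 2 * (N * ‖y‖ₑ ^ 2)) :
    ‖x‖ ≤ k * √N.toReal * ‖y‖ := by
  have h4 : ‖I‖ ^ 2 ≤ ‖x‖ ^ 2 * (N.toReal * ‖y‖ ^ 2) := by
    have := ENNReal.toReal_mono (by finiteness) h2
    simpa using this
  have h5 : ‖I‖ ≤ ‖x‖ * (√N.toReal * ‖y‖) := by
    refine abs_le_of_sq_le_sq' (h4.trans (le_of_eq ?_)) (by positivity) |>.2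
    rw [mul_pow, mul_pow, Real.sq_sqrt ENNReal.toReal_nonneg]
  rcases eq_or_ne ‖x‖ 0 with h0 | h0
  · rw [h0]; positivity
  · refine le_of_mul_le_mul_left ?_ (lt_of_le_of_ne (norm_nonneg x) h0.symm)
    calc ‖x‖ * ‖x‖ = k * ‖I‖ := by rw [← h1, sq]
      _ ≤ k * (‖x‖ * (√N.toReal * ‖y‖)) := by gcongr
      _ = _ := by ring

variable {S Z B : Type} [MeasureSpace S] [MeasureSpace Z] [MeasureSpace B]
  [SigmaFinite (volume : Measure S)] [SigmaFinite (volume : Measure Z)]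
  [SigmaFinite (volume : Measure B)] {n m li lo : ℕ}
  {eo : (Fin lo → Boson) → S × B} {ei : Z × B → (Fin li → Boson)}
  {F : Lepton × Lepton × S → Z → ℂ} {J : Type*} [Fintype J]

/-- The signed sum over ways to distribute the created particles. -/
def spread (g : J → Perms n m li) (u : Config n m li → ℂ) (c : Config n m li) : ℂ :=
  ∑ j, (((g j).sign : ℤ) : ℂ) * u ((g j).act c)

theorem spread_congr (g : J → Perms n m li) {u v : Config n m li → ℂ} (h : ∀ᵐ c, u c = v c) :
    ∀ᵐ c, spread g u c = spread g v c := by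
  have h1 : ∀ᵐ c, ∀ j, u ((g j).act c) = v ((g j).act c) :=
    ae_all_iff.2 fun j => (g j).measurePreserving_act.quasiMeasurePreserving.ae h
  filter_upwards [h1] with c hc
  simp only [spread, hc]

theorem memLp_spread (g : J → Perms n m li) {u : Config n m li → ℂ} (h : MemLp u 2) :
    MemLp (spread g u) 2 :=
  memLp_finsetSum _ fun j _ =>
    (h.comp_measurePreserving (g j).measurePreserving_act).const_mul _

variable (heo : MeasurePreserving eo volume volume) (hei : MeasurePreserving ei volume volume)
  (hF : Measurable fun q : (Lepton × Lepton × S) × Z => F q.1 q.2)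
  (hF2 : ∫⁻ q : (Lepton × Lepton × S) × Z, ‖F q.1 q.2‖ₑ ^ 2 < ⊤)
  (g : J → Perms (n + 1) (m + 1) lo) (a : ℂ)
  (hsym : ∀ Ψ : Config n m li → ℂ, FermiBose Ψ →
    FermiBose (spread g (contract (outMap eo) (inMap ei) F Ψ)))

include heo hei hF hF2 hsym

-- The operator is the scaled signed sum of contractions. Paired with a vector `χ` of the right
-- symmetry, all terms of the sum contribute equally, so the pairing is `card J` times a single
-- contraction. Linearity and boundedness are both deduced from this formula.
set_option maxHeartbeats 1000000 in
theorem exists_sector_operator : ∃ T : sector n m li →L[ℂ] sector (n + 1) (m + 1) lo,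
    (∀ (ψ : sector n m li) (Ψ : Config n m li → ℂ),
      (∀ᵐ c, fn ψ c = Ψ c) →
      ∀ᵐ c, fn (T ψ) c =
        a * spread g (contract (outMap eo) (inMap ei) F Ψ) c) ∧
    ∀ (χ : sector (n + 1) (m + 1) lo) (ψ : sector n m li), inner ℂ χ (T ψ) =
      a * Fintype.card J * ∫ c,
        (starRingEnd ℂ) (fn χ c) *
          contract (outMap eo) (inMap ei) F
            (fn ψ) c := by
  have hπ := measurePreserving_outMap (X := Lepton) (n := n) (m := m) heo
  have hι := measurePreserving_inMap (X := Lepton) (n := n) (m := m) hei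
  obtain ⟨hat, hat_def⟩ : ∃ hat : (Config n m li → ℂ) → Config (n + 1) (m + 1) lo → ℂ,
      hat = contract (outMap eo) (inMap ei) F := ⟨_, rfl⟩
  rw [← hat_def] at hsym ⊢
  have hhat : ∀ ψ : sector n m li, MemLp (hat (fn ψ)) 2 :=
    fun ψ => hat_def ▸ memLp_contract hπ hι hF (measurable_sector ψ) hF2 (sqInt_sector_lt_top ψ)
  have hmem : ∀ ψ : sector n m li,
      MemLp (fun c => a * spread g (hat (fn ψ)) c) 2 :=
    fun ψ => (memLp_spread g (hhat ψ)).const_mul a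
  have hcongr : ∀ {Ψ Φ : Config n m li → ℂ}, (∀ᵐ c, Ψ c = Φ c) → ∀ᵐ c, hat Ψ c = hat Φ c :=
    fun h => hat_def ▸ contract_congr (F := F) hπ hι h
  let T0 : sector n m li → Lp ℂ 2 (volume : Measure (Config (n + 1) (m + 1) lo)) :=
    fun ψ => (hmem ψ).toLp
  have hT0 : ∀ (ψ : sector n m li) (Ψ : Config n m li → ℂ), (∀ᵐ c, fn ψ c = Ψ c) →
      ∀ᵐ c, (T0 ψ : Config (n + 1) (m + 1) lo → ℂ) c = a * spread g (hat Ψ) c := fun ψ Ψ h => by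
    filter_upwards [(hmem ψ).coeFn_toLp, spread_congr g (hcongr h)]
      with c h1 h2
    rw [h1]
    exact congrArg _ h2
  have hsec : ∀ ψ, T0 ψ ∈ sector (n + 1) (m + 1) lo := by
    intro ψ
    -- The symmetry hypothesis concerns pointwise symmetric functions, so `ψ` is replaced by such a
    -- representative, which changes the image only on a null set.
    obtain ⟨Ψ, -, hΨs, hΨe⟩ := exists_fermiBose ψ
    rw [mem_sector_iff]
    intro h
    have h1 := hT0 ψ Ψ hΨe
    filter_upwards [h1, h.measurePreserving_act.quasiMeasurePreserving.ae h1] with c e1 e2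
    rw [e1, e2, hsym Ψ hΨs h c, mul_left_comm]
  have hinner : ∀ (χ : sector (n + 1) (m + 1) lo) (ψ : sector n m li),
      inner ℂ χ (⟨T0 ψ, hsec ψ⟩ : sector (n + 1) (m + 1) lo) = a * Fintype.card J * ∫ c,
        (starRingEnd ℂ) (fn χ c) *
          hat (fn ψ) c := by
    intro χ ψ
    rw [inner_sector, mul_assoc, ← integral_conj_mul_sum (fun j => (g j).measurePreserving_act)
      (fun j => fn_act χ (g j)) (memLp_fn _) (hhat ψ), ← integral_const_mul]
    refine integral_congr_ae ?_
    filter_upwards [hT0 ψ _ (Filter.Eventually.of_forall fun c => rfl)] with c hc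
    change _ * (T0 ψ : Config (n + 1) (m + 1) lo → ℂ) c = _
    rw [hc, mul_left_comm]
    rfl
  have hadd : ∀ ψ φ : sector n m li, ∀ᵐ c,
      hat (fn (ψ + φ)) c =
      hat (fn ψ) c +
        hat (fn φ) c := fun ψ φ => by
    filter_upwards [hcongr (fn_add ψ φ),
      ae_integrable_contract hπ hι hF (measurable_sector ψ) hF2 (sqInt_sector_lt_top ψ),
      ae_integrable_contract hπ hι hF (measurable_sector φ) hF2 (sqInt_sector_lt_top φ)]
      with c h1 h2 h3
    refine h1.trans ?_
    simp only [hat_def, contract]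
    rw [← integral_add h2 h3]
    simp only [mul_add]
  have hsmul : ∀ (z : ℂ) (ψ : sector n m li), ∀ᵐ c,
      hat (fn (z • ψ)) c =
      z * hat (fn ψ) c := fun z ψ => by
    filter_upwards [hcongr (fn_smul z ψ)] with c h1
    refine h1.trans ?_
    simp only [hat_def, contract]
    rw [← integral_const_mul]
    simp only [mul_left_comm]
  obtain ⟨T1, hT1⟩ : ∃ T1 : sector n m li →ₗ[ℂ] sector (n + 1) (m + 1) lo,
      ∀ ψ, T1 ψ = ⟨T0 ψ, hsec ψ⟩ := ⟨
    { toFun := fun ψ => ⟨T0 ψ, hsec ψ⟩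
      map_add' := fun ψ φ => by
        refine ext_inner_left ℂ fun χ => ?_
        rw [inner_add_right, hinner, hinner, hinner, ← mul_add, ← integral_add
          (integrable_conj_mul (memLp_fn _) (hhat ψ)) (integrable_conj_mul (memLp_fn _) (hhat φ))]
        congr 1
        refine integral_congr_ae ?_
        filter_upwards [hadd ψ φ] with c hc
        simp only [hc, mul_add]
      map_smul' := fun z ψ => by
        refine ext_inner_left ℂ fun χ => ?_
        rw [RingHom.id_apply, inner_smul_right, hinner, hinner, mul_left_comm,
          ← integral_const_mul z]
        congr 1
        refine integral_congr_ae ?_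
        filter_upwards [hsmul z ψ] with c hc
        simp only [hc, mul_left_comm] }, fun _ => rfl⟩
  have hbound : ∀ ψ, ‖T1 ψ‖ ≤ (‖a‖ * Fintype.card J *
      √(∫⁻ q : (Lepton × Lepton × S) × Z, ‖F q.1 q.2‖ₑ ^ 2).toReal) * ‖ψ‖ := by
    intro ψ
    have h1 := hinner (T1 ψ) ψ
    rw [← hT1] at h1
    have h2 := sq_enorm_integral_conj_mul_le (μ := volume)
      (measurable_sector (T1 ψ)).aestronglyMeasurable (hhat ψ).1
    rw [← sq_enorm_sector] at h2
    have h3 := h2.trans (mul_le_mul_right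
      (hat_def ▸ sq_enorm_contract_le hπ hι hF (measurable_sector ψ)) _)
    rw [← sq_enorm_sector] at h3
    set I := ∫ c, (starRingEnd ℂ)
      (fn (T1 ψ) c) *
          hat (fn ψ) c with hI
    have h6 : ‖T1 ψ‖ ^ 2 = ‖a‖ * Fintype.card J * ‖I‖ := by
      have h7 := congrArg norm h1
      rw [norm_inner_self] at h7
      simpa using h7
    exact norm_le_of_sq_eq_mul (by positivity) hF2.ne h6 h3
  refine ⟨T1.mkContinuous _ hbound, fun ψ Ψ h => ?_, fun χ ψ => ?_⟩
  · rw [LinearMap.mkContinuous_apply, hT1]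
    exact hT0 ψ Ψ h
  · rw [LinearMap.mkContinuous_apply, hT1, hinner]

end Operator

/-! ## Bounds on sector operators -/

section Bounds

open ENNReal

theorem enorm_inner_self {E : Type*} [NormedAddCommGroup E] [InnerProductSpace ℂ E] (x : E) :
    ‖inner ℂ x x‖ₑ = ‖x‖ₑ ^ 2 := by
  rw [← ofReal_norm, norm_inner_self, ENNReal.ofReal_pow (norm_nonneg _), ofReal_norm]

theorem enorm_inner_apply_adjoint {E E' : Type*} [NormedAddCommGroup E] [InnerProductSpace ℂ E]
    [CompleteSpace E] [NormedAddCommGroup E'] [InnerProductSpace ℂ E'] [CompleteSpace E']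
    (T : E →L[ℂ] E') (x : E') : ‖inner ℂ x (T (T.adjoint x))‖ₑ = ‖T.adjoint x‖ₑ ^ 2 := by
  rw [← ContinuousLinearMap.adjoint_inner_left, enorm_inner_self]

/-- The total momentum of a configuration of leptons. -/
def leptonEnergy {n : ℕ} (c : Fin n → Lepton) : ℝ≥0∞ := ∑ i, ((c i).1 : ℝ≥0∞)

theorem measurable_leptonEnergy {n : ℕ} : Measurable (leptonEnergy (n := n)) := by
  unfold leptonEnergy
  fun_prop

theorem leptonEnergy_comp {n : ℕ} (c : Fin n → Lepton) (σ : Equiv.Perm (Fin n)) :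
    leptonEnergy (c ∘ σ) = leptonEnergy c :=
  Equiv.sum_comp σ fun i => ((c i).1 : ℝ≥0∞)

theorem leptonEnergy_succ {n : ℕ} (c : Fin (n + 1) → Lepton) :
    leptonEnergy c = (c 0).1 + leptonEnergy (Fin.tail c) :=
  Fin.sum_univ_succ _

/-- `|Ψ|²` is symmetric in the neutrinos, so each of them contributes to the momentum integral as
much as the first. This converts the factor `n + 1` into the total neutrino momentum, without a
bound on the number of massless particles. -/
theorem lintegral_front {n m l : ℕ} {Ψ : Config (n + 1) m l → ℂ} (hΨ : Measurable Ψ)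
    (hs : FermiBose Ψ) {W : (Fin (n + 1) → Lepton) → ℝ≥0∞} (hW : Measurable W)
    (hWs : ∀ (σ : Equiv.Perm (Fin (n + 1))) c, W (c ∘ σ) = W c) :
    (n + 1) * ∫⁻ c, ‖Ψ c‖ₑ ^ 2 * ((c.1 0).1 * W c.1) =
      ∫⁻ c, ‖Ψ c‖ₑ ^ 2 * (leptonEnergy c.1 * W c.1) := by
  have h1 : ∀ i : Fin (n + 1), ∫⁻ c : Config (n + 1) m l, ‖Ψ c‖ₑ ^ 2 * ((c.1 i).1 * W c.1) =
      ∫⁻ c : Config (n + 1) m l, ‖Ψ c‖ₑ ^ 2 * ((c.1 0).1 * W c.1) := by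
    intro i
    let g : Perms (n + 1) m l := (front i, 1, 1)
    rw [← g.measurePreserving_act.lintegral_comp
      (f := fun c : Config (n + 1) m l => ‖Ψ c‖ₑ ^ 2 * ((c.1 0).1 * W c.1)) (by fun_prop)]
    refine lintegral_congr fun c => ?_
    have e1 : ‖Ψ (g.act c)‖ₑ = ‖Ψ c‖ₑ := by
      rw [hs]
      rcases Int.units_eq_one_or g.sign with e | e <;> simp [e]
    have e2 : (g.act c).1 = c.1 ∘ front i := rfl
    rw [e1, e2, hWs]
    simp
  calc _ = ∑ i : Fin (n + 1), ∫⁻ c : Config (n + 1) m l, ‖Ψ c‖ₑ ^ 2 * ((c.1 i).1 * W c.1) := by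
        simp only [h1]
        simp
    _ = _ := by
        rw [← lintegral_finsetSum _ (fun i _ => by fun_prop)]
        refine lintegral_congr fun c => ?_
        rw [leptonEnergy, Finset.sum_mul, Finset.mul_sum]

/-- Follows from `1 + p + E ≤ (1 + p)(1 + E)`. Here `p` is the momentum of the created neutrino and
`E` that of the others; the right side splits into a weight for the output and a weight for the
input. -/
theorem weight_le (p E : ℝ≥0∞) (hp : p ≠ ⊤) (hE : E ≠ ⊤) :
    p * (1 + p)⁻¹ ≤ p * (1 + (p + E))⁻¹ * (1 + E) := by
  rw [mul_assoc]
  gcongr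
  have h1 : 1 + (p + E) ≤ (1 + p) * (1 + E) := by
    calc 1 + (p + E) ≤ 1 + (p + E) + p * E := le_self_add
      _ = _ := by ring
  have h2 : ((1 + p) * (1 + E))⁻¹ ≤ (1 + (p + E))⁻¹ := ENNReal.inv_le_inv.2 h1
  have h3 : (1 + p)⁻¹ = ((1 + p) * (1 + E))⁻¹ * (1 + E) := by
    rw [ENNReal.mul_inv (Or.inl (by simp)) (Or.inl (by finiteness)), mul_assoc,
      ENNReal.inv_mul_cancel (by simp) (by finiteness), mul_one]
  rw [h3]
  gcongr

variable {S Z B : Type} [MeasureSpace S] [MeasureSpace Z] [MeasureSpace B]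
  [SigmaFinite (volume : Measure S)] [SigmaFinite (volume : Measure Z)]
  [SigmaFinite (volume : Measure B)] {n m li lo : ℕ}
  {eo : (Fin lo → Boson) → S × B} {ei : Z × B → (Fin li → Boson)}
  {F Ft : Lepton × Lepton × S → Z → ℂ}

variable (heo : MeasurePreserving eo volume volume) (hei : MeasurePreserving ei volume volume)
  (hF : Measurable fun q : (Lepton × Lepton × S) × Z => F q.1 q.2)
  (hFt : Measurable fun q : (Lepton × Lepton × S) × Z => Ft q.1 q.2)
  (hF2 : ∫⁻ q : (Lepton × Lepton × S) × Z, ‖F q.1 q.2‖ₑ ^ 2 < ⊤)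
  (hκ : ∀ o z, ‖F o z‖ₑ ^ 2 ≤ ((o.1.1 : ℝ≥0∞) * (1 + (o.1.1 : ℝ≥0∞))⁻¹) * ‖Ft o z‖ₑ ^ 2)
  {T : sector n m li →L[ℂ] sector (n + 1) (m + 1) lo} {b : ℂ} {N : ℕ}
  (hb : ‖b‖ₑ ^ 2 = (n + 1) * (m + 1) * (N + 1))
  (hT : ∀ χ ψ, inner ℂ χ (T ψ) = b * ∫ c, (starRingEnd ℂ) (fn χ c) *
    contract (outMap eo) (inMap ei) F (fn ψ) c)

include heo hei hF hFt hF2 hκ hb hT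

/-- Of the three factors in `‖b‖²`, `m + 1` is cancelled by `contract_pairing_le`, `n + 1` is
absorbed by `lintegral_front`, and `N + 1` survives. The symmetric weight `W` distributes the lepton
energy between `χ` and `ψ`. -/
theorem sq_enorm_inner_le {W : (Fin (n + 1) → Lepton) → ℝ≥0∞} (hW : Measurable W)
    (hWs : ∀ (σ : Equiv.Perm (Fin (n + 1))) c, W (c ∘ σ) = W c)
    {β : (Fin n → Lepton) → ℝ≥0∞} (hβ : Measurable β)
    (hWβ : ∀ c : Fin (n + 1) → Lepton,
      ((c 0).1 : ℝ≥0∞) * (1 + ((c 0).1 : ℝ≥0∞))⁻¹ ≤ ((c 0).1 * W c) * β (Fin.tail c))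
    (χ : sector (n + 1) (m + 1) lo) (ψ : sector n m li) :
    ‖inner ℂ χ (T ψ)‖ₑ ^ 2 ≤ (N + 1) * ((∫⁻ c, ‖fn χ c‖ₑ ^ 2 * (leptonEnergy c.1 * W c.1)) *
      ((∫⁻ q : (Lepton × Lepton × S) × Z, ‖Ft q.1 q.2‖ₑ ^ 2) *
        ∫⁻ c, ‖fn ψ c‖ₑ ^ 2 * β c.1)) := by
  obtain ⟨χ', hχm, hχs, hχe⟩ := exists_fermiBose χ
  obtain ⟨ψ', hψm, hψs, hψe⟩ := exists_fermiBose ψ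
  have hπ := measurePreserving_outMap (X := Lepton) (n := n) (m := m) heo
  have hι := measurePreserving_inMap (X := Lepton) (n := n) (m := m) hei
  have e1 : ∫ c, (starRingEnd ℂ) (fn χ c) * contract (outMap eo) (inMap ei) F (fn ψ) c =
      ∫ c, (starRingEnd ℂ) (χ' c) * contract (outMap eo) (inMap ei) F ψ' c := by
    refine integral_congr_ae ?_
    filter_upwards [hχe, contract_congr (F := F) hπ hι hψe] with c h1 h2
    rw [h1, h2]
  have e2 : ∫⁻ c, ‖fn χ c‖ₑ ^ 2 * (leptonEnergy c.1 * W c.1) =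
      ∫⁻ c, ‖χ' c‖ₑ ^ 2 * (leptonEnergy c.1 * W c.1) :=
    lintegral_congr_ae (hχe.mono fun c h => by simp only [h])
  have e3 : ∫⁻ c, ‖fn ψ c‖ₑ ^ 2 * β c.1 = ∫⁻ c, ‖ψ' c‖ₑ ^ 2 * β c.1 :=
    lintegral_congr_ae (hψe.mono fun c h => by simp only [h])
  have hψ2 : ∫⁻ c, ‖ψ' c‖ₑ ^ 2 < ⊤ := by
    rw [← lintegral_congr_ae (hψe.mono fun c h => congrArg (fun z : ℂ => ‖z‖ₑ ^ 2) h)]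
    exact sqInt_sector_lt_top ψ
  have hχ2 : ∫⁻ c, ‖χ' c‖ₑ ^ 2 < ⊤ := by
    rw [← lintegral_congr_ae (hχe.mono fun c h => congrArg (fun z : ℂ => ‖z‖ₑ ^ 2) h)]
    exact sqInt_sector_lt_top χ
  have key := contract_pairing_le heo hei hχm hψm hF hFt hχs.antisymm hψs.antisymm hF2 hψ2 hχ2
    (κ := fun x => (x.1 : ℝ≥0∞) * (1 + (x.1 : ℝ≥0∞))⁻¹) (α := fun c => (c 0).1 * W c)
    (by fun_prop) hβ hκ hWβ
  rw [hT, e1, e2, e3, enorm_mul, mul_pow, hb, ← lintegral_front hχm hχs hW hWs]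
  calc _ = (N + 1) * (n + 1) * ((m + 1) *
        ‖∫ c, (starRingEnd ℂ) (χ' c) * contract (outMap eo) (inMap ei) F ψ' c‖ₑ ^ 2) := by ring
    _ ≤ _ := mul_le_mul_right key _
    _ = _ := by ring

/-- Pair with `χ = T ψ` and take `W = (1 + E)⁻¹`, `β = 1 + E`: the weight on `χ` becomes `E / (1 +
E) ≤ 1`, so the whole energy falls on `ψ`, and one factor `‖T ψ‖²` cancels. -/
theorem sq_enorm_apply_le (ψ : sector n m li) : ‖T ψ‖ₑ ^ 2 ≤
    (∫⁻ q : (Lepton × Lepton × S) × Z, ‖Ft q.1 q.2‖ₑ ^ 2) *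
      ∫⁻ c, ‖fn ψ c‖ₑ ^ 2 * ((N + 1) * (1 + leptonEnergy c.1)) := by
  have hE := measurable_leptonEnergy (n := n + 1)
  have hE' := measurable_leptonEnergy (n := n)
  have hfin : ∀ {k : ℕ} (c : Fin k → Lepton), leptonEnergy c ≠ ⊤ := fun c => by
    simp [leptonEnergy, ENNReal.sum_eq_top]
  have h1 := sq_enorm_inner_le heo hei hF hFt hF2 hκ hb hT
    (W := fun c => (1 + leptonEnergy c)⁻¹) (by fun_prop)
    (fun σ c => by rw [leptonEnergy_comp]) (β := fun c => 1 + leptonEnergy c) (by fun_prop)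
    (fun c => by
      rw [leptonEnergy_succ]
      exact weight_le _ _ ENNReal.coe_ne_top (hfin _)) (T ψ) ψ
  have h2 : ∫⁻ c, ‖fn (T ψ) c‖ₑ ^ 2 * (leptonEnergy c.1 * (1 + leptonEnergy c.1)⁻¹) ≤
      ‖T ψ‖ₑ ^ 2 := by
    rw [sq_enorm_sector]
    refine lintegral_mono fun c => ?_
    refine mul_le_of_le_one_right zero_le ?_
    calc _ ≤ (1 + leptonEnergy c.1) * (1 + leptonEnergy c.1)⁻¹ := by gcongr; exact le_add_self
      _ ≤ 1 := ENNReal.mul_inv_le_one _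
  have h3 : ‖inner ℂ (T ψ) (T ψ)‖ₑ = ‖T ψ‖ₑ ^ 2 := by
    exact enorm_inner_self (T ψ)
  rw [h3] at h1
  have h4 : ∫⁻ c, ‖fn ψ c‖ₑ ^ 2 * ((N + 1) * (1 + leptonEnergy c.1)) =
      (N + 1) * ∫⁻ c, ‖fn ψ c‖ₑ ^ 2 * (1 + leptonEnergy c.1) := by
    have := measurable_sector ψ
    rw [← lintegral_const_mul _ (by fun_prop)]
    refine lintegral_congr fun c => by ring
  rw [h4]
  have h5 := h1.trans (mul_le_mul_right (mul_le_mul_left h2 _) _)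
  rcases eq_or_ne (‖T ψ‖ₑ ^ 2) 0 with h0 | h0
  · rw [h0]; exact zero_le
  · refine (ENNReal.mul_le_mul_iff_right h0 (by finiteness)).1 ?_
    calc _ = (‖T ψ‖ₑ ^ 2) ^ 2 := by ring
      _ ≤ _ := h5
      _ = _ := by ring

/-- The opposite choice `W = β = 1` puts the whole lepton energy on `χ`. With `y = T* χ` this is the
bound for the adjoint. -/
theorem sq_enorm_le_of_inner (χ : sector (n + 1) (m + 1) lo) (y : sector n m li)
    (h3 : ‖inner ℂ χ (T y)‖ₑ = ‖y‖ₑ ^ 2) : ‖y‖ₑ ^ 2 ≤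
    (∫⁻ q : (Lepton × Lepton × S) × Z, ‖Ft q.1 q.2‖ₑ ^ 2) *
      ∫⁻ c, ‖fn χ c‖ₑ ^ 2 * ((N + 1) * (1 + leptonEnergy c.1)) := by
  have hE := measurable_leptonEnergy (n := n + 1)
  have h1 := sq_enorm_inner_le heo hei hF hFt hF2 hκ hb hT
    (W := fun c => 1) (by fun_prop) (fun σ c => rfl) (β := fun c => 1) (by fun_prop)
    (fun c => by
      rw [mul_one, mul_one]
      exact mul_le_of_le_one_right zero_le (by simp)) χ y
  simp only [mul_one, ← sq_enorm_sector] at h1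
  rw [h3] at h1
  have h4 : (N + 1) * ∫⁻ c, ‖fn χ c‖ₑ ^ 2 * leptonEnergy c.1 ≤
      ∫⁻ c, ‖fn χ c‖ₑ ^ 2 * ((N + 1) * (1 + leptonEnergy c.1)) := by
    have := measurable_sector χ
    rw [← lintegral_const_mul _ (by fun_prop)]
    refine lintegral_mono fun c => ?_
    calc _ = ‖fn χ c‖ₑ ^ 2 * ((N + 1) * leptonEnergy c.1) := by ring
      _ ≤ _ := by gcongr; exact le_add_self
  rcases eq_or_ne (‖y‖ₑ ^ 2) 0 with h0 | h0
  · rw [h0]; exact zero_le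
  · refine (ENNReal.mul_le_mul_iff_right h0 (by finiteness)).1 ?_
    calc _ = (‖y‖ₑ ^ 2) ^ 2 := by ring
      _ ≤ _ := h1
      _ = ‖y‖ₑ ^ 2 * ((∫⁻ q : (Lepton × Lepton × S) × Z, ‖Ft q.1 q.2‖ₑ ^ 2) *
        ((N + 1) * ∫⁻ c, ‖fn χ c‖ₑ ^ 2 * leptonEnergy c.1)) := by ring
      _ ≤ _ := by gcongr

theorem sq_enorm_adjoint_apply_le (χ : sector (n + 1) (m + 1) lo) : ‖T.adjoint χ‖ₑ ^ 2 ≤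
    (∫⁻ q : (Lepton × Lepton × S) × Z, ‖Ft q.1 q.2‖ₑ ^ 2) *
      ∫⁻ c, ‖fn χ c‖ₑ ^ 2 * ((N + 1) * (1 + leptonEnergy c.1)) :=
  sq_enorm_le_of_inner heo hei hF hFt hF2 hκ hb hT χ _ (enorm_inner_apply_adjoint T χ)

end Bounds

/-! ## The two Wick monomials as block operators -/

section Spread

/-- The argument of `alt_comp_perm` for several species: the `g j` play the role of coset
representatives modulo `K`, on which `u` already has the right symmetry, and `hg` says that left
translation permutes them up to `K`. -/
theorem fermiBose_spread {n m l : ℕ} {J : Type*} [Fintype J] (g : J → Perms n m l)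
    (K : Perms n m l → Prop) {u : Config n m l → ℂ}
    (hu : ∀ k, K k → ∀ c, u (k.act c) = ((k.sign : ℤ) : ℂ) * u c)
    (hg : ∀ h : Perms n m l, ∃ e : J ≃ J, ∀ j, K ((g (e j))⁻¹ * h * g j)) :
    FermiBose (spread g u) := by
  intro h c
  obtain ⟨e, he⟩ := hg h
  unfold spread
  rw [← Equiv.sum_comp e (fun j => (((g j).sign : ℤ) : ℂ) * u ((g j).act c)), Finset.mul_sum]
  refine Finset.sum_congr rfl fun j _ => ?_
  have h1 : h * g j = g (e j) * ((g (e j))⁻¹ * h * g j) := by group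
  have h2 : h.sign * (g j).sign = (g (e j)).sign * ((g (e j))⁻¹ * h * g j).sign := by
    rw [← Perms.sign_mul, ← Perms.sign_mul, ← h1]
  rw [Perms.act_act, h1, ← Perms.act_act, hu _ (he j)]
  have h3 : ((h.sign : ℤ) : ℂ) * (((g j).sign : ℤ) : ℂ) =
      (((g (e j)).sign : ℤ) : ℂ) * ((((g (e j))⁻¹ * h * g j).sign : ℤ) : ℂ) := by
    have := congrArg (fun x : ℤˣ => ((x : ℤ) : ℂ)) h2
    push_cast at this
    exact this
  have hsq : ∀ x : ℤˣ, ((x : ℤ) : ℂ) ^ 2 = 1 := fun x => by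
    rcases Int.units_eq_one_or x with e | e <;> simp [e]
  generalize ((g (e j))⁻¹ * h * g j).sign = x at *
  linear_combination ((h.sign : ℤ) : ℂ) * ((x : ℤ) : ℂ) * u ((g (e j)).act c) * h3
    - hsq h.sign * (((g j).sign : ℤ) : ℂ) * ((x : ℤ) : ℂ) * u ((g (e j)).act c)
    + hsq x * ((h.sign : ℤ) : ℂ) * (((g (e j)).sign : ℤ) : ℂ) * u ((g (e j)).act c)

theorem front_inv_mul_apply_zero {n : ℕ} (σ : Equiv.Perm (Fin (n + 1))) (i : Fin (n + 1)) :
    ((front (σ i))⁻¹ * σ * front i) 0 = 0 := by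
  rw [Equiv.Perm.mul_apply, Equiv.Perm.mul_apply, Equiv.Perm.inv_eq_iff_eq]
  simp

end Spread

/-! ### The one-point space, in place of an absent boson variable -/

instance : IsProbabilityMeasure (volume : Measure Unit) :=
  inferInstanceAs (IsProbabilityMeasure (Measure.dirac PUnit.unit))

theorem measurePreserving_unit_mk {Y : Type*} [MeasureSpace Y]
    [SigmaFinite (volume : Measure Y)] :
    MeasurePreserving (fun y : Y => ((), y)) volume volume := by
  refine ⟨measurable_prodMk_left, ?_⟩
  have h : (volume : Measure Unit) = Measure.dirac PUnit.unit := rfl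
  rw [Measure.volume_eq_prod, h, Measure.dirac_prod]

theorem measurePreserving_unit_snd {Y : Type*} [MeasureSpace Y]
    [SigmaFinite (volume : Measure Y)] :
    MeasurePreserving (fun q : Unit × Y => q.2) volume volume :=
  measurePreserving_snd

theorem measurePreserving_unit_fst {Y : Type*} [MeasureSpace Y]
    [SigmaFinite (volume : Measure Y)] :
    MeasurePreserving (fun q : Y × Unit => q.1) volume volume :=
  measurePreserving_fst

/-- Square integrable kernels with some decay at small momentum of the first particle. -/
structure RegularKernel (F Ft : Lepton → Lepton → Boson → ℂ) : Prop where
  measurable : Measurable fun q : Lepton × Lepton × Boson => F q.1 q.2.1 q.2.2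
  measurable' : Measurable fun q : Lepton × Lepton × Boson => Ft q.1 q.2.1 q.2.2
  le : ∀ ξ₁ ξ₂ ξ₃, ‖F ξ₁ ξ₂ ξ₃‖ₑ ^ 2 ≤
    ((ξ₁.1 : ENNReal) * (1 + (ξ₁.1 : ENNReal))⁻¹) * ‖Ft ξ₁ ξ₂ ξ₃‖ₑ ^ 2
  lt_top : ∫⁻ q : Lepton × Lepton × Boson, ‖Ft q.1 q.2.1 q.2.2‖ₑ ^ 2 < ⊤

theorem RegularKernel.sqInt_lt_top {F Ft : Lepton → Lepton → Boson → ℂ} (h : RegularKernel F Ft) :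
    ∫⁻ q : Lepton × Lepton × Boson, ‖F q.1 q.2.1 q.2.2‖ₑ ^ 2 < ⊤ := by
  refine lt_of_le_of_lt (lintegral_mono fun q => (h.le q.1 q.2.1 q.2.2).trans ?_) h.lt_top
  refine mul_le_of_le_one_left zero_le ?_
  calc _ ≤ (1 + (q.1.1 : ENNReal)) * (1 + (q.1.1 : ENNReal))⁻¹ := by gcongr; exact le_add_self
    _ ≤ 1 := ENNReal.mul_inv_le_one _

variable {n m l : ℕ}

/-! ### One boson absorbed -/

section Absorb

/-- No boson is created. -/
def absorbOut (y : Fin l → Boson) : Unit × (Fin l → Boson) := ((), y)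

/-- The boson to be absorbed comes first. -/
def absorbIn (q : Boson × (Fin l → Boson)) : Fin (l + 1) → Boson := Fin.cons q.1 q.2

/-- The kernel, in the variables of `absorbOut` and `absorbIn`. -/
def absorbKernel (F : Lepton → Lepton → Boson → ℂ) (o : Lepton × Lepton × Unit) (z : Boson) : ℂ :=
  F o.1 o.2.1 z

/-- Bringing one particle of each lepton species to the front. -/
def absorbPerms (j : Fin (n + 1) × Fin (m + 1)) : Perms (n + 1) (m + 1) l :=
  (front j.1, front j.2, 1)

theorem measurePreserving_absorbOut :
    MeasurePreserving (absorbOut (l := l)) volume volume := measurePreserving_unit_mk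

theorem measurePreserving_absorbIn :
    MeasurePreserving (absorbIn (l := l)) volume volume := measurePreserving_cons'

theorem measurePreserving_absorbKernel :
    MeasurePreserving (fun q : (Lepton × Lepton × Unit) × Boson => (q.1.1, q.1.2.1, q.2))
      volume volume := by
  have h1 : MeasurePreserving (fun q : (Lepton × Unit) × Boson => (q.1.1, q.2)) volume volume :=
    measurePreserving_unit_fst.prod (.id _)
  exact ((MeasurePreserving.id (volume : Measure Lepton)).prod h1).comp measurePreserving_prodAssoc'

theorem fermiBose_absorb (F : Lepton → Lepton → Boson → ℂ) (Ψ : Config n m (l + 1) → ℂ)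
    (hΨ : FermiBose Ψ) : FermiBose (spread (absorbPerms (l := l))
      (contract (outMap absorbOut) (inMap absorbIn) (absorbKernel F) Ψ)) := by
  -- Only the two created leptons are distinguished. The bosons of the output are all spectators, so
  -- their permutations are unrestricted.
  refine fermiBose_spread _ (fun k => k.1 0 = 0 ∧ k.2.1 0 = 0) (fun k hk c => ?_) fun h =>
    ⟨Equiv.prodCongr h.1 h.2.1, fun j =>
      ⟨front_inv_mul_apply_zero h.1 j.1, front_inv_mul_apply_zero h.2.1 j.2⟩⟩
  obtain ⟨e1, h1, s1⟩ := exists_perm_of_fix_zero k.1 hk.1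
  obtain ⟨e2, h2, s2⟩ := exists_perm_of_fix_zero k.2.1 hk.2
  simp only [contract, outMap, inMap, absorbOut, absorbIn, absorbKernel, Perms.act, relabel]
  rw [← integral_const_mul]
  refine integral_congr_ae (Filter.Eventually.of_forall fun z => ?_)
  -- A permutation of the outgoing bosons is extended to the incoming ones by fixing the absorbed
  -- boson, which sits at position `0`.
  have h3 : (Fin.cons z (c.2.2 ∘ k.2.2) : Fin (l + 1) → Boson) =
      (Fin.cons z c.2.2 : Fin (l + 1) → Boson) ∘ Equiv.Perm.decomposeFin.symm (0, k.2.2) := by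
    funext i
    refine Fin.cases ?_ (fun i => ?_) i <;> simp
  have h4 := hΨ (e1, e2, Equiv.Perm.decomposeFin.symm (0, k.2.2))
    (Fin.tail c.1, Fin.tail c.2.1, Fin.cons z c.2.2)
  simp only [Perms.act, relabel, Perms.sign] at h4 ⊢
  rw [tail_comp_of_fix_zero h1, tail_comp_of_fix_zero h2, h3, h4, s1, s2, Function.comp_apply,
    Function.comp_apply, hk.1, hk.2]
  ring

/-- The normalization of the first Wick monomial between fixed particle numbers. -/
def absorbConst (n m l : ℕ) : ℂ :=
  (√((n : ℝ) + 1) : ℂ)⁻¹ * ((-1) ^ n * (√((m : ℝ) + 1) : ℂ)⁻¹) * (√((l : ℝ) + 1) : ℂ)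

/-- The signs `(-1)^i` in the creation operators are those of the cycles `front i`, and removing the
`i`-th particle is bringing it to the front and taking the tail. -/
theorem wick1_eq_spread (F : Lepton → Lepton → Boson → ℂ) (Ψ : Waves)
    (c : Config (n + 1) (m + 1) l) : wick1 F Ψ (n + 1) (m + 1) l c = absorbConst n m l *
      spread absorbPerms
        (contract (outMap absorbOut) (inMap absorbIn) (absorbKernel F) (Ψ n m (l + 1))) c := by
  simp only [wick1, creP, creM, annZ, absorbConst, spread, contract, outMap, inMap, absorbOut,
    absorbIn, absorbKernel, absorbPerms, Perms.act, Perms.sign, relabel, tail_comp_front,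
    sign_front, Fintype.sum_prod_type, Function.comp_apply, front_apply_zero, Equiv.Perm.coe_one,
    Function.comp_id]
  simp only [mul_left_comm _ (√((l : ℝ) + 1) : ℂ), integral_const_mul, Finset.mul_sum]
  refine Finset.sum_congr rfl fun i _ => Finset.sum_congr rfl fun j _ => ?_
  push_cast
  ring

theorem ae_absorbPerms {P : Config (n + 1) (m + 1) l → Prop} (h : ∀ᵐ c, P c) :
    ∀ᵐ c : Config (n + 1) (m + 1) l, ∀ i i', P ((absorbPerms (i, i')).act c) :=
  ae_all_iff.2 fun i => ae_all_iff.2 fun i' =>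
    (absorbPerms (i, i')).measurePreserving_act.quasiMeasurePreserving.ae h

/-- The `(n+1)(m+1)` equal terms, normalized by `(n+1)^(-1/2) (m+1)^(-1/2) (l+1)^(1/2)`, give
`√((n+1)(m+1)(l+1))`. -/
theorem sq_enorm_absorbConst (n m l : ℕ) :
    ‖absorbConst n m l * (Fintype.card (Fin (n + 1) × Fin (m + 1)) : ℕ)‖ₑ ^ 2 =
      ((n : ENNReal) + 1) * (m + 1) * (l + 1) := by
  have h : ‖absorbConst n m l * (Fintype.card (Fin (n + 1) × Fin (m + 1)) : ℕ)‖ ^ 2 =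
      ((n : ℝ) + 1) * (m + 1) * (l + 1) := by
    have h1 : (0 : ℝ) < n + 1 := by positivity
    have h2 : (0 : ℝ) < m + 1 := by positivity
    have h3 : (0 : ℝ) < l + 1 := by positivity
    simp only [absorbConst, norm_mul, norm_inv, norm_pow, norm_neg, norm_one, one_pow, one_mul,
      Complex.norm_real, Fintype.card_prod, Fintype.card_fin, Complex.norm_natCast,
      Real.norm_of_nonneg (Real.sqrt_nonneg _), mul_pow, inv_pow, Real.sq_sqrt h1.le,
      Real.sq_sqrt h2.le, Real.sq_sqrt h3.le]
    push_cast
    field_simp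
  rw [← ofReal_norm, ← ENNReal.ofReal_pow (norm_nonneg _), h]
  rw [ENNReal.ofReal_mul (by positivity), ENNReal.ofReal_mul (by positivity)]
  norm_cast

end Absorb

/-! ### One boson emitted -/

section Emit

/-- The emitted boson comes first. -/
def emitOut (y : Fin (l + 1) → Boson) : Boson × (Fin l → Boson) := (y 0, Fin.tail y)

/-- No boson is absorbed. -/
def emitIn (q : Unit × (Fin l → Boson)) : Fin l → Boson := q.2

/-- The kernel, in the variables of `emitOut` and `emitIn`. -/
def emitKernel (F : Lepton → Lepton → Boson → ℂ) (o : Lepton × Lepton × Boson) (_ : Unit) : ℂ :=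
  F o.1 o.2.1 o.2.2

/-- Bringing one particle of each species to the front. -/
def emitPerms (j : Fin (n + 1) × Fin (m + 1) × Fin (l + 1)) : Perms (n + 1) (m + 1) (l + 1) :=
  (front j.1, front j.2.1, front j.2.2)

theorem measurePreserving_emitOut :
    MeasurePreserving (emitOut (l := l)) volume volume := measurePreserving_split

theorem measurePreserving_emitIn :
    MeasurePreserving (emitIn (l := l)) volume volume := measurePreserving_unit_snd

theorem measurePreserving_emitKernel :
    MeasurePreserving (fun q : (Lepton × Lepton × Boson) × Unit => q.1)
      volume volume := measurePreserving_unit_fst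

theorem fermiBose_emit (F : Lepton → Lepton → Boson → ℂ) (Ψ : Config n m l → ℂ)
    (hΨ : FermiBose Ψ) : FermiBose (spread (emitPerms (l := l))
      (contract (outMap emitOut) (inMap emitIn) (emitKernel F) Ψ)) := by
  refine fermiBose_spread _ (fun k => k.1 0 = 0 ∧ k.2.1 0 = 0 ∧ k.2.2 0 = 0) (fun k hk c => ?_)
    fun h => ⟨Equiv.prodCongr h.1 (Equiv.prodCongr h.2.1 h.2.2), fun j =>
      ⟨front_inv_mul_apply_zero h.1 j.1, front_inv_mul_apply_zero h.2.1 j.2.1,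
        front_inv_mul_apply_zero h.2.2 j.2.2⟩⟩
  obtain ⟨e1, h1, s1⟩ := exists_perm_of_fix_zero k.1 hk.1
  obtain ⟨e2, h2, s2⟩ := exists_perm_of_fix_zero k.2.1 hk.2.1
  obtain ⟨e3, h3, s3⟩ := exists_perm_of_fix_zero k.2.2 hk.2.2
  simp only [contract, outMap, inMap, emitOut, emitIn, emitKernel, Perms.act, relabel]
  rw [← integral_const_mul]
  refine integral_congr_ae (Filter.Eventually.of_forall fun z => ?_)
  have h4 := hΨ (e1, e2, e3) (Fin.tail c.1, Fin.tail c.2.1, Fin.tail c.2.2)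
  simp only [Perms.act, relabel, Perms.sign] at h4 ⊢
  rw [tail_comp_of_fix_zero h1, tail_comp_of_fix_zero h2, tail_comp_of_fix_zero h3, h4, s1, s2,
    Function.comp_apply, Function.comp_apply, Function.comp_apply, hk.1, hk.2.1, hk.2.2]
  ring

/-- The normalization of the second Wick monomial between fixed particle numbers. -/
def emitConst (n m l : ℕ) : ℂ :=
  (√((n : ℝ) + 1) : ℂ)⁻¹ * ((-1) ^ n * (√((m : ℝ) + 1) : ℂ)⁻¹) * (√((l : ℝ) + 1) : ℂ)⁻¹

theorem contract_emit (F : Lepton → Lepton → Boson → ℂ) (Ψ : Config n m l → ℂ)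
    (c : Config (n + 1) (m + 1) (l + 1)) :
    contract (outMap emitOut) (inMap emitIn) (emitKernel F) Ψ c =
      F (c.1 0) (c.2.1 0) (c.2.2 0) * Ψ (Fin.tail c.1, Fin.tail c.2.1, Fin.tail c.2.2) := by
  simp [contract, outMap, inMap, emitOut, emitIn, emitKernel]

theorem wick2_eq_spread (F : Lepton → Lepton → Boson → ℂ) (Ψ : Waves)
    (c : Config (n + 1) (m + 1) (l + 1)) : wick2 F Ψ (n + 1) (m + 1) (l + 1) c =
      emitConst n m l * spread emitPerms
        (contract (outMap emitOut) (inMap emitIn) (emitKernel F) (Ψ n m l)) c := by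
  simp only [wick2, creP, creM, creZ, emitConst, spread, contract_emit, emitPerms, Perms.act,
    Perms.sign, relabel, tail_comp_front, sign_front, Fintype.sum_prod_type, Function.comp_apply,
    front_apply_zero, Finset.mul_sum]
  refine Finset.sum_congr rfl fun i _ => Finset.sum_congr rfl fun j _ =>
    Finset.sum_congr rfl fun k _ => ?_
  push_cast
  ring

theorem ae_emitPerms {P : Config (n + 1) (m + 1) (l + 1) → Prop} (h : ∀ᵐ c, P c) :
    ∀ᵐ c : Config (n + 1) (m + 1) (l + 1), ∀ j, P ((emitPerms j).act c) :=
  ae_all_iff.2 fun j => (emitPerms j).measurePreserving_act.quasiMeasurePreserving.ae h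

/-- Emission has the normalization `(l+1)^(-1/2)` but also `l+1` choices of the emitted boson, so
the net factor agrees with that for absorption. -/
theorem sq_enorm_emitConst (n m l : ℕ) :
    ‖emitConst n m l * (Fintype.card (Fin (n + 1) × Fin (m + 1) × Fin (l + 1)) : ℕ)‖ₑ ^ 2 =
      ((n : ENNReal) + 1) * (m + 1) * (l + 1) := by
  have h : ‖emitConst n m l * (Fintype.card (Fin (n + 1) × Fin (m + 1) × Fin (l + 1)) : ℕ)‖ ^ 2 =
      ((n : ℝ) + 1) * (m + 1) * (l + 1) := by
    have h1 : (0 : ℝ) < n + 1 := by positivity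
    have h2 : (0 : ℝ) < m + 1 := by positivity
    have h3 : (0 : ℝ) < l + 1 := by positivity
    simp only [emitConst, norm_mul, norm_inv, norm_pow, norm_neg, norm_one, one_pow, one_mul,
      Complex.norm_real, Fintype.card_prod, Fintype.card_fin, Complex.norm_natCast,
      Real.norm_of_nonneg (Real.sqrt_nonneg _), mul_pow, inv_pow, Real.sq_sqrt h1.le,
      Real.sq_sqrt h2.le, Real.sq_sqrt h3.le]
    push_cast
    field_simp
  rw [← ofReal_norm, ← ENNReal.ofReal_pow (norm_nonneg _), h]
  rw [ENNReal.ofReal_mul (by positivity), ENNReal.ofReal_mul (by positivity)]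
  norm_cast

end Emit

/-! ### The Wick monomials as block operators -/

theorem fn_zero (n m l : ℕ) : ∀ᵐ c, fn (0 : sector n m l) c = 0 := Lp.coeFn_zero _ _ _

theorem sector_ext {n m l : ℕ} {ψ φ : sector n m l} (h : ∀ᵐ c, fn ψ c = fn φ c) : ψ = φ :=
  Subtype.ext (Lp.ext h)

theorem mem_graph_toLinearPMap_iff {R E F : Type*} [Ring R] [AddCommGroup E] [Module R E]
    [AddCommGroup F] [Module R F] {g : Submodule R (E × F)}
    (hg : ∀ x ∈ g, x.1 = 0 → x.2 = 0) (x : E × F) : x ∈ g.toLinearPMap.graph ↔ x ∈ g := by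
  rw [g.toLinearPMap_graph_eq hg]

theorem mem_graph_HI1_iff (F : Lepton → Lepton → Boson → ℂ) (ψ φ : Fock) :
    (ψ, φ) ∈ (HI1 F).graph ↔ Wick1Rel F ψ φ :=
  mem_graph_toLinearPMap_iff (wick1Graph_single_valued F) (ψ, φ)

theorem mem_graph_HI2_iff (F : Lepton → Lepton → Boson → ℂ) (ψ φ : Fock) :
    (ψ, φ) ∈ (HI2 F).graph ↔ Wick2Rel F ψ φ :=
  mem_graph_toLinearPMap_iff (wick2Graph_single_valued F) (ψ, φ)

theorem measurable_absorbKernel {F : Lepton → Lepton → Boson → ℂ}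
    (h : Measurable fun q : Lepton × Lepton × Boson => F q.1 q.2.1 q.2.2) :
    Measurable fun q : (Lepton × Lepton × Unit) × Boson => absorbKernel F q.1 q.2 :=
  h.comp measurePreserving_absorbKernel.measurable

theorem sqInt_absorbKernel {F : Lepton → Lepton → Boson → ℂ}
    (h : Measurable fun q : Lepton × Lepton × Boson => F q.1 q.2.1 q.2.2) :
    ∫⁻ q : (Lepton × Lepton × Unit) × Boson, ‖absorbKernel F q.1 q.2‖ₑ ^ 2 =
      ∫⁻ q : Lepton × Lepton × Boson, ‖F q.1 q.2.1 q.2.2‖ₑ ^ 2 :=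
  measurePreserving_absorbKernel.lintegral_comp (h.enorm.pow_const 2)

theorem measurable_emitKernel {F : Lepton → Lepton → Boson → ℂ}
    (h : Measurable fun q : Lepton × Lepton × Boson => F q.1 q.2.1 q.2.2) :
    Measurable fun q : (Lepton × Lepton × Boson) × Unit => emitKernel F q.1 q.2 :=
  h.comp measurePreserving_emitKernel.measurable

theorem sqInt_emitKernel {F : Lepton → Lepton → Boson → ℂ}
    (h : Measurable fun q : Lepton × Lepton × Boson => F q.1 q.2.1 q.2.2) :
    ∫⁻ q : (Lepton × Lepton × Boson) × Unit, ‖emitKernel F q.1 q.2‖ₑ ^ 2 =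
      ∫⁻ q : Lepton × Lepton × Boson, ‖F q.1 q.2.1 q.2.2‖ₑ ^ 2 :=
  measurePreserving_emitKernel.lintegral_comp (h.enorm.pow_const 2)

section Elements

variable {F Ft : Lepton → Lepton → Boson → ℂ} (n m l : ℕ)

theorem exists_absorb_operator (h : RegularKernel F Ft) :
    ∃ T : sector n m (l + 1) →L[ℂ] sector (n + 1) (m + 1) l,
      (∀ (ψ : sector n m (l + 1)) (Ψ : Waves), (∀ᵐ c, fn ψ c = Ψ n m (l + 1) c) →
        ∀ᵐ c, fn (T ψ) c = wick1 F Ψ (n + 1) (m + 1) l c) ∧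
      (∀ ψ, ‖T ψ‖ₑ ^ 2 ≤ (∫⁻ q : Lepton × Lepton × Boson, ‖Ft q.1 q.2.1 q.2.2‖ₑ ^ 2) *
        ∫⁻ c, ‖fn ψ c‖ₑ ^ 2 * ((l + 1) * (1 + leptonEnergy c.1))) ∧
      ∀ χ, ‖T.adjoint χ‖ₑ ^ 2 ≤ (∫⁻ q : Lepton × Lepton × Boson, ‖Ft q.1 q.2.1 q.2.2‖ₑ ^ 2) *
        ∫⁻ c, ‖fn χ c‖ₑ ^ 2 * ((l + 1) * (1 + leptonEnergy c.1)) := by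
  have hF := measurable_absorbKernel h.measurable
  have hFt := measurable_absorbKernel h.measurable'
  have hF2 := (sqInt_absorbKernel h.measurable).trans_lt h.sqInt_lt_top
  have hs : ∀ Ψ : Config n m (l + 1) → ℂ, FermiBose Ψ → FermiBose (spread (absorbPerms (l := l))
      (contract (outMap absorbOut) (inMap absorbIn) (absorbKernel F) Ψ)) := fermiBose_absorb F
  have key := exists_sector_operator (n := n) (m := m) measurePreserving_absorbOut
    measurePreserving_absorbIn hF hF2 absorbPerms (absorbConst n m l) hs
  obtain ⟨T, h1, h2⟩ := key
  refine ⟨T, fun ψ Ψ hΨ => ?_, fun ψ => ?_, fun χ => ?_⟩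
  · simp only [wick1_eq_spread]
    exact h1 ψ _ hΨ
  · exact (sq_enorm_apply_le measurePreserving_absorbOut measurePreserving_absorbIn hF hFt hF2
      (fun o z => h.le _ _ _) (sq_enorm_absorbConst n m l) h2 ψ).trans_eq
      (congrArg (· * _) (sqInt_absorbKernel h.measurable'))
  · exact (sq_enorm_adjoint_apply_le measurePreserving_absorbOut measurePreserving_absorbIn hF hFt
      hF2 (fun o z => h.le _ _ _) (sq_enorm_absorbConst n m l) h2 χ).trans_eq
      (congrArg (· * _) (sqInt_absorbKernel h.measurable'))

theorem exists_emit_operator (h : RegularKernel F Ft) :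
    ∃ T : sector n m l →L[ℂ] sector (n + 1) (m + 1) (l + 1),
      (∀ (ψ : sector n m l) (Ψ : Waves), (∀ᵐ c, fn ψ c = Ψ n m l c) →
        ∀ᵐ c, fn (T ψ) c = wick2 F Ψ (n + 1) (m + 1) (l + 1) c) ∧
      (∀ ψ, ‖T ψ‖ₑ ^ 2 ≤ (∫⁻ q : Lepton × Lepton × Boson, ‖Ft q.1 q.2.1 q.2.2‖ₑ ^ 2) *
        ∫⁻ c, ‖fn ψ c‖ₑ ^ 2 * ((l + 1) * (1 + leptonEnergy c.1))) ∧
      ∀ χ, ‖T.adjoint χ‖ₑ ^ 2 ≤ (∫⁻ q : Lepton × Lepton × Boson, ‖Ft q.1 q.2.1 q.2.2‖ₑ ^ 2) *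
        ∫⁻ c, ‖fn χ c‖ₑ ^ 2 * ((l + 1) * (1 + leptonEnergy c.1)) := by
  have hF := measurable_emitKernel h.measurable
  have hFt := measurable_emitKernel h.measurable'
  have hF2 := (sqInt_emitKernel h.measurable).trans_lt h.sqInt_lt_top
  have hs : ∀ Ψ : Config n m l → ℂ, FermiBose Ψ → FermiBose (spread (emitPerms (l := l))
      (contract (outMap emitOut) (inMap emitIn) (emitKernel F) Ψ)) := fermiBose_emit F
  have key := exists_sector_operator (n := n) (m := m) measurePreserving_emitOut
    measurePreserving_emitIn hF hF2 emitPerms (emitConst n m l) hs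
  obtain ⟨T, h1, h2⟩ := key
  refine ⟨T, fun ψ Ψ hΨ => ?_, fun ψ => ?_, fun χ => ?_⟩
  · simp only [wick2_eq_spread]
    exact h1 ψ _ hΨ
  · exact (sq_enorm_apply_le measurePreserving_emitOut measurePreserving_emitIn hF hFt hF2
      (fun o z => h.le _ _ _) (sq_enorm_emitConst n m l) h2 ψ).trans_eq
      (congrArg (· * _) (sqInt_emitKernel h.measurable'))
  · exact (sq_enorm_adjoint_apply_le measurePreserving_emitOut measurePreserving_emitIn hF hFt
      hF2 (fun o z => h.le _ _ _) (sq_enorm_emitConst n m l) h2 χ).trans_eq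
      (congrArg (· * _) (sqInt_emitKernel h.measurable'))

theorem absorb_integrand (F : Lepton → Lepton → Boson → ℂ) (Ψ : Waves)
    (c : Config (n + 1) (m + 1) l) (i : Fin (n + 1)) (i' : Fin (m + 1)) (z : Boson) :
    F (c.1 i) (c.2.1 i') z * annZ z Ψ n m l (i.removeNth c.1, i'.removeNth c.2.1, c.2.2) =
      (√((l : ℝ) + 1) : ℂ) *
        (absorbKernel F (outMap absorbOut ((absorbPerms (i, i')).act c)).1 z *
        Ψ n m (l + 1) (inMap absorbIn (z, (outMap absorbOut ((absorbPerms (i, i')).act c)).2))) := by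
  simp only [annZ, outMap, inMap, absorbOut,
    absorbIn, absorbKernel, absorbPerms, Perms.act, relabel, tail_comp_front,
    Function.comp_apply, front_apply_zero, Equiv.Perm.coe_one, Function.comp_id]
  ring

/-- For square integrable kernels convergence is automatic. Membership in the maximal domain thus
reduces to the image lying in the Fock space, as the block description requires. -/
theorem wick1Converges_wave (h : RegularKernel F Ft) (ψ : Fock) :
    Wick1Converges F (wave ψ) := by
  intro n m l
  have h1 := ae_integrable_contract
    (measurePreserving_outMap (X := Lepton) (n := n) (m := m) measurePreserving_absorbOut)
    (measurePreserving_inMap (X := Lepton) (n := n) (m := m) measurePreserving_absorbIn)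
    (measurable_absorbKernel h.measurable) (measurable_sector (ψ (n, m, l + 1)))
    ((sqInt_absorbKernel h.measurable).trans_lt h.sqInt_lt_top)
    (sqInt_sector_lt_top (ψ (n, m, l + 1)))
  filter_upwards [ae_absorbPerms h1] with c hc i i'
  simp only [absorb_integrand]
  exact (hc i i').const_mul _

end Elements

variable {F Ft : Lepton → Lepton → Boson → ℂ}

/-- Outputs in sectors without a neutrino or without an antineutrino vanish, and these are exactly
the sectors outside the range of the target map. -/
theorem exists_isBlock_HI1 (h : RegularKernel F Ft) :
    ∃ T : ∀ k : ℕ × ℕ × ℕ, sector k.1 k.2.1 (k.2.2 + 1) →L[ℂ] sector (k.1 + 1) (k.2.1 + 1) k.2.2,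
      IsBlock (E := fun ν : ℕ × ℕ × ℕ => sector ν.1 ν.2.1 ν.2.2) (HI1 F)
        (fun k : ℕ × ℕ × ℕ => (k.1, k.2.1, k.2.2 + 1)) (fun k => (k.1 + 1, k.2.1 + 1, k.2.2)) T ∧
      (∀ k ψ, ‖T k ψ‖ₑ ^ 2 ≤ (∫⁻ q : Lepton × Lepton × Boson, ‖Ft q.1 q.2.1 q.2.2‖ₑ ^ 2) *
        ∫⁻ c, ‖fn ψ c‖ₑ ^ 2 * ((k.2.2 + 1) * (1 + leptonEnergy c.1))) ∧
      ∀ k χ, ‖(T k).adjoint χ‖ₑ ^ 2 ≤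
        (∫⁻ q : Lepton × Lepton × Boson, ‖Ft q.1 q.2.1 q.2.2‖ₑ ^ 2) *
        ∫⁻ c, ‖fn χ c‖ₑ ^ 2 * ((k.2.2 + 1) * (1 + leptonEnergy c.1)) := by
  choose T h1 h2 h3 using fun k : ℕ × ℕ × ℕ => exists_absorb_operator k.1 k.2.1 k.2.2 h
  refine ⟨T, ⟨fun a b hab => ?_, fun a b hab => ?_, fun ψ φ => ?_⟩, h2, h3⟩
  · simp only [Prod.mk.injEq, add_left_inj] at hab
    exact Prod.ext hab.1 (Prod.ext hab.2.1 hab.2.2)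
  · simp only [Prod.mk.injEq, add_left_inj] at hab
    exact Prod.ext hab.1 (Prod.ext hab.2.1 hab.2.2)
  refine (mem_graph_HI1_iff F ψ φ).trans ?_
  constructor
  · rintro ⟨Ψ, e1, -, e2⟩
    refine ⟨fun k => sector_ext ?_, fun ⟨n, m, l⟩ hi => sector_ext ?_⟩
    · filter_upwards [e2 (k.1 + 1) (k.2.1 + 1) k.2.2, h1 k _ Ψ (e1 k.1 k.2.1 (k.2.2 + 1))]
        with c a1 a2
      exact a1.trans a2.symm
    · filter_upwards [e2 n m l, fn_zero n m l] with c a1 a2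
      refine a1.trans (Eq.trans ?_ a2.symm)
      match n, m, hi with
      | 0, _, _ => simp [wick1, creP]
      | _ + 1, 0, _ => simp [wick1, creP, creM]
      | n + 1, m + 1, hi => exact absurd ⟨(n, m, l), rfl⟩ hi
  · rintro ⟨e1, e2⟩
    refine ⟨wave ψ, fun _ _ _ => .of_forall fun _ => rfl, wick1Converges_wave h ψ,
      fun n m l => ?_⟩
    match n, m with
    | 0, m =>
      have e3 : φ (0, m, l) = 0 := e2 _ (by simp)
      filter_upwards [fn_zero 0 m l] with c hc
      simp only [wave, e3, wick1, creP]
      exact hc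
    | n + 1, 0 =>
      have e3 : φ (n + 1, 0, l) = 0 := e2 _ (by simp)
      filter_upwards [fn_zero (n + 1) 0 l] with c hc
      simp only [wave, e3, wick1, creP, creM, mul_zero, Finset.sum_const_zero]
      exact hc
    | n + 1, m + 1 =>
      filter_upwards [h1 (n, m, l) _ (wave ψ) (.of_forall fun _ => rfl)] with c hc
      rw [← hc]
      have := e1 (n, m, l)
      exact congrArg (fun x => fn x c) this

theorem exists_isBlock_HI2 (h : RegularKernel F Ft) :
    ∃ T : ∀ k : ℕ × ℕ × ℕ, sector k.1 k.2.1 k.2.2 →L[ℂ] sector (k.1 + 1) (k.2.1 + 1) (k.2.2 + 1),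
      IsBlock (E := fun ν : ℕ × ℕ × ℕ => sector ν.1 ν.2.1 ν.2.2) (HI2 F)
        (fun k : ℕ × ℕ × ℕ => k) (fun k => (k.1 + 1, k.2.1 + 1, k.2.2 + 1)) T ∧
      (∀ k ψ, ‖T k ψ‖ₑ ^ 2 ≤ (∫⁻ q : Lepton × Lepton × Boson, ‖Ft q.1 q.2.1 q.2.2‖ₑ ^ 2) *
        ∫⁻ c, ‖fn ψ c‖ₑ ^ 2 * ((k.2.2 + 1) * (1 + leptonEnergy c.1))) ∧
      ∀ k χ, ‖(T k).adjoint χ‖ₑ ^ 2 ≤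
        (∫⁻ q : Lepton × Lepton × Boson, ‖Ft q.1 q.2.1 q.2.2‖ₑ ^ 2) *
        ∫⁻ c, ‖fn χ c‖ₑ ^ 2 * ((k.2.2 + 1) * (1 + leptonEnergy c.1)) := by
  choose T h1 h2 h3 using fun k : ℕ × ℕ × ℕ => exists_emit_operator k.1 k.2.1 k.2.2 h
  refine ⟨T, ⟨fun a b hab => hab, fun a b hab => ?_, fun ψ φ => ?_⟩, h2, h3⟩
  · simp only [Prod.mk.injEq, add_left_inj] at hab
    exact Prod.ext hab.1 (Prod.ext hab.2.1 hab.2.2)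
  refine (mem_graph_HI2_iff F ψ φ).trans ?_
  constructor
  · rintro ⟨Ψ, e1, e2⟩
    refine ⟨fun k => sector_ext ?_, fun ⟨n, m, l⟩ hi => sector_ext ?_⟩
    · filter_upwards [e2 (k.1 + 1) (k.2.1 + 1) (k.2.2 + 1), h1 k _ Ψ (e1 k.1 k.2.1 k.2.2)]
        with c a1 a2
      exact a1.trans a2.symm
    · filter_upwards [e2 n m l, fn_zero n m l] with c a1 a2
      refine a1.trans (Eq.trans ?_ a2.symm)
      match n, m, l, hi with
      | 0, _, _, _ => simp [wick2, creP]
      | _ + 1, 0, _, _ => simp [wick2, creP, creM]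
      | _ + 1, _ + 1, 0, _ => simp [wick2, creP, creM, creZ]
      | n + 1, m + 1, l + 1, hi => exact absurd ⟨(n, m, l), rfl⟩ hi
  · rintro ⟨e1, e2⟩
    refine ⟨wave ψ, fun _ _ _ => .of_forall fun _ => rfl, fun n m l => ?_⟩
    match n, m, l with
    | 0, m, l =>
      have e3 : φ (0, m, l) = 0 := e2 _ (by simp)
      filter_upwards [fn_zero 0 m l] with c hc
      simp only [wave, e3, wick2, creP]
      exact hc
    | n + 1, 0, l =>
      have e3 : φ (n + 1, 0, l) = 0 := e2 _ (by simp)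
      filter_upwards [fn_zero (n + 1) 0 l] with c hc
      simp only [wave, e3, wick2, creP, creM, mul_zero, Finset.sum_const_zero]
      exact hc
    | n + 1, m + 1, 0 =>
      have e3 : φ (n + 1, m + 1, 0) = 0 := e2 _ (by simp)
      filter_upwards [fn_zero (n + 1) (m + 1) 0] with c hc
      simp only [wave, e3, wick2, creP, creM, creZ, mul_zero, Finset.sum_const_zero]
      exact hc
    | n + 1, m + 1, l + 1 =>
      filter_upwards [h1 (n, m, l) _ (wave ψ) (.of_forall fun _ => rfl)] with c hc
      rw [← hc]
      have := e1 (n, m, l)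
      exact congrArg (fun x => fn x c) this

/-! ### Dependence on the kernel -/

section Congr

variable {F F' : Lepton → Lepton → Boson → ℂ}
  (h : ∀ᵐ q : Lepton × Lepton × Boson, F q.1 q.2.1 q.2.2 = F' q.1 q.2.1 q.2.2)

include h

/-- Null sets of the kernel variables pull back to null sets of configurations for every choice of
particles. The Wick operators therefore depend only on the almost everywhere class of the kernel,
which permits replacing a cutoff function that is only almost everywhere strongly measurable by a
measurable one. -/
theorem ae_absorbKernel_eq (n m l : ℕ) : ∀ᵐ c : Config (n + 1) (m + 1) l, ∀ i i', ∀ᵐ z,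
    F (c.1 i) (c.2.1 i') z = F' (c.1 i) (c.2.1 i') z := by
  have h1 := measurePreserving_absorbKernel.quasiMeasurePreserving.ae h
  have h2 := ae_contract_kernel
    (measurePreserving_outMap (X := Lepton) (n := n) (m := m) (measurePreserving_absorbOut (l := l)))
    (P := fun o z => absorbKernel F o z = absorbKernel F' o z) h1
  filter_upwards [ae_absorbPerms h2] with c hc i i'
  filter_upwards [hc i i'] with z hz
  simpa [outMap, absorbOut, absorbKernel, absorbPerms, Perms.act, relabel] using hz

theorem ae_emitKernel_eq (n m l : ℕ) : ∀ᵐ c : Config (n + 1) (m + 1) (l + 1), ∀ i i' i'',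
    F (c.1 i) (c.2.1 i') (c.2.2 i'') = F' (c.1 i) (c.2.1 i') (c.2.2 i'') := by
  have h1 := measurePreserving_emitKernel.quasiMeasurePreserving.ae h
  have h2 := ae_contract_kernel
    (measurePreserving_outMap (X := Lepton) (n := n) (m := m) (measurePreserving_emitOut (l := l)))
    (P := fun o z => emitKernel F o z = emitKernel F' o z) h1
  filter_upwards [ae_emitPerms h2] with c hc i i' i''
  -- The one-point space has nonzero measure, so a statement holding almost everywhere on it holds
  -- at its point.
  obtain ⟨z, hz⟩ := (hc (i, i', i'')).exists
  simpa [outMap, emitOut, emitKernel, emitPerms, Perms.act, relabel] using hz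

theorem Wick1Rel.congr_kernel {ψ φ : Fock} (hr : Wick1Rel F ψ φ) : Wick1Rel F' ψ φ := by
  obtain ⟨Ψ, e1, e2, e3⟩ := hr
  refine ⟨Ψ, e1, fun n m l => ?_, fun n m l => ?_⟩
  · filter_upwards [e2 n m l, ae_absorbKernel_eq h n m l] with c h1 h2 i i'
    exact (h1 i i').congr ((h2 i i').mono fun z hz => by simp only [hz])
  · match n, m with
    | 0, m => filter_upwards [e3 0 m l] with c hc using hc
    | n + 1, 0 =>
      filter_upwards [e3 (n + 1) 0 l] with c hc
      rw [hc]
      simp [wick1, creP, creM]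
    | n + 1, m + 1 =>
      filter_upwards [e3 (n + 1) (m + 1) l, ae_absorbKernel_eq h n m l] with c hc h2
      rw [hc]
      simp only [wick1, creP, creM]
      have h3 : ∀ i i', ∫ z, F (c.1 i) (c.2.1 i') z *
          annZ z Ψ n m l (i.removeNth c.1, i'.removeNth c.2.1, c.2.2) = ∫ z,
          F' (c.1 i) (c.2.1 i') z *
          annZ z Ψ n m l (i.removeNth c.1, i'.removeNth c.2.1, c.2.2) := fun i i' =>
        integral_congr_ae ((h2 i i').mono fun z hz => by simp only [hz])
      simp only [h3]

theorem Wick2Rel.congr_kernel {ψ φ : Fock} (hr : Wick2Rel F ψ φ) : Wick2Rel F' ψ φ := by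
  obtain ⟨Ψ, e1, e3⟩ := hr
  refine ⟨Ψ, e1, fun n m l => ?_⟩
  match n, m, l with
  | 0, m, l => filter_upwards [e3 0 m l] with c hc using hc
  | n + 1, 0, l =>
    filter_upwards [e3 (n + 1) 0 l] with c hc
    rw [hc]
    simp [wick2, creP, creM]
  | n + 1, m + 1, 0 =>
    filter_upwards [e3 (n + 1) (m + 1) 0] with c hc
    rw [hc]
    simp [wick2, creP, creM, creZ]
  | n + 1, m + 1, l + 1 =>
    filter_upwards [e3 (n + 1) (m + 1) (l + 1), ae_emitKernel_eq h n m l] with c hc h2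
    rw [hc]
    simp only [wick2, creP, creM, creZ, h2]

theorem HI1_congr : HI1 F = HI1 F' :=
  congrArg Submodule.toLinearPMap (Submodule.ext fun _ =>
    ⟨fun hr => Wick1Rel.congr_kernel h hr,
      fun hr => Wick1Rel.congr_kernel (h.mono fun _ => Eq.symm) hr⟩)

theorem HI2_congr : HI2 F = HI2 F' :=
  congrArg Submodule.toLinearPMap (Submodule.ext fun _ =>
    ⟨fun hr => Wick2Rel.congr_kernel h hr,
      fun hr => Wick2Rel.congr_kernel (h.mono fun _ => Eq.symm) hr⟩)

end Congr

/-! ## Small interactions of creation and annihilation type -/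

section Interaction

variable {E : Type*} [NormedAddCommGroup E] [InnerProductSpace ℂ E] [CompleteSpace E]

/-- Each `Hᵢ` is paired with its adjoint, so the sum is symmetric on the common domain. The four
terms add up to a relative bound `4C`. -/
theorem exists_coupling {A H₁ H₂ : E →ₗ.[ℂ] E} (hs : A.IsFormalAdjoint A)
    (hp : ∀ y, ∃ x : A.domain, A x + Complex.I • (x : E) = y)
    (hm : ∀ y, ∃ x : A.domain, A x + (-Complex.I) • (x : E) = y) {C : ℝ} (hC : 0 ≤ C)
    (h : ∀ B ∈ ({H₁, H₂, H₁.adjoint, H₂.adjoint} : Set (E →ₗ.[ℂ] E)), ∀ x : A.domain,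
      ∃ w, ((x : E), w) ∈ B.graph ∧ ‖w‖ ≤ C * (‖A x‖ + ‖(x : E)‖)) :
    ∃ g₀ : ℝ, 0 < g₀ ∧ ∀ g : ℝ, 0 ≤ g → g ≤ g₀ →
      (A + (g : ℂ) • (H₁ + H₂ + H₁.adjoint + H₂.adjoint)).domain = A.domain ∧
        IsSelfAdjoint (A + (g : ℂ) • (H₁ + H₂ + H₁.adjoint + H₂.adjoint)) := by
  have hd : Dense (A.domain : Set E) := dense_domain_of_surjective hs hp
  have hdom : ∀ B ∈ ({H₁, H₂, H₁.adjoint, H₂.adjoint} : Set (E →ₗ.[ℂ] E)),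
      A.domain ≤ B.domain := fun B hB x hx => by
    obtain ⟨w, h1, -⟩ := h B hB ⟨x, hx⟩
    exact LinearPMap.mem_domain_of_mem_graph h1
  have hbd : ∀ B (hB : B ∈ ({H₁, H₂, H₁.adjoint, H₂.adjoint} : Set (E →ₗ.[ℂ] E)))
      (x : A.domain), ‖B ⟨x, hdom B hB x.2⟩‖ ≤ C * (‖A x‖ + ‖(x : E)‖) := fun B hB x => by
    obtain ⟨w, h1, h2⟩ := h B hB x
    rw [LinearPMap.mem_graph_iff] at h1
    obtain ⟨y, hy, rfl⟩ := h1
    have : y = ⟨x, hdom B hB x.2⟩ := Subtype.ext hy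
    rwa [← this]
  have i1 := hdom H₁ (by simp)
  have i2 := hdom H₂ (by simp)
  have i3 := hdom H₁.adjoint (by simp)
  have i4 := hdom H₂.adjoint (by simp)
  have hV : A.domain ≤ (H₁ + H₂ + H₁.adjoint + H₂.adjoint).domain := by
    simp only [LinearPMap.add_domain]
    exact le_inf (le_inf (le_inf i1 i2) i3) i4
  have happ : ∀ x : A.domain, (H₁ + H₂ + H₁.adjoint + H₂.adjoint) ⟨x, hV x.2⟩ =
      H₁ ⟨x, i1 x.2⟩ + H₂ ⟨x, i2 x.2⟩ + H₁.adjoint ⟨x, i3 x.2⟩ + H₂.adjoint ⟨x, i4 x.2⟩ :=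
    fun x => by simp only [LinearPMap.add_apply]
  have a1 : ∀ x y : A.domain, inner ℂ (H₁.adjoint ⟨x, i3 x.2⟩) (y : E) =
      inner ℂ (x : E) (H₁ ⟨y, i1 y.2⟩) := fun x y =>
    LinearPMap.adjoint_isFormalAdjoint (hd.mono i1) ⟨x, i3 x.2⟩ ⟨y, i1 y.2⟩
  have a2 : ∀ x y : A.domain, inner ℂ (H₂.adjoint ⟨x, i4 x.2⟩) (y : E) =
      inner ℂ (x : E) (H₂ ⟨y, i2 y.2⟩) := fun x y =>
    LinearPMap.adjoint_isFormalAdjoint (hd.mono i2) ⟨x, i4 x.2⟩ ⟨y, i2 y.2⟩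
  have b1 : ∀ x y : A.domain, inner ℂ (H₁ ⟨x, i1 x.2⟩) (y : E) =
      inner ℂ (x : E) (H₁.adjoint ⟨y, i3 y.2⟩) := fun x y => by
    rw [← inner_conj_symm, ← a1, inner_conj_symm]
  have b2 : ∀ x y : A.domain, inner ℂ (H₂ ⟨x, i2 x.2⟩) (y : E) =
      inner ℂ (x : E) (H₂.adjoint ⟨y, i4 y.2⟩) := fun x y => by
    rw [← inner_conj_symm, ← a2, inner_conj_symm]
  -- The Neumann series needs `g · 2 · (4C) < 1`; the added `1` makes the inequality strict and
  -- covers `C = 0`.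
  refine ⟨(8 * C + 1)⁻¹, by positivity, fun g hg hg' => isSelfAdjoint_add_small (C := 4 * C) hs hp
    hm hV (fun x y => ?_) (fun x => ?_) hg ?_⟩
  · rw [happ, happ]
    simp only [inner_add_left, inner_add_right, a1, a2, b1, b2]
    ring
  · rw [happ]
    have c1 := hbd H₁ (by simp) x
    have c2 := hbd H₂ (by simp) x
    have c3 := hbd H₁.adjoint (by simp) x
    have c4 := hbd H₂.adjoint (by simp) x
    refine (norm_add_le _ _).trans ?_
    refine (add_le_add_left (norm_add_le _ _) _).trans ?_
    refine (add_le_add_left (add_le_add_left (norm_add_le _ _) _) _).trans ?_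
    linarith
  · calc g * (2 * (4 * C)) = g * (8 * C) := by ring
      _ ≤ (8 * C + 1)⁻¹ * (8 * C) := by gcongr
      _ < (8 * C + 1)⁻¹ * (8 * C + 1) := by gcongr; linarith
      _ = 1 := inv_mul_cancel₀ (by positivity)

end Interaction

/-! ## The free Hamiltonian -/

section Free

variable {mZ : ℝ}

theorem mem_graph_H0_iff (ψ φ : Fock) : (ψ, φ) ∈ (H0 mZ).graph ↔ FreeRel mZ ψ φ :=
  mem_graph_toLinearPMap_iff (freeGraph_single_valued mZ) (ψ, φ)

theorem freeRel_H0 (x : (H0 mZ).domain) : FreeRel mZ x (H0 mZ x) :=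
  (mem_graph_H0_iff _ _).1 ((H0 mZ).mem_graph x)

theorem energy_nonneg {n m l : ℕ} (c : Config n m l) : 0 ≤ energy mZ c :=
  add_nonneg (add_nonneg (Finset.sum_nonneg fun _ _ => NNReal.coe_nonneg _)
    (Finset.sum_nonneg fun _ _ => NNReal.coe_nonneg _))
    (Finset.sum_nonneg fun _ _ => Real.sqrt_nonneg _)

theorem measurable_energy {n m l : ℕ} : Measurable (energy mZ (n := n) (m := m) (l := l)) := by
  unfold energy omega3
  fun_prop

theorem energy_act {n m l : ℕ} (g : Perms n m l) (c : Config n m l) :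
    energy mZ (g.act c) = energy mZ c := by
  have h1 := Equiv.sum_comp g.1 fun i => ((c.1 i).1 : ℝ)
  have h2 := Equiv.sum_comp g.2.1 fun i => ((c.2.1 i).1 : ℝ)
  have h3 := Equiv.sum_comp g.2.2 fun i => omega3 mZ (c.2.2 i).1
  exact congrArg₂ _ (congrArg₂ _ h1 h2) h3

theorem inner_sector_energy {n m l : ℕ} {x x' y y' : sector n m l}
    (hx : ∀ᵐ c, fn x' c = energy mZ c * fn x c) (hy : ∀ᵐ c, fn y' c = energy mZ c * fn y c) :
    inner ℂ x' y = inner ℂ x y' := by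
  rw [inner_sector, inner_sector]
  refine integral_congr_ae ?_
  filter_upwards [hx, hy] with c h1 h2
  rw [h1, h2, map_mul, Complex.conj_ofReal]
  ring

theorem isFormalAdjoint_H0 : (H0 mZ).IsFormalAdjoint (H0 mZ) := by
  intro x y
  refine (lp.hasSum_inner (𝕜 := ℂ) _ _).unique ((lp.hasSum_inner (𝕜 := ℂ) _ _).congr_fun fun ν => ?_)
  exact inner_sector_energy (freeRel_H0 x ν.1 ν.2.1 ν.2.2) (freeRel_H0 y ν.1 ν.2.1 ν.2.2)

theorem exists_sector_mul {n m l : ℕ} {w : Config n m l → ℂ} (hw : Measurable w)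
    (hs : ∀ (g : Perms n m l) c, w (g.act c) = w c) (hb : ∀ c, ‖w c‖ ≤ 1) (ψ : sector n m l) :
    ∃ φ : sector n m l, (∀ᵐ c, fn φ c = w c * fn ψ c) ∧ ‖φ‖ ≤ ‖ψ‖ := by
  have h1 : MemLp (fun c => w c * fn ψ c) 2 := (memLp_fn ψ).of_le
    (hw.mul (measurable_sector ψ)).aestronglyMeasurable (.of_forall fun c => by
      rw [norm_mul]
      exact mul_le_of_le_one_left (norm_nonneg _) (hb c))
  have h2 : ∀ᵐ c, h1.toLp _ c = w c * fn ψ c := h1.coeFn_toLp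
  have h3 : h1.toLp _ ∈ sector n m l := (mem_sector_iff _).2 fun g => by
    filter_upwards [h2, g.measurePreserving_act.quasiMeasurePreserving.ae h2, fn_act ψ g]
      with c e1 e2 e3
    rw [e1, e2, e3, hs]
    ring
  refine ⟨⟨h1.toLp _, h3⟩, h2, Lp.norm_le_norm_of_ae_le ?_⟩
  filter_upwards [h2] with c hc
  have h4 : ‖h1.toLp _ c‖ ≤ ‖fn ψ c‖ := by
    rw [hc, norm_mul]
    exact mul_le_of_le_one_left (norm_nonneg _) (hb c)
  exact h4

theorem exists_lp_of_norm_le {ι : Type*} {E : ι → Type*} [∀ i, NormedAddCommGroup (E i)]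
    [∀ i, InnerProductSpace ℂ (E i)] (ψ : lp E 2) (v : ∀ i, E i) (h : ∀ i, ‖v i‖ ≤ ‖ψ i‖) :
    ∃ φ : lp E 2, ∀ i, φ i = v i := by
  have h1 : Summable fun i => ‖v i‖ ^ 2 := (lp_hasSum_norm_sq ψ).summable.of_nonneg_of_le
    (fun i => by positivity) fun i => by gcongr; exact h i
  exact ⟨⟨v, memℓp_gen (by simpa using h1)⟩, fun i => rfl⟩

theorem exists_add_smul_of_mem_graph {E : Type*} [AddCommGroup E] [Module ℂ E] {A : E →ₗ.[ℂ] E}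
    {x x' y : E} {z : ℂ} (h : (x, x') ∈ A.graph) (hy : x' + z • x = y) :
    ∃ x : A.domain, A x + z • (x : E) = y := by
  obtain ⟨x₀, e1, e2⟩ := A.mem_graph_iff.1 h
  exact ⟨x₀, by rw [e2, e1]; exact hy⟩

-- The solution is multiplication of `y` by `(E + z)⁻¹`. Because `z` is imaginary of modulus one,
-- `|E + z|² = E² + 1`, so both `(E + z)⁻¹` and `E (E + z)⁻¹` are bounded by one. The second bound
-- places the solution in the domain.
set_option maxHeartbeats 1000000 in
theorem exists_H0_add_smul {z : ℂ} (hz : z.re = 0) (hz1 : ‖z‖ = 1) (y : Fock) :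
    ∃ x : (H0 mZ).domain, H0 mZ x + z • (x : Fock) = y := by
  have hn : ∀ e : ℝ, ‖(e : ℂ) + z‖ ^ 2 = e ^ 2 + 1 := fun e => by
    have h1 : z.im ^ 2 = 1 := by
      have := Complex.sq_norm z
      rw [hz1, Complex.normSq_apply, hz] at this
      linarith
    rw [Complex.sq_norm, Complex.normSq_apply]
    simp [hz]
    linarith
  have hn1 : ∀ e : ℝ, 1 ≤ ‖(e : ℂ) + z‖ := fun e =>
    (abs_le_of_sq_le_sq' (by rw [hn]; nlinarith) (norm_nonneg _)).2
  have hn2 : ∀ e : ℝ, |e| ≤ ‖(e : ℂ) + z‖ := fun e =>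
    (abs_le_of_sq_le_sq' (by rw [hn, sq_abs]; linarith) (norm_nonneg _)).2
  choose v hv hv' using fun ν : ℕ × ℕ × ℕ => exists_sector_mul (n := ν.1) (m := ν.2.1) (l := ν.2.2)
    (w := fun c => ((energy mZ c : ℂ) + z)⁻¹)
    ((Complex.measurable_ofReal.comp measurable_energy).add_const z).inv
    (fun g c => by rw [energy_act])
    (fun c => by rw [norm_inv]; exact inv_le_one_of_one_le₀ (hn1 _)) (y ν)
  choose u hu hu' using fun ν : ℕ × ℕ × ℕ => exists_sector_mul (n := ν.1) (m := ν.2.1) (l := ν.2.2)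
    (w := fun c => (energy mZ c : ℂ) * ((energy mZ c : ℂ) + z)⁻¹)
    ((Complex.measurable_ofReal.comp measurable_energy).mul
      ((Complex.measurable_ofReal.comp measurable_energy).add_const z).inv)
    (fun g c => by rw [energy_act])
    (fun c => by
      rw [norm_mul, norm_inv, Complex.norm_real]
      exact mul_inv_le_one_of_le₀ (hn2 _) (norm_nonneg _)) (y ν)
  have hx := exists_lp_of_norm_le y v hv'
  have hx' := exists_lp_of_norm_le y u hu'
  obtain ⟨x, hx⟩ := hx
  obtain ⟨x', hx'⟩ := hx'
  have hrel : FreeRel mZ x x' := fun n m l => by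
    filter_upwards [hv (n, m, l), hu (n, m, l)] with c e1 e2
    have f1 : wave x n m l c = fn (v (n, m, l)) c := congrArg (fun s => fn s c) (hx (n, m, l))
    have f2 : wave x' n m l c = fn (u (n, m, l)) c := congrArg (fun s => fn s c) (hx' (n, m, l))
    rw [f1, f2, e1, e2, mul_assoc]
  refine exists_add_smul_of_mem_graph ((mem_graph_H0_iff x x').2 hrel) ?_
  refine lp.ext (funext fun ν => ?_)
  change x' ν + z • x ν = y ν
  rw [hx, hx']
  refine sector_ext ?_
  filter_upwards [fn_add (u ν) (z • v ν), fn_smul z (v ν), hv ν, hu ν] with c e1 e2 e3 e4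
  rw [e1, e2, e3, e4]
  have : (energy mZ c : ℂ) + z ≠ 0 := norm_pos_iff.1 (zero_lt_one.trans_le (hn1 _))
  field_simp

end Free

/-! ## Relative bounds with respect to the free Hamiltonian -/

section RelativeBound

variable {mZ : ℝ}

theorem leptonEnergy_eq_ofReal {n : ℕ} (c : Fin n → Lepton) :
    leptonEnergy c = ENNReal.ofReal (∑ i, ((c i).1 : ℝ)) := by
  rw [ENNReal.ofReal_sum_of_nonneg fun _ _ => NNReal.coe_nonneg _]
  simp [leptonEnergy]

/-- Every boson carries energy at least `mZ`, so `N ≤ E / mZ`, and the lepton momentum is at most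
`E`. The product `(E / mZ + 1)(1 + E)` grows quadratically and is bounded by `2 (1 + 1/mZ)(1 + E²)`.
-/
theorem weight_le_energy (hm : 0 < mZ) {n m l N : ℕ} (hN : N ≤ l) (c : Config n m l) :
    ((N : ENNReal) + 1) * (1 + leptonEnergy c.1) ≤
      ENNReal.ofReal (2 * (1 + mZ⁻¹)) * ENNReal.ofReal (1 + energy mZ c ^ 2) := by
  have h0 : 0 ≤ ∑ i, ((c.1 i).1 : ℝ) := Finset.sum_nonneg fun _ _ => NNReal.coe_nonneg _
  have h0' : 0 ≤ ∑ i, ((c.2.1 i).1 : ℝ) := Finset.sum_nonneg fun _ _ => NNReal.coe_nonneg _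
  have h1 : (l : ℝ) * mZ ≤ ∑ i, omega3 mZ (c.2.2 i).1 := by
    have : ∑ _i : Fin l, mZ ≤ ∑ i, omega3 mZ (c.2.2 i).1 := Finset.sum_le_sum fun i _ =>
      Real.le_sqrt_of_sq_le (by nlinarith [sq_nonneg ‖(c.2.2 i).1‖])
    simpa using this
  have h2 : ∑ i, ((c.1 i).1 : ℝ) ≤ energy mZ c := by
    unfold energy
    nlinarith [mul_nonneg (Nat.cast_nonneg (α := ℝ) l) hm.le]
  have h3 : (N : ℝ) ≤ mZ⁻¹ * energy mZ c := by
    have h4 : (l : ℝ) * mZ ≤ energy mZ c := by unfold energy; linarith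
    calc (N : ℝ) ≤ l := by exact_mod_cast hN
      _ = mZ⁻¹ * (l * mZ) := by field_simp
      _ ≤ _ := by gcongr
  have hE := energy_nonneg (mZ := mZ) c
  have hi : 0 ≤ mZ⁻¹ := by positivity
  have key : ((N : ℝ) + 1) * (1 + ∑ i, ((c.1 i).1 : ℝ)) ≤
      2 * (1 + mZ⁻¹) * (1 + energy mZ c ^ 2) := by
    calc _ ≤ (mZ⁻¹ * energy mZ c + 1) * (1 + energy mZ c) := by gcongr
      _ ≤ _ := by
        nlinarith [sq_nonneg (energy mZ c - 1), mul_nonneg hi (sq_nonneg (energy mZ c - 1)),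
          mul_nonneg hi (sq_nonneg (energy mZ c))]
  rw [leptonEnergy_eq_ofReal, ← ENNReal.ofReal_mul (by positivity)]
  refine le_trans (le_of_eq ?_) (ENNReal.ofReal_le_ofReal key)
  rw [ENNReal.ofReal_mul (by positivity), ENNReal.ofReal_add (by positivity) (by positivity),
    ENNReal.ofReal_add (by positivity) (by positivity)]
  simp

/-- On one sector `∫ |ψ|² (1 + E²) = ‖ψ‖² + ‖H0 ψ‖²`, so the energy weights of the matrix element
estimates become relative bounds with a constant independent of the sector. -/
theorem norm_sq_le_of_energy (hm : 0 < mZ) {n m l N : ℕ} (hN : N ≤ l) {ψ φ : sector n m l}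
    (h : ∀ᵐ c, fn φ c = energy mZ c * fn ψ c) {S : ENNReal} (hS : S ≠ ⊤) {E : Type*}
    [SeminormedAddCommGroup E] {y : E}
    (hy : ‖y‖ₑ ^ 2 ≤ S * ∫⁻ c, ‖fn ψ c‖ₑ ^ 2 * ((N + 1) * (1 + leptonEnergy c.1))) :
    ‖y‖ ^ 2 ≤ √(S.toReal * (2 * (1 + mZ⁻¹))) ^ 2 * (‖φ‖ ^ 2 + ‖ψ‖ ^ 2) := by
  have hψ := measurable_sector ψ
  have hφ := measurable_sector φ
  have h1 : ∫⁻ c, ‖fn ψ c‖ₑ ^ 2 * ((N + 1) * (1 + leptonEnergy c.1)) ≤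
      ENNReal.ofReal (2 * (1 + mZ⁻¹)) * (‖φ‖ₑ ^ 2 + ‖ψ‖ₑ ^ 2) := by
    rw [sq_enorm_sector, sq_enorm_sector, ← lintegral_add_left (by fun_prop),
      ← lintegral_const_mul _ (by fun_prop)]
    refine lintegral_mono_ae ?_
    filter_upwards [h] with c hc
    have h2 : ‖fn φ c‖ₑ ^ 2 + ‖fn ψ c‖ₑ ^ 2 =
        ‖fn ψ c‖ₑ ^ 2 * ENNReal.ofReal (1 + energy mZ c ^ 2) := by
      have h3 : ‖(energy mZ c : ℂ)‖ₑ ^ 2 = ENNReal.ofReal (energy mZ c ^ 2) := by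
        rw [← ofReal_norm, ← ENNReal.ofReal_pow (norm_nonneg _), Complex.norm_real,
          Real.norm_eq_abs, sq_abs]
      rw [hc, enorm_mul, mul_pow, h3, ENNReal.ofReal_add zero_le_one (sq_nonneg _),
        ENNReal.ofReal_one]
      ring
    calc _ ≤ ‖fn ψ c‖ₑ ^ 2 * (ENNReal.ofReal (2 * (1 + mZ⁻¹)) *
          ENNReal.ofReal (1 + energy mZ c ^ 2)) := mul_le_mul_right (weight_le_energy hm hN c) _
      _ = _ := by rw [h2]; ring
  have h4 : ‖y‖ₑ ^ 2 ≤ S * (ENNReal.ofReal (2 * (1 + mZ⁻¹)) * (‖φ‖ₑ ^ 2 + ‖ψ‖ₑ ^ 2)) :=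
    hy.trans (by gcongr)
  have h5 := ENNReal.toReal_mono (by finiteness) h4
  have hM : 0 ≤ 2 * (1 + mZ⁻¹) := by positivity
  rw [ENNReal.toReal_mul, ENNReal.toReal_mul, ENNReal.toReal_add (by finiteness) (by finiteness),
    ENNReal.toReal_ofReal hM] at h5
  rw [Real.sq_sqrt (mul_nonneg ENNReal.toReal_nonneg hM), mul_assoc]
  simpa using h5

variable {F Ft : Lepton → Lepton → Boson → ℂ}

theorem dense_domain_H0 : Dense ((H0 mZ).domain : Set Fock) :=
  dense_domain_of_surjective isFormalAdjoint_H0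
    (exists_H0_add_smul Complex.I_re Complex.norm_I)

theorem exists_graph_HI1 (hm : 0 < mZ) (h : RegularKernel F Ft) : ∃ C : ℝ, 0 ≤ C ∧
    ∀ B ∈ ({HI1 F, (HI1 F).adjoint} : Set (Fock →ₗ.[ℂ] Fock)), ∀ x : (H0 mZ).domain,
      ∃ w, ((x : Fock), w) ∈ B.graph ∧ ‖w‖ ≤ C * (‖H0 mZ x‖ + ‖(x : Fock)‖) := by
  have hb := exists_isBlock_HI1 h
  obtain ⟨T, hT, h1, h2⟩ := hb
  have e1 : ∀ x : (H0 mZ).domain, ∃ w, ((x : Fock), w) ∈ (HI1 F).graph ∧ ‖w‖ ≤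
      √((∫⁻ q : Lepton × Lepton × Boson, ‖Ft q.1 q.2.1 q.2.2‖ₑ ^ 2).toReal * (2 * (1 + mZ⁻¹))) *
        (‖H0 mZ x‖ + ‖(x : Fock)‖) := fun x =>
    -- The weight involves `N = k.2.2`. Absorption starts from `N + 1` bosons, its adjoint from `N`,
    -- so `N ≤ l` holds in both cases. For emission the two roles are interchanged.
    hT.exists_graph (Real.sqrt_nonneg _) fun k => norm_sq_le_of_energy hm (Nat.le_succ k.2.2)
      (freeRel_H0 x _ _ _) h.lt_top.ne (h1 k _)
  -- The domain of the monomial contains that of `H0`, so it is dense and the adjoint is determined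
  -- by its pairings.
  have hd : Dense ((HI1 F).domain : Set Fock) := dense_domain_H0.mono fun x hx => by
    have := e1 ⟨x, hx⟩
    exact LinearPMap.mem_domain_of_mem_graph this.choose_spec.1
  have e2 : ∀ x : (H0 mZ).domain, ∃ w, ((x : Fock), w) ∈ (HI1 F).adjoint.graph ∧ ‖w‖ ≤
      √((∫⁻ q : Lepton × Lepton × Boson, ‖Ft q.1 q.2.1 q.2.2‖ₑ ^ 2).toReal * (2 * (1 + mZ⁻¹))) *
        (‖H0 mZ x‖ + ‖(x : Fock)‖) := fun x =>
    hT.exists_adjoint_graph hd (Real.sqrt_nonneg _) fun k => norm_sq_le_of_energy hm le_rfl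
      (freeRel_H0 x _ _ _) h.lt_top.ne (h2 k _)
  refine ⟨√((∫⁻ q : Lepton × Lepton × Boson, ‖Ft q.1 q.2.1 q.2.2‖ₑ ^ 2).toReal *
    (2 * (1 + mZ⁻¹))), Real.sqrt_nonneg _, ?_⟩
  rintro B (rfl | rfl)
  · exact e1
  · exact e2

theorem exists_graph_HI2 (hm : 0 < mZ) (h : RegularKernel F Ft) : ∃ C : ℝ, 0 ≤ C ∧
    ∀ B ∈ ({HI2 F, (HI2 F).adjoint} : Set (Fock →ₗ.[ℂ] Fock)), ∀ x : (H0 mZ).domain,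
      ∃ w, ((x : Fock), w) ∈ B.graph ∧ ‖w‖ ≤ C * (‖H0 mZ x‖ + ‖(x : Fock)‖) := by
  have hb := exists_isBlock_HI2 h
  obtain ⟨T, hT, h1, h2⟩ := hb
  have e1 : ∀ x : (H0 mZ).domain, ∃ w, ((x : Fock), w) ∈ (HI2 F).graph ∧ ‖w‖ ≤
      √((∫⁻ q : Lepton × Lepton × Boson, ‖Ft q.1 q.2.1 q.2.2‖ₑ ^ 2).toReal * (2 * (1 + mZ⁻¹))) *
        (‖H0 mZ x‖ + ‖(x : Fock)‖) := fun x =>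
    hT.exists_graph (Real.sqrt_nonneg _) fun k => norm_sq_le_of_energy hm le_rfl
      (freeRel_H0 x _ _ _) h.lt_top.ne (h1 k _)
  have hd : Dense ((HI2 F).domain : Set Fock) := dense_domain_H0.mono fun x hx => by
    have := e1 ⟨x, hx⟩
    exact LinearPMap.mem_domain_of_mem_graph this.choose_spec.1
  have e2 : ∀ x : (H0 mZ).domain, ∃ w, ((x : Fock), w) ∈ (HI2 F).adjoint.graph ∧ ‖w‖ ≤
      √((∫⁻ q : Lepton × Lepton × Boson, ‖Ft q.1 q.2.1 q.2.2‖ₑ ^ 2).toReal * (2 * (1 + mZ⁻¹))) *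
        (‖H0 mZ x‖ + ‖(x : Fock)‖) := fun x =>
    hT.exists_adjoint_graph hd (Real.sqrt_nonneg _) fun k =>
      norm_sq_le_of_energy hm (Nat.le_succ k.2.2)
      (freeRel_H0 x _ _ _) h.lt_top.ne (h2 k _)
  refine ⟨√((∫⁻ q : Lepton × Lepton × Boson, ‖Ft q.1 q.2.1 q.2.2‖ₑ ^ 2).toReal *
    (2 * (1 + mZ⁻¹))), Real.sqrt_nonneg _, ?_⟩
  rintro B (rfl | rfl)
  · exact e1
  · exact e2

theorem exists_coupling_of_regularKernel (hm : 0 < mZ) {F₁ Ft₁ F₂ Ft₂ : Lepton → Lepton → Boson → ℂ}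
    (h₁ : RegularKernel F₁ Ft₁) (h₂ : RegularKernel F₂ Ft₂) :
    ∃ g₀ : ℝ, 0 < g₀ ∧ ∀ g : ℝ, 0 ≤ g → g ≤ g₀ →
      (H0 mZ + (g : ℂ) • (HI1 F₁ + HI2 F₂ + (HI1 F₁).adjoint + (HI2 F₂).adjoint)).domain =
        (H0 mZ).domain ∧
      IsSelfAdjoint
        (H0 mZ + (g : ℂ) • (HI1 F₁ + HI2 F₂ + (HI1 F₁).adjoint + (HI2 F₂).adjoint)) := by
  have k1 := exists_graph_HI1 hm h₁
  have k2 := exists_graph_HI2 hm h₂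
  obtain ⟨C₁, hC₁, e1⟩ := k1
  obtain ⟨C₂, hC₂, e2⟩ := k2
  refine exists_coupling isFormalAdjoint_H0 (exists_H0_add_smul Complex.I_re Complex.norm_I)
    (exists_H0_add_smul (by simp) (by simp)) (add_nonneg hC₁ hC₂) ?_
  have l1 : ∀ B ∈ ({HI1 F₁, (HI1 F₁).adjoint} : Set (Fock →ₗ.[ℂ] Fock)), ∀ x : (H0 mZ).domain,
      ∃ w, ((x : Fock), w) ∈ B.graph ∧ ‖w‖ ≤ (C₁ + C₂) * (‖H0 mZ x‖ + ‖(x : Fock)‖) :=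
    fun B hB x => (e1 B hB x).imp fun w hw => ⟨hw.1, hw.2.trans (by gcongr; linarith)⟩
  have l2 : ∀ B ∈ ({HI2 F₂, (HI2 F₂).adjoint} : Set (Fock →ₗ.[ℂ] Fock)), ∀ x : (H0 mZ).domain,
      ∃ w, ((x : Fock), w) ∈ B.graph ∧ ‖w‖ ≤ (C₁ + C₂) * (‖H0 mZ x‖ + ‖(x : Fock)‖) :=
    fun B hB x => (e2 B hB x).imp fun w hw => ⟨hw.1, hw.2.trans (by gcongr; linarith)⟩
  rintro B (rfl | rfl | rfl | rfl)
  · exact l1 _ (Or.inl rfl)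
  · exact l2 _ (Or.inl rfl)
  · exact l1 _ (Or.inr rfl)
  · exact l2 _ (Or.inr rfl)

end RelativeBound

/-! ## Bounds on the spherical waves -/

section SphericalHarmonics

/-- Binomial expansion: the derivative of each power `t^(2i)` is at most the falling factorial for
the top power, and the absolute binomial coefficients sum to `2^l`. -/
theorem abs_eval_iterate_derivative_le (l k : ℕ) {t : ℝ} (ht : |t| ≤ 1) :
    |(Polynomial.derivative^[k] ((Polynomial.X ^ 2 - 1 : Polynomial ℝ) ^ l)).eval t| ≤
      2 ^ l * ((2 * l).descFactorial k : ℝ) := by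
  have h1 : (Polynomial.X ^ 2 - 1 : Polynomial ℝ) ^ l = ∑ i ∈ Finset.range (l + 1),
      Polynomial.C ((-1) ^ (l - i) * (l.choose i : ℝ)) * Polynomial.X ^ (2 * i) := by
    rw [sub_eq_add_neg, add_pow]
    refine Finset.sum_congr rfl fun i _ => ?_
    simp only [map_mul, map_pow, map_neg, map_one, map_natCast, ← pow_mul]
    ring
  rw [h1, Polynomial.iterate_derivative_sum, Polynomial.eval_finsetSum]
  refine (Finset.abs_sum_le_sum_abs _ _).trans ?_
  have h2 : ∀ i ∈ Finset.range (l + 1), |(Polynomial.derivative^[k]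
      (Polynomial.C ((-1) ^ (l - i) * (l.choose i : ℝ)) * Polynomial.X ^ (2 * i))).eval t| ≤
      (l.choose i : ℝ) * ((2 * l).descFactorial k : ℝ) := by
    intro i hi
    have hi' : 2 * i ≤ 2 * l := by have := Finset.mem_range.1 hi; omega
    rw [Polynomial.iterate_derivative_C_mul, Polynomial.iterate_derivative_X_pow_eq_smul]
    simp only [Polynomial.eval_mul, Polynomial.eval_C, Polynomial.eval_smul, Polynomial.eval_pow,
      Polynomial.eval_X, smul_eq_mul, abs_mul, abs_pow, abs_neg, abs_one, one_pow, one_mul,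
      Nat.abs_cast]
    gcongr
    calc _ ≤ ((2 * i).descFactorial k : ℝ) * 1 := by
          gcongr
          exact pow_le_one₀ (abs_nonneg _) ht
      _ ≤ _ := by
          rw [mul_one]
          exact_mod_cast Nat.descFactorial_le _ hi'
  refine (Finset.sum_le_sum h2).trans (le_of_eq ?_)
  rw [← Finset.sum_mul, ← Nat.cast_sum, Nat.sum_range_choose]
  push_cast
  rfl

/-- The central binomial coefficient is the largest: `C(2l, l + m) ≤ C(2l, l)`. -/
theorem factorial_sq_le {l m : ℕ} (h : m ≤ l) :
    l.factorial ^ 2 ≤ (l - m).factorial * (l + m).factorial := by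
  have h1 : (2 * l).choose (l + m) * (l + m).factorial * (l - m).factorial = (2 * l).factorial := by
    have := Nat.choose_mul_factorial_mul_factorial (n := 2 * l) (k := l + m) (by omega)
    rwa [show 2 * l - (l + m) = l - m by omega] at this
  have h2 : l.centralBinom * l.factorial ^ 2 = (2 * l).factorial := by
    have := Nat.choose_mul_factorial_mul_factorial (n := 2 * l) (k := l) (by omega)
    rw [show 2 * l - l = l by omega] at this
    rw [Nat.centralBinom, ← this]
    ring
  have h3 := Nat.choose_le_centralBinom (l + m) l
  have h4 := Nat.centralBinom_pos l
  refine Nat.le_of_mul_le_mul_left ?_ h4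
  rw [h2, ← h1]
  calc _ = (2 * l).choose (l + m) * ((l - m).factorial * (l + m).factorial) := by ring
    _ ≤ _ := Nat.mul_le_mul_right _ h3

/-- The normalization is at most `(l - m)! / l!`, and multiplied by the derivative bound it becomes
the central binomial coefficient, uniformly in `m`. For `m > l` the derivative vanishes, so the
truncated subtraction `l - m` is harmless. -/
theorem sqrt_mul_abs_legendre_le (l m : ℕ) {t : ℝ} (ht : |t| ≤ 1) :
    √(((l - m).factorial : ℝ) / ((l + m).factorial : ℝ)) *
      |(Polynomial.derivative^[m] (legendreP l)).eval t| ≤ 4 ^ l := by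
  have h1 : |(Polynomial.derivative^[m] (legendreP l)).eval t| ≤
      ((2 * l).descFactorial (m + l) : ℝ) / (l.factorial : ℝ) := by
    rw [legendreP, Polynomial.iterate_derivative_C_mul, ← Function.iterate_add_apply,
      Polynomial.eval_mul, Polynomial.eval_C, abs_mul, abs_inv,
      abs_of_nonneg (by positivity : (0 : ℝ) ≤ 2 ^ l * (l.factorial : ℝ))]
    refine (mul_le_mul_of_nonneg_left (abs_eval_iterate_derivative_le l (m + l) ht)
      (by positivity)).trans (le_of_eq ?_)
    field_simp
  rcases lt_or_ge l m with hlm | hlm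
  · have h2 : (2 * l).descFactorial (m + l) = 0 := Nat.descFactorial_of_lt (by omega)
    rw [h2] at h1
    have h3 : |(Polynomial.derivative^[m] (legendreP l)).eval t| = 0 :=
      le_antisymm (by simpa using h1) (abs_nonneg _)
    rw [h3, mul_zero]
    positivity
  · have h2 : ((l - m).factorial : ℝ) * ((2 * l).descFactorial (m + l) : ℝ) =
        (2 * l).factorial := by
      have := Nat.factorial_mul_descFactorial (n := 2 * l) (k := m + l) (by omega)
      rw [show 2 * l - (m + l) = l - m by omega] at this
      exact_mod_cast this
    have h3 : ((2 * l).factorial : ℝ) = (l.centralBinom : ℝ) * (l.factorial : ℝ) ^ 2 := by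
      have := Nat.choose_mul_factorial_mul_factorial (n := 2 * l) (k := l) (by omega)
      rw [show 2 * l - l = l by omega] at this
      rw [Nat.centralBinom, ← this]
      push_cast
      ring
    have h4 : √(((l - m).factorial : ℝ) / ((l + m).factorial : ℝ)) ≤
        ((l - m).factorial : ℝ) / (l.factorial : ℝ) := by
      refine Real.sqrt_le_iff.2 ⟨by positivity, ?_⟩
      have h5 : ((l.factorial : ℝ)) ^ 2 ≤ ((l - m).factorial : ℝ) * ((l + m).factorial : ℝ) := by
        exact_mod_cast factorial_sq_le hlm
      rw [div_pow, div_le_div_iff₀ (by positivity) (by positivity)]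
      calc _ ≤ ((l - m).factorial : ℝ) * (((l - m).factorial : ℝ) * ((l + m).factorial : ℝ)) := by
            gcongr
        _ = _ := by ring
    calc _ ≤ ((l - m).factorial : ℝ) / (l.factorial : ℝ) *
          (((2 * l).descFactorial (m + l) : ℝ) / (l.factorial : ℝ)) := by gcongr
      _ = (((l - m).factorial : ℝ) * ((2 * l).descFactorial (m + l) : ℝ)) /
          (l.factorial : ℝ) ^ 2 := by ring
      _ = l.centralBinom := by
          rw [h2, h3]
          field_simp
      _ ≤ 4 ^ l := by
          rw [Nat.centralBinom]
          have : (2 * l).choose l ≤ 2 ^ (2 * l) := Nat.choose_le_two_pow _ _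
          rw [pow_mul] at this
          exact_mod_cast this

/-- The factor `3^l` dominates `√(2l + 1)` and `4^l` comes from the Legendre part. An exponential
bound is enough because the radial functions decay factorially. -/
theorem norm_sphHarmNat_le (l m : ℕ) (x : R3) : ‖sphHarmNat l m x‖ ≤ 12 ^ l := by
  have hx : ‖x‖ ^ 2 = x 0 ^ 2 + x 1 ^ 2 + x 2 ^ 2 := by
    rw [EuclideanSpace.norm_sq_eq, Fin.sum_univ_three]
    simp
  -- At the origin the quotients are `0` by convention, so the bounds hold there as well.
  have h1 : |x 2 / ‖x‖| ≤ 1 := by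
    rw [abs_div, abs_norm]
    refine div_le_one_of_le₀ (abs_le_of_sq_le_sq ?_ (norm_nonneg _)) (norm_nonneg _)
    nlinarith [sq_nonneg (x 0), sq_nonneg (x 1)]
  have h2 : ‖((x 0 / ‖x‖ : ℝ) : ℂ) + Complex.I * ((x 1 / ‖x‖ : ℝ) : ℂ)‖ ≤ 1 := by
    refine (sq_le_one_iff₀ (norm_nonneg _)).1 ?_
    rw [mul_comm Complex.I, Complex.sq_norm, Complex.normSq_add_mul_I, div_pow, div_pow, ← add_div]
    refine div_le_one_of_le₀ ?_ (by positivity)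
    nlinarith [sq_nonneg (x 2)]
  have h3 : √((2 * l + 1) / (4 * Real.pi)) ≤ 3 ^ l := by
    have h4 : (2 * l + 1 : ℝ) ≤ 3 ^ l := by
      have := one_add_mul_le_pow (a := (2 : ℝ)) (by norm_num) l
      norm_num at this
      linarith
    have h5 : (2 * l + 1 : ℝ) / (4 * Real.pi) ≤ 2 * l + 1 :=
      div_le_self (by positivity) (by nlinarith [Real.pi_gt_three])
    refine Real.sqrt_le_iff.2 ⟨by positivity, (h5.trans h4).trans ?_⟩
    exact le_self_pow₀ (one_le_pow₀ (by norm_num)) two_ne_zero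
  unfold sphHarmNat
  rw [Real.sqrt_mul (by positivity)]
  simp only [norm_mul, norm_pow, norm_neg, norm_one, one_pow, one_mul, Complex.norm_real,
    Real.norm_of_nonneg (Real.sqrt_nonneg _), Complex.ofReal_mul, Real.norm_eq_abs]
  have h6 := sqrt_mul_abs_legendre_le l m h1
  have h7 := pow_le_one₀ (n := m) (norm_nonneg _) h2
  calc _ = √((2 * l + 1) / (4 * Real.pi)) *
        ‖((x 0 / ‖x‖ : ℝ) : ℂ) + Complex.I * ((x 1 / ‖x‖ : ℝ) : ℂ)‖ ^ m *
        (√(((l - m).factorial : ℝ) / ((l + m).factorial : ℝ)) *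
      |(Polynomial.derivative^[m] (legendreP l)).eval (x 2 / ‖x‖)|) := by ring
    _ ≤ 3 ^ l * 1 * 4 ^ l := by gcongr
    _ = 12 ^ l := by rw [mul_one, ← mul_pow]; norm_num

theorem norm_sphHarm_le (l : ℕ) (m : ℤ) (x : R3) : ‖sphHarm l m x‖ ≤ 12 ^ l := by
  unfold sphHarm
  split_ifs
  · exact norm_sphHarmNat_le _ _ _
  · simpa using norm_sphHarmNat_le l m.natAbs x

theorem norm_spinor1_le (c : AngLabel) (x : R3) (i : Fin 2) :
    ‖spinor1 c x i‖ ≤ 12 ^ (c.n + 1) := by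
  have ha : ((c.a : ℕ) : ℝ) ≤ 2 * c.n + 1 := by
    have := c.a.2
    have : (c.a : ℕ) ≤ 2 * c.n + 1 := by omega
    exact_mod_cast this
  have ha' : (0 : ℝ) ≤ ((c.a : ℕ) : ℝ) := Nat.cast_nonneg _
  have hn : (0 : ℝ) ≤ c.n := Nat.cast_nonneg _
  have hs : ∀ {a b : ℝ}, 0 ≤ b → a ≤ b → √(a / b) ≤ 1 := fun hb h =>
    Real.sqrt_le_one.2 (div_le_one_of_le₀ h hb)
  have key : ∀ {a b : ℝ} {l : ℕ} {m : ℤ}, 0 ≤ b → a ≤ b → l ≤ c.n + 1 →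
      √(a / b) * ‖sphHarm l m x‖ ≤ 12 ^ (c.n + 1) := fun hb h hl =>
    calc _ ≤ 1 * 12 ^ _ := mul_le_mul (hs hb h) (norm_sphHarm_le _ _ _) (norm_nonneg _) zero_le_one
      _ ≤ _ := by rw [one_mul]; exact pow_le_pow_right₀ (by norm_num) hl
  unfold spinor1
  split_ifs <;> fin_cases i <;>
    simp only [Fin.zero_eta, Fin.mk_one, Matrix.cons_val_zero, Matrix.cons_val_one,
      Matrix.cons_val_fin_one, norm_mul, norm_neg,
      Complex.norm_real, Real.norm_of_nonneg (Real.sqrt_nonneg _)] <;>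
    refine key ?_ ?_ (by omega) <;> simp only [AngLabel.mj, AngLabel.j] <;> linarith

end SphericalHarmonics

/-! ### Radial functions and the size of the spherical waves -/

section Radial

theorem abs_integral_radial_le (n : ℕ) {s : ℝ → ℝ} (hs : ∀ u, |s u| ≤ 1) :
    |∫ u in (0 : ℝ)..1, s u * u ^ (n + 1) * (1 - u) ^ n| ≤ 1 := by
  have h := intervalIntegral.norm_integral_le_of_norm_le_const (a := (0 : ℝ)) (b := 1) (C := 1)
    (f := fun u => s u * u ^ (n + 1) * (1 - u) ^ n) fun u hu => by
      rw [Set.uIoc_of_le zero_le_one] at hu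
      rw [Real.norm_eq_abs, abs_mul, abs_mul, abs_pow, abs_pow]
      have h1 : |u| ≤ 1 := abs_le.2 ⟨by linarith [hu.1], hu.2⟩
      have h2 : |1 - u| ≤ 1 := abs_le.2 ⟨by linarith [hu.2], by linarith [hu.1]⟩
      exact mul_le_one₀ (mul_le_one₀ (hs u) (by positivity) (pow_le_one₀ (abs_nonneg _) h1))
        (by positivity) (pow_le_one₀ (abs_nonneg _) h2)
  simpa using h

/-- One factor `p` is kept explicit while the other momenta and radii are replaced by their maximal
values: it provides the decay at small momentum, and the `n!` provides summability over angular
momenta. -/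
theorem abs_radial_le (n : ℕ) {p r P L J : ℝ} (hp : 0 ≤ p) (hpP : p ≤ P) (hr : 0 ≤ r) (hrL : r ≤ L)
    (hJ : |J| ≤ 1) :
    |-(p / √Real.pi) * ((2 * p * r) ^ n / (n.factorial : ℝ)) * (2 * J)| ≤
      p * (2 * ((2 * P * L) ^ n / (n.factorial : ℝ))) := by
  have h1 : (1 : ℝ) ≤ √Real.pi := Real.one_le_sqrt.2 (by linarith [Real.pi_gt_three])
  rw [abs_mul, abs_mul, abs_neg, abs_of_nonneg (by positivity : 0 ≤ p / √Real.pi),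
    abs_of_nonneg (by positivity : 0 ≤ (2 * p * r) ^ n / (n.factorial : ℝ)), abs_mul]
  have h2 : p / √Real.pi ≤ p := div_le_self hp h1
  have hP : 0 ≤ P := hp.trans hpP
  have hL : 0 ≤ L := hr.trans hrL
  calc _ ≤ p * ((2 * P * L) ^ n / (n.factorial : ℝ)) * (2 * 1) := by
        rw [abs_of_nonneg (zero_le_two : (0 : ℝ) ≤ 2)]
        gcongr
    _ = _ := by ring

variable {c : AngLabel} {p r P L : ℝ}

theorem abs_gRad_le (hp : 0 ≤ p) (hpP : p ≤ P) (hr : 0 ≤ r) (hrL : r ≤ L) :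
    |gRad c p r| ≤ p * (2 * ((2 * P * L) ^ c.n / (c.n.factorial : ℝ))) := by
  unfold gRad
  split_ifs
  · exact abs_radial_le _ hp hpP hr hrL (abs_integral_radial_le _ fun u => Real.abs_sin_le_one _)
  · rw [abs_neg]
    exact abs_radial_le _ hp hpP hr hrL (abs_integral_radial_le _ fun u => Real.abs_cos_le_one _)

theorem abs_fRad_le (hp : 0 ≤ p) (hpP : p ≤ P) (hr : 0 ≤ r) (hrL : r ≤ L) :
    |fRad c p r| ≤ p * (2 * ((2 * P * L) ^ c.n / (c.n.factorial : ℝ))) := by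
  unfold fRad
  split_ifs
  · exact abs_radial_le _ hp hpP hr hrL (abs_integral_radial_le _ fun u => Real.abs_cos_le_one _)
  · exact abs_radial_le _ hp hpP hr hrL (abs_integral_radial_le _ fun u => Real.abs_sin_le_one _)

/-- The decay of the spherical waves in the angular momentum, for bounded momentum and radius. -/
def waveBound (P L : ℝ) (n : ℕ) : ℝ := 24 * ((24 * P * L) ^ n / (n.factorial : ℝ))

theorem norm_assemble_le {g f B : ℝ} (hg : |g| ≤ B) (hf : |f| ≤ B) (x : R3) (i : Fin 4) :
    ‖assemble c g f x i‖ ≤ B * 12 ^ (c.n + 1) := by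
  have h1 := norm_spinor1_le c x
  have h2 : ∀ i, ‖spinor2 c x i‖ ≤ 12 ^ (c.n + 1) := norm_spinor1_le ⟨c.n, c.a, !c.s⟩ x
  have hB : 0 ≤ B := (abs_nonneg _).trans hg
  unfold assemble
  fin_cases i <;> simp only [Fin.zero_eta, Fin.mk_one, Fin.reduceFinMk, Matrix.cons_val,
      norm_mul, norm_neg, Complex.norm_I,
      one_mul, Complex.norm_real, Real.norm_eq_abs] <;>
    first
    | exact mul_le_mul hg (h1 _) (norm_nonneg _) hB
    | exact mul_le_mul hf (h2 _) (norm_nonneg _) hB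

/-- The bound `12^(n+1)` on the spinors turns the radial constants `2` and `2PL` into `24` and
`24PL`. -/
theorem bound_mul_pow (p P L : ℝ) (n : ℕ) :
    p * (2 * ((2 * P * L) ^ n / (n.factorial : ℝ))) * 12 ^ (n + 1) = p * waveBound P L n := by
  have : (24 * P * L) ^ n = (2 * P * L) ^ n * 12 ^ n := by rw [← mul_pow]; ring
  rw [waveBound, this, pow_succ]
  ring

theorem norm_psiPlus_le {ξ : Lepton} {x : R3} (hp : (ξ.1 : ℝ) ≤ P) (hx : ‖x‖ ≤ L) (i : Fin 4) :
    ‖psiPlus ξ x i‖ ≤ ξ.1 * waveBound P L ξ.2.n := by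
  rw [← bound_mul_pow]
  exact norm_assemble_le (abs_gRad_le (NNReal.coe_nonneg _) hp (norm_nonneg _) hx)
    (abs_fRad_le (NNReal.coe_nonneg _) hp (norm_nonneg _) hx) x i

theorem norm_psiMinusTilde_le {ξ : Lepton} {x : R3} (hp : (ξ.1 : ℝ) ≤ P) (hx : ‖x‖ ≤ L)
    (i : Fin 4) : ‖psiMinusTilde ξ x i‖ ≤ ξ.1 * waveBound P L ξ.2.n := by
  rw [← bound_mul_pow]
  exact norm_assemble_le (c := ξ.2.neg) (abs_gRad_le (NNReal.coe_nonneg _) hp (norm_nonneg _) hx)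
    (by rw [abs_neg]; exact abs_fRad_le (NNReal.coe_nonneg _) hp (norm_nonneg _) hx) x i

end Radial

/-! ## Measurability of the spherical waves -/

section Measurability

theorem measurable_sphHarmNat (l m : ℕ) : Measurable (sphHarmNat l m) := by
  unfold sphHarmNat
  have h1 : Measurable fun x : R3 =>
      (Polynomial.derivative^[m] (legendreP l)).eval (x 2 / ‖x‖) :=
    (Polynomial.continuous _).measurable.comp (by fun_prop)
  fun_prop

theorem measurable_sphHarm (l : ℕ) (m : ℤ) : Measurable (sphHarm l m) := by
  unfold sphHarm
  have := measurable_sphHarmNat l m.natAbs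
  split_ifs
  · exact this
  · exact measurable_const.mul (Complex.continuous_conj.measurable.comp this)

theorem measurable_spinor1 (c : AngLabel) (i : Fin 2) : Measurable fun x => spinor1 c x i := by
  have := measurable_sphHarm
  unfold spinor1
  split_ifs <;> fin_cases i <;> simp only [Fin.zero_eta, Fin.mk_one, Matrix.cons_val_zero,
    Matrix.cons_val_one, Matrix.cons_val_fin_one] <;> fun_prop

theorem continuous_radial (n : ℕ) {s : ℝ → ℝ} (hs : Continuous s) :
    Continuous fun q : ℝ × ℝ => -(q.1 / √Real.pi) * ((2 * q.1 * q.2) ^ n / (n.factorial : ℝ)) *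
      (2 * ∫ u in (0 : ℝ)..1, s (q.1 * q.2 * (2 * u - 1)) * u ^ (n + 1) * (1 - u) ^ n) := by
  have h : Continuous fun q : ℝ × ℝ =>
      ∫ u in (0 : ℝ)..1, s (q.1 * q.2 * (2 * u - 1)) * u ^ (n + 1) * (1 - u) ^ n :=
    intervalIntegral.continuous_parametric_intervalIntegral_of_continuous' (by fun_prop) _ _
  fun_prop

theorem continuous_gRad (c : AngLabel) : Continuous fun q : ℝ × ℝ => gRad c q.1 q.2 := by
  unfold gRad
  split_ifs
  · exact continuous_radial c.n Real.continuous_sin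
  · exact (continuous_radial c.n Real.continuous_cos).neg

theorem continuous_fRad (c : AngLabel) : Continuous fun q : ℝ × ℝ => fRad c q.1 q.2 := by
  unfold fRad
  split_ifs
  · exact continuous_radial c.n Real.continuous_cos
  · exact continuous_radial c.n Real.continuous_sin

theorem measurable_assemble {X : Type*} [MeasurableSpace X] (c : AngLabel) {g f : X → ℝ}
    {x : X → R3} (hg : Measurable g) (hf : Measurable f) (hx : Measurable x) (i : Fin 4) :
    Measurable fun q => assemble c (g q) (f q) (x q) i := by
  have h1 : ∀ i, Measurable fun q => spinor1 c (x q) i := fun i => (measurable_spinor1 c i).comp hx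
  have h2 : ∀ i, Measurable fun q => spinor2 c (x q) i := fun i =>
    (measurable_spinor1 ⟨c.n, c.a, !c.s⟩ i).comp hx
  unfold assemble
  fin_cases i <;> simp only [Fin.zero_eta, Fin.mk_one, Fin.reduceFinMk, Matrix.cons_val] <;> fun_prop

/-- The label ranges over a countable discrete space, so joint measurability may be checked for each
label separately. -/
theorem measurable_of_angLabel {φ : AngLabel → ℝ≥0 × R3 → ℂ} (h : ∀ c, Measurable (φ c)) :
    Measurable fun q : Lepton × R3 => φ q.1.2 (q.1.1, q.2) := by
  have h1 : Measurable fun q : (ℝ≥0 × R3) × AngLabel => φ q.2 q.1 :=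
    measurable_from_prod_countable_left h
  have h2 : Measurable fun q : Lepton × R3 => ((q.1.1, q.2), q.1.2) := by fun_prop
  exact h1.comp h2

theorem measurable_gRad (c : AngLabel) : Measurable fun q : ℝ≥0 × R3 => gRad c q.1 ‖q.2‖ := by
  have h : Measurable fun q : ℝ≥0 × R3 => ((q.1 : ℝ), ‖q.2‖) := by fun_prop
  exact (continuous_gRad c).measurable.comp h

theorem measurable_fRad (c : AngLabel) : Measurable fun q : ℝ≥0 × R3 => fRad c q.1 ‖q.2‖ := by
  have h : Measurable fun q : ℝ≥0 × R3 => ((q.1 : ℝ), ‖q.2‖) := by fun_prop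
  exact (continuous_fRad c).measurable.comp h

theorem measurable_psiPlus (i : Fin 4) : Measurable fun q : Lepton × R3 => psiPlus q.1 q.2 i :=
  measurable_of_angLabel (φ := fun c q => assemble c (gRad c q.1 ‖q.2‖) (fRad c q.1 ‖q.2‖) q.2 i)
    fun c => measurable_assemble c (measurable_gRad c) (measurable_fRad c) measurable_snd i

theorem measurable_psiMinusTilde (i : Fin 4) :
    Measurable fun q : Lepton × R3 => psiMinusTilde q.1 q.2 i :=
  measurable_of_angLabel (φ := fun c q => assemble c.neg (gRad c.neg q.1 ‖q.2‖)
    (-fRad c.neg q.1 ‖q.2‖) q.2 i) fun c => measurable_assemble c.neg (measurable_gRad _)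
      (measurable_fRad _).neg measurable_snd i

theorem measurable_current {e : Fin 4 → Boson → ℂ} (he : ∀ μ, Measurable (e μ)) :
    Measurable fun q : (Lepton × Lepton × Boson) × R3 =>
      current q.1.1 q.1.2.1 q.2 (fun μ => e μ q.1.2.2) := by
  have m1 : Measurable fun q : (Lepton × Lepton × Boson) × R3 => (q.1.1, q.2) := by fun_prop
  have m2 : Measurable fun q : (Lepton × Lepton × Boson) × R3 => (q.1.2.1, q.2) := by fun_prop
  have h1 : ∀ i, Measurable fun q : (Lepton × Lepton × Boson) × R3 =>
      star (psiPlus q.1.1 q.2 i) := fun i => by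
    have h := (measurable_psiPlus i).comp m1
    exact Complex.continuous_conj.measurable.comp h
  have h2 : ∀ i, Measurable fun q : (Lepton × Lepton × Boson) × R3 =>
      psiMinusTilde q.1.2.1 q.2 i := fun i => by
    have h := (measurable_psiMinusTilde i).comp m2
    exact h
  have h3 : ∀ μ, Measurable fun q : (Lepton × Lepton × Boson) × R3 => e μ q.1.2.2 := fun μ =>
    (he μ).comp measurable_fst.snd.snd
  simp only [current, dotProduct, Matrix.mulVec, Pi.star_apply]
  refine Finset.measurable_sum _ fun μ _ => Measurable.mul ?_ (h3 μ)
  refine Finset.measurable_sum _ fun i _ => (h1 i).mul ?_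
  exact Finset.measurable_sum _ fun j _ => (h2 j).const_mul _

end Measurability

/-! ## The kernels -/

section Kernel

/-- The common form of the two kernels. -/
def currentKernel (f : ℝ → ℂ) (e : Fin 4 → Boson → ℂ) (z : ℂ) (ξ₁ ξ₂ : Lepton) (ξ₃ : Boson) : ℂ :=
  ∫ x : R3, f ‖x‖ * current ξ₁ ξ₂ x (fun μ => e μ ξ₃) * Complex.exp (z * (inner ℝ ξ₃.1 x : ℝ))

theorem measurable_currentKernel {f : ℝ → ℂ} (hf : ContinuousOn f (Set.Ici 0))
    {e : Fin 4 → Boson → ℂ} (he : ∀ μ, Measurable (e μ)) (z : ℂ) :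
    Measurable fun q : Lepton × Lepton × Boson => currentKernel f e z q.1 q.2.1 q.2.2 := by
  have h1 : Continuous fun x : R3 => f ‖x‖ :=
    hf.comp_continuous continuous_norm fun x => norm_nonneg x
  have h2 : Measurable fun q : (Lepton × Lepton × Boson) × R3 =>
      f ‖q.2‖ * current q.1.1 q.1.2.1 q.2 (fun μ => e μ q.1.2.2) *
        Complex.exp (z * (inner ℝ q.1.2.2.1 q.2 : ℝ)) := by
    refine ((h1.measurable.comp measurable_snd).mul (measurable_current he)).mul ?_
    have h3 : Measurable fun q : (Lepton × Lepton × Boson) × R3 => (inner ℝ q.1.2.2.1 q.2 : ℝ) :=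
      Measurable.inner (measurable_fst.snd.snd.fst) measurable_snd
    fun_prop
  exact h2.stronglyMeasurable.integral_prod_right'.measurable

theorem exists_norm_current_le : ∃ W : ℝ, 0 ≤ W ∧ ∀ (ξ₁ ξ₂ : Lepton) (x : R3) (e : Fin 4 → ℂ)
    (A B D : ℝ), (∀ i, ‖psiPlus ξ₁ x i‖ ≤ A) → (∀ i, ‖psiMinusTilde ξ₂ x i‖ ≤ B) →
      (∀ μ, ‖e μ‖ ≤ D) → ‖current ξ₁ ξ₂ x e‖ ≤ W * D * A * B := by
  -- Expanding every contraction reduces the bound to the triangle inequality, with the sum of all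
  -- matrix entries as constant.
  refine ⟨∑ μ, ∑ i, ∑ j, ‖(gammaM 0 * gammaM μ * (1 - gamma5)) i j‖,
    Finset.sum_nonneg fun _ _ => Finset.sum_nonneg fun _ _ => Finset.sum_nonneg fun _ _ =>
      norm_nonneg _, fun ξ₁ ξ₂ x e A B D hA hB hD => ?_⟩
  have hA0 : 0 ≤ A := (norm_nonneg _).trans (hA 0)
  have hB0 : 0 ≤ B := (norm_nonneg _).trans (hB 0)
  simp only [current, dotProduct, Matrix.mulVec, Pi.star_apply, Finset.sum_mul, Finset.mul_sum]
  refine (norm_sum_le _ _).trans (Finset.sum_le_sum fun μ _ => ?_)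
  refine (norm_sum_le _ _).trans (Finset.sum_le_sum fun i _ => ?_)
  refine (norm_sum_le _ _).trans (Finset.sum_le_sum fun j _ => ?_)
  simp only [norm_mul, norm_star]
  calc _ ≤ A * (‖(gammaM 0 * gammaM μ * (1 - gamma5)) i j‖ * B) * D := by
        gcongr
        · exact hA i
        · exact hB j
        · exact hD μ
    _ = _ := by ring

/-- The cutoff restricts the integral to a ball and the phase has modulus one, so the kernel
inherits the bounds of the two waves: a momentum factor and factorial decay for each lepton. -/
theorem exists_norm_currentKernel_le {f : ℝ → ℂ} (hf : ContinuousOn f (Set.Ici 0)) {L : ℝ}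
    (hL : 0 < L) (hfL : ∀ r, L < r → f r = 0) {e : Fin 4 → Boson → ℂ} {R D : ℝ}
    (he : ∀ μ (ξ : Boson), ‖ξ.1‖ ≤ R → ‖e μ ξ‖ ≤ D) {z : ℂ} (hz : z.re = 0) (P : ℝ) :
    ∃ C : ℝ, ∀ (ξ₁ ξ₂ : Lepton) (ξ₃ : Boson), (ξ₁.1 : ℝ) ≤ P → (ξ₂.1 : ℝ) ≤ P → ‖ξ₃.1‖ ≤ R →
      ‖currentKernel f e z ξ₁ ξ₂ ξ₃‖ ≤
        C * (ξ₁.1 * waveBound P L ξ₁.2.n) * (ξ₂.1 * waveBound P L ξ₂.2.n) := by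
  obtain ⟨W, hW, hcur⟩ := exists_norm_current_le
  obtain ⟨N, hN⟩ := (isCompact_Icc (a := (0 : ℝ)) (b := L)).exists_bound_of_continuousOn
    (hf.mono Set.Icc_subset_Ici_self)
  have hN0 : 0 ≤ N := (norm_nonneg _).trans (hN 0 ⟨le_rfl, hL.le⟩)
  refine ⟨N * (W * D) * volume.real (Metric.closedBall (0 : R3) L), fun ξ₁ ξ₂ ξ₃ h1 h2 h3 => ?_⟩
  have h0 : ∀ x ∉ Metric.closedBall (0 : R3) L, f ‖x‖ * current ξ₁ ξ₂ x (fun μ => e μ ξ₃) *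
      Complex.exp (z * (inner ℝ ξ₃.1 x : ℝ)) = 0 := fun x hx => by
    rw [mem_closedBall_zero_iff, not_le] at hx
    rw [hfL _ hx, zero_mul, zero_mul]
  rw [currentKernel, ← setIntegral_eq_integral_of_forall_compl_eq_zero h0]
  refine (norm_setIntegral_le_of_norm_le_const (C := N * (W * D * (ξ₁.1 * waveBound P L ξ₁.2.n) *
    (ξ₂.1 * waveBound P L ξ₂.2.n))) measure_closedBall_lt_top fun x hx => ?_).trans
    (le_of_eq (by ring))
  rw [mem_closedBall_zero_iff] at hx
  have h4 : ‖Complex.exp (z * (inner ℝ ξ₃.1 x : ℝ))‖ = 1 := by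
    rw [Complex.norm_exp]
    simp [hz]
  rw [norm_mul, norm_mul, h4, mul_one]
  exact mul_le_mul (hN _ ⟨norm_nonneg _, hx⟩) (hcur ξ₁ ξ₂ x _ _ _ _
    (norm_psiPlus_le h1 hx) (norm_psiMinusTilde_le h2 hx) fun μ => he μ ξ₃ h3) (norm_nonneg _) hN0

end Kernel

/-! ## Polarization vectors -/

/-- Transversality and Cauchy–Schwarz give `ω₃² |ε₀|² ≤ |k|² ∑ |εᵢ|²`, and normalization gives `∑
|εᵢ|² = 1 + |ε₀|²`. Since `ω₃² = |k|² + mZ²`, this leaves `mZ² |ε₀|² ≤ |k|²`, which in turn bounds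
the spatial components. -/
theorem IsPolarization.norm_le {mZ : ℝ} (hm : 0 < mZ) {ε : Fin 4 → Boson → ℂ}
    (hε : IsPolarization mZ ε) (μ : Fin 4) (ξ : Boson) :
    ‖ε μ ξ‖ ^ 2 ≤ 1 + (‖ξ.1‖ / mZ) ^ 2 := by
  obtain ⟨k, l⟩ := ξ
  have hω : omega3 mZ k ^ 2 = ‖k‖ ^ 2 + mZ ^ 2 := Real.sq_sqrt (by positivity)
  have hω0 : 0 ≤ omega3 mZ k := Real.sqrt_nonneg _
  have h1 : ∑ i : Fin 3, ‖ε i.succ (k, l)‖ ^ 2 - ‖ε 0 (k, l)‖ ^ 2 = 1 := by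
    have h := hε.orthonormal k l l
    simp only [if_true, Complex.conj_mul'] at h
    exact_mod_cast h
  have h2 : omega3 mZ k * ‖ε 0 (k, l)‖ ≤ ∑ i : Fin 3, |k i| * ‖ε i.succ (k, l)‖ := by
    have h := hε.transversal k l
    have h3 : (omega3 mZ k : ℂ) * ε 0 (k, l) = -∑ i : Fin 3, (k i : ℂ) * ε i.succ (k, l) :=
      eq_neg_of_add_eq_zero_left h
    have h4 := congrArg norm h3
    rw [norm_mul, norm_neg, Complex.norm_real, Real.norm_of_nonneg hω0] at h4
    rw [h4]
    refine (norm_sum_le _ _).trans (le_of_eq ?_)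
    simp
  have h5 : (∑ i : Fin 3, |k i| * ‖ε i.succ (k, l)‖) ^ 2 ≤
      ‖k‖ ^ 2 * ∑ i : Fin 3, ‖ε i.succ (k, l)‖ ^ 2 := by
    refine (Finset.sum_mul_sq_le_sq_mul_sq _ _ _).trans (le_of_eq ?_)
    simp [EuclideanSpace.norm_sq_eq]
  have h6 : (omega3 mZ k * ‖ε 0 (k, l)‖) ^ 2 ≤
      ‖k‖ ^ 2 * ∑ i : Fin 3, ‖ε i.succ (k, l)‖ ^ 2 :=
    (pow_le_pow_left₀ (mul_nonneg hω0 (norm_nonneg _)) h2 2).trans h5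
  have h7 : ∑ i : Fin 3, ‖ε i.succ (k, l)‖ ^ 2 = 1 + ‖ε 0 (k, l)‖ ^ 2 := by linarith
  rw [mul_pow, hω, h7] at h6
  have h8 : ‖ε 0 (k, l)‖ ^ 2 ≤ (‖k‖ / mZ) ^ 2 := by
    rw [div_pow, le_div_iff₀ (by positivity)]
    nlinarith
  refine Fin.cases ?_ (fun i => ?_) μ
  · linarith
  · have := Finset.single_le_sum (f := fun i : Fin 3 => ‖ε i.succ (k, l)‖ ^ 2)
      (fun i _ => by positivity) (Finset.mem_univ i)
    linarith

theorem norm_polarization_div_le {mZ R : ℝ} (hm : 0 < mZ) {ε : Fin 4 → Boson → ℂ}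
    (hε : IsPolarization mZ ε) (μ : Fin 4) (ξ : Boson) (hξ : ‖ξ.1‖ ≤ R) :
    ‖ε μ ξ‖ / ‖(√(2 * omega3 mZ ξ.1) : ℂ)‖ ≤ √(1 + (R / mZ) ^ 2) / √(2 * mZ) := by
  have h1 : ‖ε μ ξ‖ ≤ √(1 + (R / mZ) ^ 2) := by
    refine Real.le_sqrt_of_sq_le ((hε.norm_le hm μ ξ).trans ?_)
    gcongr
  have h2 : mZ ≤ omega3 mZ ξ.1 := Real.le_sqrt_of_sq_le (by nlinarith [sq_nonneg ‖ξ.1‖])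
  rw [Complex.norm_real, Real.norm_of_nonneg (Real.sqrt_nonneg _)]
  gcongr

/-! ## Regularity of the kernels -/

section Regularity

/-- The factor `(2n+2)·2` counts the labels with `j = n + 1/2`. With `n + 1 ≤ 2^n` and `(n!)² ≥ n!`
the series is dominated by an exponential series. -/
theorem summable_waveBound (P L : ℝ) :
    Summable fun n : ℕ => ((2 * n + 2) * 2 : ℝ) * waveBound P L n ^ 2 := by
  refine Summable.of_nonneg_of_le (fun n => by positivity) (fun n => ?_)
    ((Real.summable_pow_div_factorial (2 * (24 * P * L) ^ 2)).mul_left (4 * 24 ^ 2))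
  have h1 : (n : ℝ) + 1 ≤ 2 ^ n := by
    have := one_add_mul_le_pow (a := (1 : ℝ)) (by norm_num) n
    norm_num at this
    linarith
  have h2 : ((n.factorial : ℝ) ^ 2)⁻¹ ≤ (n.factorial : ℝ)⁻¹ := by
    have h3 : (1 : ℝ) ≤ n.factorial := by exact_mod_cast n.factorial_pos
    gcongr
    exact le_self_pow₀ h3 two_ne_zero
  calc ((2 * n + 2) * 2 : ℝ) * waveBound P L n ^ 2
      = 4 * 24 ^ 2 * (((n : ℝ) + 1) * ((24 * P * L) ^ 2) ^ n * ((n.factorial : ℝ) ^ 2)⁻¹) := by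
        rw [waveBound, ← pow_mul, mul_comm 2 n, pow_mul]
        ring
    _ ≤ 4 * 24 ^ 2 * (2 ^ n * ((24 * P * L) ^ 2) ^ n * (n.factorial : ℝ)⁻¹) := by gcongr
    _ = _ := by
        rw [mul_pow 2 ((24 * P * L) ^ 2) n]
        generalize ((24 * P * L) ^ 2) ^ n = y
        ring

theorem lintegral_angLabel_lt_top {β : ℕ → ℝ}
    (hβ : Summable fun n : ℕ => ((2 * n + 2) * 2 : ℝ) * β n ^ 2) :
    ∫⁻ c : AngLabel, ENNReal.ofReal (β c.n ^ 2) < ⊤ := by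
  have h1 : ∫⁻ c : AngLabel, ENNReal.ofReal (β c.n ^ 2) =
      ∑' c : AngLabel, ENNReal.ofReal (β c.n ^ 2) := lintegral_count _
  have h2 : ∑' c : AngLabel, ENNReal.ofReal (β c.n ^ 2) =
      ∑' n : ℕ, ENNReal.ofReal (((2 * n + 2) * 2 : ℝ) * β n ^ 2) := by
    rw [← AngLabel.equivSigma.symm.tsum_eq fun c : AngLabel => ENNReal.ofReal (β c.n ^ 2),
      ENNReal.tsum_sigma']
    refine tsum_congr fun n => ?_
    have h3 : ∀ b : Fin (2 * n + 2) × Bool,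
        ENNReal.ofReal (β (AngLabel.equivSigma.symm ⟨n, b⟩).n ^ 2) = ENNReal.ofReal (β n ^ 2) :=
      fun b => rfl
    simp only [h3, tsum_fintype, Finset.sum_const, Finset.card_univ, Fintype.card_prod,
      Fintype.card_fin, Fintype.card_bool, nsmul_eq_mul]
    rw [ENNReal.ofReal_mul (by positivity), ← ENNReal.ofReal_natCast]
    push_cast
    rfl
  rw [h1, h2]
  exact hβ.tsum_ofReal_lt_top

theorem volume_momentum_lt_top (P : ℝ) : volume {p : ℝ≥0 | (p : ℝ) ≤ P} < ⊤ := by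
  have h : MeasurableEmbedding ((↑) : ℝ≥0 → ℝ) :=
    MeasurableEmbedding.subtype_coe measurableSet_Ici
  change Measure.comap ((↑) : ℝ≥0 → ℝ) volume _ < ⊤
  rw [h.comap_apply]
  refine (measure_mono ?_).trans_lt (measure_Icc_lt_top (a := (0 : ℝ)) (b := P))
  rintro _ ⟨p, hp, rfl⟩
  exact ⟨p.2, hp⟩

/-- The kernel is dominated by a product of functions of the single variables. On bounded momenta
each factor is square integrable: the lepton factor by the summability of `β`, the boson factor
because it is constant on a ball. -/
theorem exists_regularKernel {h G : Lepton → Lepton → Boson → ℂ}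
    (hh : Measurable fun q : Lepton × Lepton × Boson => h q.1 q.2.1 q.2.2)
    (hG : AEStronglyMeasurable (fun q : Lepton × Lepton × Boson => G q.1 q.2.1 q.2.2) volume)
    {M P R C : ℝ} (hP : 0 ≤ P) (hM : ∀ ξ₁ ξ₂ ξ₃, ‖G ξ₁ ξ₂ ξ₃‖ ≤ M)
    (hsupp : ∀ (ξ₁ ξ₂ : Lepton) (ξ₃ : Boson), G ξ₁ ξ₂ ξ₃ ≠ 0 →
      (ξ₁.1 : ℝ) ≤ P ∧ (ξ₂.1 : ℝ) ≤ P ∧ ‖ξ₃.1‖ ≤ R)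
    {β : ℕ → ℝ} (hβ : Summable fun n : ℕ => ((2 * n + 2) * 2 : ℝ) * β n ^ 2)
    (hb : ∀ (ξ₁ ξ₂ : Lepton) (ξ₃ : Boson), (ξ₁.1 : ℝ) ≤ P → (ξ₂.1 : ℝ) ≤ P → ‖ξ₃.1‖ ≤ R →
      ‖h ξ₁ ξ₂ ξ₃‖ ≤ C * (ξ₁.1 * β ξ₁.2.n) * (ξ₂.1 * β ξ₂.2.n)) :
    ∃ F Ft, RegularKernel F Ft ∧ ∀ᵐ q : Lepton × Lepton × Boson,
      h q.1 q.2.1 q.2.2 * G q.1 q.2.1 q.2.2 = F q.1 q.2.1 q.2.2 := by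
  classical
  obtain ⟨G', hG'm, hG'e⟩ := hG
  -- The measurable version `G'` agrees with `G` only almost everywhere, so its support and its
  -- bound are enforced by truncation.
  let S : Set (Lepton × Lepton × Boson) :=
    {q | (q.1.1 : ℝ) ≤ P ∧ (q.2.1.1 : ℝ) ≤ P ∧ ‖q.2.2.1‖ ≤ R ∧ ‖G' q‖ ≤ M}
  have hS : MeasurableSet S := by
    have a1 : MeasurableSet {q : Lepton × Lepton × Boson | (q.1.1 : ℝ) ≤ P} :=
      measurableSet_le (by fun_prop) measurable_const
    have a2 : MeasurableSet {q : Lepton × Lepton × Boson | (q.2.1.1 : ℝ) ≤ P} :=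
      measurableSet_le (by fun_prop) measurable_const
    have a3 : MeasurableSet {q : Lepton × Lepton × Boson | ‖q.2.2.1‖ ≤ R} :=
      measurableSet_le (by fun_prop) measurable_const
    have a4 : MeasurableSet {q : Lepton × Lepton × Boson | ‖G' q‖ ≤ M} :=
      measurableSet_le hG'm.measurable.norm measurable_const
    exact a1.inter (a2.inter (a3.inter a4))
  let u : Lepton → ℝ := fun ξ => if (ξ.1 : ℝ) ≤ P then β ξ.2.n else 0
  -- The factor `(1 + P)²` pays, after squaring, for extracting `p₁ / (1 + p₁)` from `p₁² p₂²`.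
  let v : Boson → ℝ := fun ξ => if ‖ξ.1‖ ≤ R then C * M * (1 + P) ^ 2 else 0
  have hu : Measurable u := by
    have h1 : Measurable β := measurable_from_nat
    have h2 : Measurable AngLabel.n := measurable_of_countable _
    exact Measurable.ite (measurableSet_le (by fun_prop) measurable_const) (by fun_prop)
      measurable_const
  have hv : Measurable v :=
    Measurable.ite (measurableSet_le (by fun_prop) measurable_const) measurable_const
      measurable_const
  refine ⟨fun ξ₁ ξ₂ ξ₃ => S.indicator (fun q => h q.1 q.2.1 q.2.2 * G' q) (ξ₁, ξ₂, ξ₃),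
    fun ξ₁ ξ₂ ξ₃ => ((u ξ₁ * (u ξ₂ * v ξ₃) : ℝ) : ℂ),
    ⟨(hh.mul hG'm.measurable).indicator hS, by fun_prop, fun ξ₁ ξ₂ ξ₃ => ?_, ?_⟩, ?_⟩
  · by_cases hq : (ξ₁, ξ₂, ξ₃) ∈ S
    · rw [Set.indicator_of_mem hq]
      obtain ⟨h1, h2, h3, h4⟩ := hq
      simp only at h1 h2 h3 h4
      have hp1 : (0 : ℝ) ≤ ξ₁.1 := NNReal.coe_nonneg _
      have hp2 : (0 : ℝ) ≤ ξ₂.1 := NNReal.coe_nonneg _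
      have e1 : ((ξ₁.1 : ENNReal) * (1 + (ξ₁.1 : ENNReal))⁻¹) =
          ENNReal.ofReal ((ξ₁.1 : ℝ) * (1 + (ξ₁.1 : ℝ))⁻¹) := by
        rw [ENNReal.ofReal_mul hp1, ENNReal.ofReal_inv_of_pos (by positivity),
          ENNReal.ofReal_add zero_le_one hp1]
        simp
      rw [e1, ← ofReal_norm, ← ofReal_norm, ← ENNReal.ofReal_pow (norm_nonneg _),
        ← ENNReal.ofReal_pow (norm_nonneg _), ← ENNReal.ofReal_mul (by positivity)]
      refine ENNReal.ofReal_le_ofReal ?_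
      rw [Complex.norm_real, Real.norm_eq_abs, sq_abs, norm_mul]
      simp only [u, v, if_pos h1, if_pos h2, if_pos h3]
      have h5 := hb ξ₁ ξ₂ ξ₃ h1 h2 h3
      have h6 : ‖h ξ₁ ξ₂ ξ₃‖ * ‖G' (ξ₁, ξ₂, ξ₃)‖ ≤
          C * (ξ₁.1 * β ξ₁.2.n) * (ξ₂.1 * β ξ₂.2.n) * M :=
        mul_le_mul h5 h4 (norm_nonneg _) ((norm_nonneg _).trans h5)
      refine (pow_le_pow_left₀ (by positivity) h6 2).trans ?_
      -- What remains of `p₁² p₂²` after division by `p₁ / (1 + p₁)`. The division is possible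
      -- because the squared kernel vanishes quadratically in `p₁`, while only linear decay is
      -- needed.
      have h7 : (1 + (ξ₁.1 : ℝ)) * ξ₁.1 * (ξ₂.1 : ℝ) ^ 2 ≤ (1 + P) * (1 + P) * (1 + P) ^ 2 := by
        gcongr <;> linarith
      rw [mul_assoc (ξ₁.1 : ℝ), ← div_eq_inv_mul, ← mul_div_assoc, le_div_iff₀ (by positivity)]
      calc _ = ((1 + (ξ₁.1 : ℝ)) * ξ₁.1 * (ξ₂.1 : ℝ) ^ 2) *
            (ξ₁.1 * (C * M * β ξ₁.2.n * β ξ₂.2.n) ^ 2) := by ring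
        _ ≤ ((1 + P) * (1 + P) * (1 + P) ^ 2) *
            (ξ₁.1 * (C * M * β ξ₁.2.n * β ξ₂.2.n) ^ 2) := by gcongr
        _ = _ := by ring
    · rw [Set.indicator_of_notMem hq]
      simp
  · have e1 : ∀ q : Lepton × Lepton × Boson,
        ‖((u q.1 * (u q.2.1 * v q.2.2) : ℝ) : ℂ)‖ₑ ^ 2 =
          ‖u q.1‖ₑ ^ 2 * (‖u q.2.1‖ₑ ^ 2 * ‖v q.2.2‖ₑ ^ 2) := fun q => by
      have : ∀ r : ℝ, ‖(r : ℂ)‖ₑ = ‖r‖ₑ := fun r => by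
        rw [← ofReal_norm, ← ofReal_norm, Complex.norm_real]
      rw [this, enorm_mul, enorm_mul, mul_pow, mul_pow]
    have hu2 : ∫⁻ ξ, ‖u ξ‖ₑ ^ 2 < ⊤ := by
      have e2 : ∀ ξ : Lepton, ‖u ξ‖ₑ ^ 2 = {p : ℝ≥0 | (p : ℝ) ≤ P}.indicator 1 ξ.1 *
          ENNReal.ofReal (β ξ.2.n ^ 2) := fun ξ => by
        by_cases hξ : (ξ.1 : ℝ) ≤ P
        · have : ξ.1 ∈ {p : ℝ≥0 | (p : ℝ) ≤ P} := hξ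
          simp only [u, if_pos hξ, Set.indicator_of_mem this, Pi.one_apply, one_mul]
          rw [← ofReal_norm, ← ENNReal.ofReal_pow (norm_nonneg _), Real.norm_eq_abs, sq_abs]
        · have : ξ.1 ∉ {p : ℝ≥0 | (p : ℝ) ≤ P} := hξ
          simp [u, if_neg hξ, Set.indicator_of_notMem this]
      have hms : MeasurableSet {p : ℝ≥0 | (p : ℝ) ≤ P} :=
        measurableSet_le (by fun_prop) measurable_const
      simp only [e2]
      have e3 := lintegral_prod_mul (μ := (volume : Measure ℝ≥0)) (ν := (volume : Measure AngLabel))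
        (f := {p : ℝ≥0 | (p : ℝ) ≤ P}.indicator 1) (g := fun c => ENNReal.ofReal (β c.n ^ 2))
        (measurable_one.indicator hms).aemeasurable (measurable_of_countable _).aemeasurable
      refine e3.trans_lt (ENNReal.mul_lt_top ?_ (lintegral_angLabel_lt_top hβ))
      rw [lintegral_indicator_one hms]
      exact volume_momentum_lt_top P
    have hv2 : ∫⁻ ξ, ‖v ξ‖ₑ ^ 2 < ⊤ := by
      have e2 : ∀ ξ : Boson, ‖v ξ‖ₑ ^ 2 ≤ (Metric.closedBall (0 : R3) R).indicator
          (fun _ => ‖C * M * (1 + P) ^ 2‖ₑ ^ 2) ξ.1 * 1 := fun ξ => by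
        by_cases hξ : ‖ξ.1‖ ≤ R
        · have : ξ.1 ∈ Metric.closedBall (0 : R3) R := mem_closedBall_zero_iff.2 hξ
          simp only [v, if_pos hξ, Set.indicator_of_mem this, mul_one, le_refl]
        · simp [v, if_neg hξ]
      refine (lintegral_mono e2).trans_lt ?_
      have e3 := lintegral_prod_mul (μ := (volume : Measure R3)) (ν := (volume : Measure Pol))
        (f := (Metric.closedBall (0 : R3) R).indicator
          (fun _ => ‖C * M * (1 + P) ^ 2‖ₑ ^ 2)) (g := fun _ => 1)
        (measurable_const.indicator Metric.isClosed_closedBall.measurableSet).aemeasurable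
        aemeasurable_const
      refine e3.trans_lt (ENNReal.mul_lt_top ?_ ?_)
      · rw [lintegral_indicator_const Metric.isClosed_closedBall.measurableSet]
        exact ENNReal.mul_lt_top (by finiteness) measure_closedBall_lt_top
      · rw [lintegral_one]
        exact Measure.count_apply_lt_top.2 Set.finite_univ
    simp only [e1]
    have e4 := lintegral_prod_mul (μ := (volume : Measure Lepton))
      (ν := (volume : Measure (Lepton × Boson))) (f := fun ξ => ‖u ξ‖ₑ ^ 2)
      (g := fun q => ‖u q.1‖ₑ ^ 2 * ‖v q.2‖ₑ ^ 2) (by fun_prop) (by fun_prop)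
    have e5 := lintegral_prod_mul (μ := (volume : Measure Lepton))
      (ν := (volume : Measure Boson)) (f := fun ξ => ‖u ξ‖ₑ ^ 2)
      (g := fun ξ => ‖v ξ‖ₑ ^ 2) (by fun_prop) (by fun_prop)
    refine e4.trans_lt (ENNReal.mul_lt_top hu2 (e5.trans_lt (ENNReal.mul_lt_top hu2 hv2)))
  · filter_upwards [hG'e] with q hq
    by_cases hqS : q ∈ S
    · rw [show (q.1, q.2.1, q.2.2) = q from rfl, Set.indicator_of_mem hqS, ← hq]
    -- Outside `S` the product must vanish: were it nonzero, the support condition on `G` and the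
    -- bound on `G = G'` would put the point into `S`.
    · rw [show (q.1, q.2.1, q.2.2) = q from rfl, Set.indicator_of_notMem hqS]
      by_contra hne
      have h1 := hsupp _ _ _ (right_ne_zero_of_mul hne)
      exact hqS ⟨h1.1, h1.2.1, h1.2.2, hq ▸ hM _ _ _⟩

theorem exists_momentum_bound {K : Set (ℝ≥0 × ℝ≥0 × R3)} (hK : IsCompact K) :
    ∃ P : ℝ, 0 ≤ P ∧ ∀ q ∈ K, (q.1 : ℝ) ≤ P ∧ (q.2.1 : ℝ) ≤ P ∧ ‖q.2.2‖ ≤ P := by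
  have hc : Continuous fun q : ℝ≥0 × ℝ≥0 × R3 => (q.1 : ℝ) + q.2.1 + ‖q.2.2‖ := by fun_prop
  obtain ⟨B, hB⟩ := hK.exists_bound_of_continuousOn hc.continuousOn
  refine ⟨max B 0, le_max_right _ _, fun q hq => ?_⟩
  have h1 := (le_abs_self _).trans ((hB q hq).trans (le_max_left B 0))
  have h2 := NNReal.coe_nonneg q.1
  have h3 := NNReal.coe_nonneg q.2.1
  have h4 := norm_nonneg q.2.2
  exact ⟨by linarith, by linarith, by linarith⟩

/-- Treats both kernels at once: they differ by complex conjugation of the polarization vector and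
by the sign of the phase, and only the modulus bound on `e` and the vanishing real part of `z`
matter. -/
theorem exists_regularKernel_current {f : ℝ → ℂ} {G1 G2 : Lepton → Lepton → Boson → ℂ}
    (hyp : CutoffHypothesis f G1 G2) {G : Lepton → Lepton → Boson → ℂ}
    (hG : G ∈ ({G1, G2} : Set (Lepton → Lepton → Boson → ℂ))) {e : Fin 4 → Boson → ℂ}
    (he : ∀ μ, Measurable (e μ)) {D : ℝ → ℝ}
    (heb : ∀ R μ (ξ : Boson), ‖ξ.1‖ ≤ R → ‖e μ ξ‖ ≤ D R) {z : ℂ} (hz : z.re = 0) :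
    ∃ F Ft, RegularKernel F Ft ∧ ∀ᵐ q : Lepton × Lepton × Boson,
      currentKernel f e z q.1 q.2.1 q.2.2 * G q.1 q.2.1 q.2.2 = F q.1 q.2.1 q.2.2 := by
  obtain ⟨L, hL, hfL⟩ := hyp.support
  obtain ⟨M, hM⟩ := hyp.bounded G hG
  obtain ⟨K, hK, hKG⟩ := hyp.compact
  obtain ⟨P, hP, hPK⟩ := exists_momentum_bound hK
  have hf := hyp.smooth.continuousOn
  obtain ⟨C, hC⟩ := exists_norm_currentKernel_le hf hL hfL (heb P) hz P
  refine exists_regularKernel (measurable_currentKernel hf he z) (hyp.measurable G hG) hP hM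
    (R := P) (fun ξ₁ ξ₂ ξ₃ hne => ?_) (summable_waveBound P L) hC
  by_contra hcon
  exact hne (hKG G hG ξ₁.1 ξ₁.2 ξ₂.1 ξ₂.2 ξ₃.1 ξ₃.2 fun hmem => hcon (hPK _ hmem))

theorem H_congr (mZ : ℝ) {f : ℝ → ℂ} {ε : Fin 4 → Boson → ℂ}
    {G1 G2 F₁ F₂ : Lepton → Lepton → Boson → ℂ}
    (e1 : ∀ᵐ q : Lepton × Lepton × Boson,
      h1 mZ f ε q.1 q.2.1 q.2.2 * G1 q.1 q.2.1 q.2.2 = F₁ q.1 q.2.1 q.2.2)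
    (e2 : ∀ᵐ q : Lepton × Lepton × Boson,
      h2 mZ f ε q.1 q.2.1 q.2.2 * G2 q.1 q.2.1 q.2.2 = F₂ q.1 q.2.1 q.2.2) (g : ℝ) :
    H mZ f ε G1 G2 g =
      H0 mZ + (g : ℂ) • (HI1 F₁ + HI2 F₂ + (HI1 F₁).adjoint + (HI2 F₂).adjoint) := by
  have i1 : HI1 (fun ξ₁ ξ₂ ξ₃ => h1 mZ f ε ξ₁ ξ₂ ξ₃ * G1 ξ₁ ξ₂ ξ₃) = HI1 F₁ := HI1_congr e1
  have i2 : HI2 (fun ξ₁ ξ₂ ξ₃ => h2 mZ f ε ξ₁ ξ₂ ξ₃ * G2 ξ₁ ξ₂ ξ₃) = HI2 F₂ := HI2_congr e2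
  simp only [H, HI, i1, i2]

end Regularity

end ZDecay

end

/-! ### Conclusion: both kernels are regular, and the abstract coupling result applies -/

theorem theorem2p1 (mZ : ℝ) (hm : 0 < mZ) (f : ℝ → ℂ) (ε : Fin 4 → ZDecay.Boson → ℂ)
    (hε : ZDecay.IsPolarization mZ ε) (G1 G2 : ZDecay.Lepton → ZDecay.Lepton → ZDecay.Boson → ℂ)
    (hyp : ZDecay.CutoffHypothesis f G1 G2) :
    ∃ g₀ : ℝ, 0 < g₀ ∧ ∀ g : ℝ, 0 ≤ g → g ≤ g₀ →
      (ZDecay.H mZ f ε G1 G2 g).domain = (ZDecay.H0 mZ).domain ∧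
        IsSelfAdjoint (ZDecay.H mZ f ε G1 G2 g) := by
  have hω : Measurable fun ξ : ZDecay.Boson => ((√(2 * ZDecay.omega3 mZ ξ.1) : ℝ) : ℂ) := by
    unfold ZDecay.omega3
    fun_prop
  have k1 := ZDecay.exists_regularKernel_current hyp (G := G1) (by simp)
    (e := fun μ ξ => ε μ ξ / (√(2 * ZDecay.omega3 mZ ξ.1) : ℂ))
    (fun μ => (hε.measurable μ).div hω)
    (D := fun R => √(1 + (R / mZ) ^ 2) / √(2 * mZ)) (fun R μ ξ hξ => by
      rw [norm_div]
      exact ZDecay.norm_polarization_div_le hm hε μ ξ hξ) (z := Complex.I) (by simp)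
  have k2 := ZDecay.exists_regularKernel_current hyp (G := G2) (by simp)
    (e := fun μ ξ => (starRingEnd ℂ) (ε μ ξ) / (√(2 * ZDecay.omega3 mZ ξ.1) : ℂ))
    (fun μ => (Complex.continuous_conj.measurable.comp (hε.measurable μ)).div hω)
    (D := fun R => √(1 + (R / mZ) ^ 2) / √(2 * mZ)) (fun R μ ξ hξ => by
      rw [norm_div, RCLike.norm_conj]
      exact ZDecay.norm_polarization_div_le hm hε μ ξ hξ) (z := -Complex.I) (by simp)
  obtain ⟨F₁, Ft₁, r1, e1⟩ := k1
  obtain ⟨F₂, Ft₂, r2, e2⟩ := k2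
  have h := ZDecay.exists_coupling_of_regularKernel hm r1 r2
  obtain ⟨g₀, hg₀, h⟩ := h
  refine ⟨g₀, hg₀, fun g hg hg' => ?_⟩
  have hH : ZDecay.H mZ f ε G1 G2 g = _ := ZDecay.H_congr mZ e1 e2 g
  rw [hH]
  exact h g hg hg'
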